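/- Let $\Bbbk$ be a field and let $Q$ be a toupie quiver: a finite connected quiver with exactly one source $0$ and exactly one sink $\omega$, in which every other vertex is the source of exactly one arrow and the target of exactly one arrow. Paths are written from left to right; the paths from $0$ to $\omega$ are called branches. Let $I\subseteq \Bbbk Q$ be an admissible ideal, $A=\Bbbk Q/I$ and $E=\Bbbk Q_0$. Fix a total order of the paths such that longer paths are larger (only the order of the branches matters). The tip $\mathrm{Tip}(g)$ of $g\neq 0$ is the largest path in its support $\mathrm{Supp}(g)$, and $c(q)$ denotes the coefficient of a path $q$ in $g$. Let $\mathcal G$ be a minimal set of generators of $I$ that consists of paths (monomial relations) and of linear combinations $\rho$ of at least two branches (non-monomial relations), where the non-monomial relations are in reduced row echelon form (each has tip coefficient $1$, and its tip occurs in no other one) and the branches in them contain no monomial relation of $\mathcal G$. Put $W=\mathrm{Tip}(\mathcal G)$. Let $\langle W\rangle$ be the set of paths that contain an element of $W$, and let $\mathrm{NonTip}(I)$ be the set of all other paths. For $w\in W$ let $\mathrm{Tip}^{-1}(w)$ be the element of $\mathcal G$ with tip $w$. *Bar construction.* A bar term $[w_1|\cdots|w_n]$ ($n\ge 1$) is a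 sequence of composable paths of positive length in $\mathrm{NonTip}(I)$; for $n=0$ the bar terms are the vertices of $Q$. The classes of the paths in $\mathrm{NonTip}(I)$ form a basis of $A$. Let $\mathbb B'_*=E\otimes_A\mathbb B_*\otimes_A E$, where $\mathbb B_*$ is the reduced bar resolution of $A$: the complex whose $n$-th term $\overline A^{\otimes_E n}$ ($E$ for $n=0$) has the bar terms of length $n$ as a basis, with differential $d[w_1|\cdots|w_n]=\sum_{i=1}^{n-1}(-1)^i[w_1|\cdots|w_iw_{i+1}|\cdots|w_n]$, the products being taken in $A$ and expanded in this basis. *Chains.* The graph $Q_W$ has as vertices the vertices of $Q$, the arrows of $Q$ and the proper right factors of elements of $W$. It has an arrow $e\to x$ for each arrow $x$ of $Q$ starting at the vertex $e$, and an arrow $u\to v$ whenever $uv\in\langle W\rangle$ and no proper left factor of $uv$ lies in $\langle W\rangle$. A bar term $[w_0|\cdots|w_r]$ is an $r$-chain if $e\to w_0\to\cdots\to w_r$ is a path in $Q_W$ for a vertex $e$ of $Q$; the vertices of $Q$ are the $(-1)$-chains. Let $\mathbb T_n$ be the vector space with basis the $(n-1)$-chains. *Matching.* Let $\mathcal M$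 consist of the arrows $$[w_1|\cdots|w_j|a|b|w_{j+2}|\cdots|w_n]\longrightarrow[w_1|\cdots|w_j|ab|w_{j+2}|\cdots|w_n]$$ of the weighted quiver of $\mathbb B'_*$ (vertices: the bar terms; the weight of $x\to y$ is the coefficient of $y$ in $dx$) such that $[w_1|\cdots|w_j]$ and $[w_1|\cdots|w_j|a]$ are chains while $[w_1|\cdots|w_j|ab]$ and $[w_1|\cdots|w_j|a|b]$ are not. Replace every arrow of $\mathcal M$ by a reversed (dotted) arrow whose weight is the negative inverse of the original one; the other arrows are called thick. Let $\Gamma(x,y)$ be the sum of the weights (products of the weights of the arrows) of all paths from $x$ to $y$, including the path of length zero if $x=y$, in which dotted and thick arrows alternate. Let $$p:\mathbb B'_n\to\mathbb T_n,\qquad i:\mathbb T_n\to\mathbb B'_n,\qquad h:\mathbb B'_n\to\mathbb B'_{n+1}$$ be the maps $x\mapsto\sum_y\Gamma(x,y)\,y$, where $y$ runs over the $(n-1)$-chains, the bar terms of length $n$, and the bar terms of length $n+1$, respectively. *Splitting.* Call $\gamma=[w_0|\cdots|w_r]$ attached if $w_{j-1}w_j\in\langle W\rangle$ for $1\le j\le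 r$. Put $\Gamma^0=\gamma$. As long as $\Gamma^{s-1}=[v_0|\cdots|v_r]$ is neither a chain nor zero, let $i_s$ be the largest index such that $v_{i_s}=v'v''$ with $v',v''$ of positive length and $[v_0|\cdots|v_{i_s-1}|v']$ a chain, and put $$\gamma^s=(-1)^{i_s}[v_0|\cdots|v_{i_s-1}|v'|v''|v_{i_s+1}|\cdots|v_r],\qquad \Gamma^s=[v_0|\cdots|v_{i_s-1}|v'|v''v_{i_s+1}|v_{i_s+2}|\cdots|v_r],$$ where $\Gamma^s=0$ if $v''v_{i_s+1}=0$ in $A$ or if $i_s=r$. **Lemma.** The set $\mathcal M$ is a Morse matching (its arrows have invertible weights, every bar term lies on at most one of them, and there are no infinite zigzag paths) whose critical vertices are exactly the chains; there are only finitely many zigzag paths from each bar term, and the differential of the Morse complex $\mathbb T_*$ is zero. The maps $p$ and $i$ are chain maps (with zero differential on $\mathbb T_*$), and $$pi=\mathrm{id},\quad ip-\mathrm{id}=dh+hd,\quad h^2=0,\quad hi=0,\quad ph=0,$$ that is, $(p,i,-h)$ is a strong deformation retract datum in the convention $\mathrm{id}-ip=dh+hd$. In particular $i$ induces an isomorphism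 from $\mathbb T_*$ to $H_*(\mathbb B'_*)=\mathrm{Tor}^A_*(E,E)$. Moreover: 1. For every attached bar term $\gamma=[w_0|\cdots|w_r]$ the splitting procedure stops, with some terms $\gamma^1,\dots,\gamma^n$ and $\Gamma^n$ (where $\Gamma^n$ is a chain or zero), and $$h(\gamma)=\sum_{s=1}^n\gamma^s,\qquad p(\gamma)=\Gamma^n.$$ 2. For an $r$-chain $w$ with $r\ne1$ one has $i(w)=w$. For a $1$-chain $w=[w_0|w_1]$ there is exactly one element of $\mathcal G$ with tip $w_0w_1$, and $$i(w)=\sum_{p_1p_2\in\mathrm{Supp}(\mathrm{Tip}^{-1}(w_0w_1)),\ p_1\in Q_1}c(p_1p_2)\,[p_1|p_2].$$ -/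

import Mathlib

noncomputable section

namespace Toupie

/-! ### Paths and the path algebra -/

/-- A path of the quiver `V`, with its source and its terminus. Paths are written from left to
right. -/
@[ext]
structure QPath (V : Type*) [Quiver V] where
  {src : V}
  {tgt : V}
  path : Quiver.Path src tgt

namespace QPath

variable {V : Type*} [Quiver V]

/-- The length of a path. -/
def length (p : QPath V) : ℕ := p.path.length

/-- The trivial path at a vertex. -/
def triv (v : V) : QPath V := ⟨(Quiver.Path.nil : Quiver.Path v v)⟩

open Classical in
/-- The concatenation `p q`, defined if `p` ends where `q` starts. -/
def concat (p q : QPath V) : Option (QPath V) :=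
  if h : p.tgt = q.src then some ⟨p.path.comp (q.path.cast h.symm rfl)⟩ else none

/-- `t` is a subpath (a factor) of `p`: `p = a t b`. -/
def Divides (t p : QPath V) : Prop :=
  ∃ a m b : QPath V, concat a t = some m ∧ concat m b = some p

theorem concat_of_ne {p q : QPath V} (h : p.tgt ≠ q.src) : concat p q = none := by
  simp [concat, h]

theorem concat_mk {a b c : V} (p : Quiver.Path a b) (q : Quiver.Path b c) :
    concat (⟨p⟩ : QPath V) ⟨q⟩ = some ⟨p.comp q⟩ := by
  simp [concat]

theorem concat_assoc (p q r : QPath V) :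
    (concat p q).bind (fun m => concat m r) = (concat q r).bind (fun m => concat p m) := by
  obtain ⟨p⟩ := p
  rename_i a b
  obtain ⟨q⟩ := q
  rename_i c d
  obtain ⟨r⟩ := r
  rename_i e f
  by_cases h : b = c
  · subst h
    by_cases h' : d = e
    · subst h'
      simp [concat_mk, Quiver.Path.comp_assoc]
    · rw [concat_mk, concat_of_ne (by simpa using h')]
      simp [concat_of_ne, h']
  · rw [concat_of_ne (by simpa using h)]
    by_cases h' : d = e
    · subst h'
      simp [concat_mk, concat_of_ne, h]
    · simp [concat_of_ne, h']

theorem triv_concat (p : QPath V) : concat (triv p.src) p = some p := by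
  obtain ⟨p⟩ := p
  simp [triv, concat_mk]

theorem concat_triv (p : QPath V) : concat p (triv p.tgt) = some p := by
  obtain ⟨p⟩ := p
  simp [triv, concat_mk]

end QPath

open QPath

/-- The path algebra `kQ`: linear combinations of paths. -/
def PathAlgebra (k V : Type*) [Field k] [Quiver V] : Type _ := QPath V →₀ k

section PathAlgebra

variable (k : Type*) {V : Type*} [Field k] [Quiver V]

instance : AddCommGroup (PathAlgebra k V) := inferInstanceAs (AddCommGroup (QPath V →₀ k))
instance : Module k (PathAlgebra k V) := inferInstanceAs (Module k (QPath V →₀ k))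

/-- A path, as an element of `kQ`. -/
def ofPath (p : QPath V) : PathAlgebra k V := Finsupp.single p (1 : k)

variable {k} in
/-- The coefficient `c(p)` of the path `p` in `x`. -/
def coeff (x : PathAlgebra k V) (p : QPath V) : k := (show QPath V →₀ k from x) p

variable {k} in
/-- The support `Supp(x)`. -/
def supp (x : PathAlgebra k V) : Finset (QPath V) := (show QPath V →₀ k from x).support

/-- The product of two paths in `kQ`: their concatenation, or `0` if they do not compose. -/
def pathMul (p q : QPath V) : PathAlgebra k V := (concat p q).elim 0 (ofPath k)

/-- The multiplication of `kQ`, as a bilinear map. -/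
def mulLin : PathAlgebra k V →ₗ[k] PathAlgebra k V →ₗ[k] PathAlgebra k V :=
  Finsupp.linearCombination k
    (fun p : QPath V => (Finsupp.linearCombination k (fun q : QPath V => pathMul k p q) :
      (QPath V →₀ k) →ₗ[k] PathAlgebra k V))

theorem mulLin_ofPath (p q : QPath V) : mulLin k (ofPath k p) (ofPath k q) = pathMul k p q := by
  have h1 : mulLin k (ofPath k p) = (Finsupp.linearCombination k
      (fun q : QPath V => pathMul k p q) : (QPath V →₀ k) →ₗ[k] PathAlgebra k V) := by
    exact (Finsupp.linearCombination_single k _ _).trans (one_smul _ _)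
  rw [h1]
  exact (Finsupp.linearCombination_single k _ _).trans (one_smul _ _)

theorem lin_ext {M : Type*} [AddCommMonoid M] [Module k M] {f g : PathAlgebra k V →ₗ[k] M}
    (h : ∀ p, f (ofPath k p) = g (ofPath k p)) : f = g :=
  Finsupp.lhom_ext' (M := k) (fun p => LinearMap.ext_ring (h p))

instance : Mul (PathAlgebra k V) := ⟨fun x y => mulLin k x y⟩

theorem mul_def (x y : PathAlgebra k V) : x * y = mulLin k x y := rfl

theorem ofPath_mul (p q : QPath V) : ofPath k p * ofPath k q = pathMul k p q :=
  mulLin_ofPath k p q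

theorem lin_induction {P : PathAlgebra k V → Prop} (x : PathAlgebra k V) (h0 : P 0)
    (hadd : ∀ y z, P y → P z → P (y + z)) (hs : ∀ (c : k) (p : QPath V), P (c • ofPath k p)) :
    P x := by
  refine Finsupp.induction_linear (motive := P) x h0 hadd fun p c => ?_
  have h : (Finsupp.single p c : QPath V →₀ k) = c • Finsupp.single p (1 : k) := by simp
  have h' := hs c p
  rw [h]
  exact h'

theorem mul_assoc_ofPath (p q r : QPath V) :
    ofPath k p * ofPath k q * ofPath k r = ofPath k p * (ofPath k q * ofPath k r) := by
  have h := congrArg (fun o : Option (QPath V) => o.elim 0 (ofPath k)) (concat_assoc p q r)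
  have e1 : ofPath k p * ofPath k q * ofPath k r =
      ((concat p q).bind (fun m => concat m r)).elim 0 (ofPath k) := by
    rw [ofPath_mul, pathMul]
    cases concat p q with
    | none => simp [mul_def]
    | some m => simp [ofPath_mul, pathMul]
  have e2 : ofPath k p * (ofPath k q * ofPath k r) =
      ((concat q r).bind (fun m => concat p m)).elim 0 (ofPath k) := by
    rw [ofPath_mul k q r, pathMul]
    cases concat q r with
    | none => simp [mul_def]
    | some m => simp [ofPath_mul, pathMul]
  rw [e1, e2]
  exact h

theorem smul_mul_aux (c : k) (x y : PathAlgebra k V) : c • x * y = c • (x * y) := by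
  simp [mul_def]

theorem mul_smul_aux (c : k) (x y : PathAlgebra k V) : x * c • y = c • (x * y) := by
  simp [mul_def]

instance : NonUnitalRing (PathAlgebra k V) where
  left_distrib x y z := by simp [mul_def]
  right_distrib x y z := by simp [mul_def]
  zero_mul x := by simp [mul_def]
  mul_zero x := by simp [mul_def]
  mul_assoc x y z := by
    have hd : ∀ a b c : PathAlgebra k V, (a + b) * c = a * c + b * c := by simp [mul_def]
    have hd' : ∀ a b c : PathAlgebra k V, a * (b + c) = a * b + a * c := by simp [mul_def]
    have h0 : ∀ a : PathAlgebra k V, 0 * a = 0 := by simp [mul_def]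
    have h0' : ∀ a : PathAlgebra k V, a * 0 = 0 := by simp [mul_def]
    induction x using lin_induction with
    | h0 => simp only [h0]
    | hadd a b ha hb => simp only [hd, ha, hb]
    | hs c p =>
      induction y using lin_induction with
      | h0 => simp only [h0, h0']
      | hadd a b ha hb => simp only [hd, hd', ha, hb]
      | hs c' q =>
        induction z using lin_induction with
        | h0 => simp only [h0']
        | hadd a b ha hb => simp only [hd', ha, hb]
        | hs c'' r => simp only [smul_mul_aux, mul_smul_aux, mul_assoc_ofPath]

/-- The unit of `kQ` is the sum of the trivial paths. -/
instance [Fintype V] : One (PathAlgebra k V) := ⟨∑ v : V, ofPath k (triv v)⟩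

theorem triv_mul (v : V) (p : QPath V) (h : v ≠ p.src) :
    ofPath k (triv v) * ofPath k p = 0 := by
  rw [ofPath_mul, pathMul, concat_of_ne (p := triv v) h]; rfl

theorem mul_triv (v : V) (p : QPath V) (h : p.tgt ≠ v) :
    ofPath k p * ofPath k (triv v) = 0 := by
  rw [ofPath_mul, pathMul, concat_of_ne (q := triv v) h]; rfl

instance [Fintype V] : Ring (PathAlgebra k V) where
  __ := (inferInstance : NonUnitalRing (PathAlgebra k V))
  one_mul x := by
    induction x using lin_induction with
    | h0 => exact mul_zero _
    | hadd a b ha hb => rw [mul_add, ha, hb]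
    | hs c p =>
      rw [mul_smul_aux]
      congr 1
      change (∑ v : V, ofPath k (triv v)) * ofPath k p = _
      rw [Finset.sum_mul, Finset.sum_eq_single p.src]
      · rw [ofPath_mul, pathMul, triv_concat]; rfl
      · intro v _ hv
        exact triv_mul k v p hv
      · simp
  mul_one x := by
    induction x using lin_induction with
    | h0 => exact zero_mul _
    | hadd a b ha hb => rw [add_mul, ha, hb]
    | hs c p =>
      rw [smul_mul_aux]
      congr 1
      change ofPath k p * (∑ v : V, ofPath k (triv v)) = _
      rw [Finset.mul_sum, Finset.sum_eq_single p.tgt]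
      · rw [ofPath_mul, pathMul, concat_triv]; rfl
      · intro v _ hv
        exact mul_triv k v p hv.symm
      · simp

instance [Fintype V] : Algebra k (PathAlgebra k V) :=
  Algebra.ofModule (smul_mul_aux k) (mul_smul_aux k)

end PathAlgebra

/-! ### Toupie quivers, admissible ideals, and the generators of the ideal -/

/-- A toupie quiver with source `o` and sink `ω`: a connected quiver in which `o` is the only
source, `ω` is the only sink, and every other vertex is the source of exactly one arrow and the
target of exactly one arrow. -/
structure IsToupie (V : Type*) [Quiver V] (o ω : V) : Prop where
  source_iff : ∀ v : V, (∀ a : V, IsEmpty (a ⟶ v)) ↔ v = o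
  sink_iff : ∀ v : V, (∀ b : V, IsEmpty (v ⟶ b)) ↔ v = ω
  one_in : ∀ v : V, v ≠ o → v ≠ ω → ∃! _e : (Σ a : V, (a ⟶ v)), True
  one_out : ∀ v : V, v ≠ o → v ≠ ω → ∃! _e : (Σ b : V, (v ⟶ b)), True
  connected : ∀ a b : V,
    Nonempty (Quiver.Path (V := Quiver.Symmetrify V) a b)

section Relations

variable {k V : Type*} [Field k] [Quiver V] [Fintype V]

/-- An admissible ideal: it is contained in the span of the paths of length at least two, and
contains all paths that are long enough. -/
structure IsAdmissible (I : TwoSidedIdeal (PathAlgebra k V)) : Prop where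
  two_le : ∀ x ∈ I, ∀ p ∈ supp x, 2 ≤ p.length
  long_mem : ∃ m : ℕ, 2 ≤ m ∧ ∀ p : QPath V, m ≤ p.length → ofPath k p ∈ I

/-- `t` is the tip of `x`: the largest path in the support of `x`. -/
def IsTip [LinearOrder (QPath V)] (x : PathAlgebra k V) (t : QPath V) : Prop :=
  t ∈ supp x ∧ ∀ q ∈ supp x, q ≤ t

/-- The non monomial elements. -/
def IsNonMonomial (x : PathAlgebra k V) : Prop := 2 ≤ (supp x).card

/-- `G` is a minimal set of generators of the ideal `I`, consisting of monomial relations and of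
non monomial relations between branches; the non monomial relations are in reduced row echelon
form for the given order of the branches, and the branches that they involve contain no monomial
relation of `G`. -/
structure IsToupieGenerators [LinearOrder (QPath V)] (o ω : V)
    (I : TwoSidedIdeal (PathAlgebra k V)) (G : Set (PathAlgebra k V)) : Prop where
  span_eq : TwoSidedIdeal.span G = I
  minimal : ∀ S : Set (PathAlgebra k V), S ⊂ G → TwoSidedIdeal.span S ≠ I
  monomial_or : ∀ g ∈ G, (∃ p : QPath V, g = ofPath k p) ∨ IsNonMonomial g
  branches : ∀ g ∈ G, IsNonMonomial g → ∀ q ∈ supp g, q.src = o ∧ q.tgt = ω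
  monic : ∀ g ∈ G, IsNonMonomial g → ∀ t : QPath V, IsTip g t → coeff g t = 1
  reduced : ∀ g ∈ G, ∀ g' ∈ G, IsNonMonomial g → IsNonMonomial g' → g ≠ g' →
    ∀ t : QPath V, IsTip g t → coeff g' t = 0
  no_monomial : ∀ g ∈ G, IsNonMonomial g → ∀ q ∈ supp g, ∀ m : QPath V, ofPath k m ∈ G →
    ¬ Divides m q

variable [LinearOrder (QPath V)]

/-- `W = Tip(G)`. -/
def TipSet (G : Set (PathAlgebra k V)) : Set (QPath V) := {t | ∃ g ∈ G, IsTip g t}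

/-- The path `p` lies in the monomial ideal `⟨Tip(G)⟩`. -/
def InTipIdeal (G : Set (PathAlgebra k V)) (p : QPath V) : Prop :=
  ∃ t ∈ TipSet G, Divides t p

/-- `NonTip(I)`: the paths that contain no element of `Tip(G)`. -/
def NonTip (G : Set (PathAlgebra k V)) (p : QPath V) : Prop := ¬ InTipIdeal G p

/-- The quiver algebra `A = kQ/I`. -/
abbrev QuiverAlgebra (I : TwoSidedIdeal (PathAlgebra k V)) : Type _ := I.ringCon.Quotient

/-- `y` is a linear combination of paths in `NonTip(I)` that represents the class of `x` in
`A = kQ/I`. -/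
def IsNormalForm (I : TwoSidedIdeal (PathAlgebra k V)) (G : Set (PathAlgebra k V))
    (x y : PathAlgebra k V) : Prop :=
  (∀ q ∈ supp y, NonTip G q) ∧ (y : QuiverAlgebra I) = (x : QuiverAlgebra I)

open Classical in
/-- The class of `x` in `A`, written in the basis `NonTip(I)` of `A`. -/
def normalForm (I : TwoSidedIdeal (PathAlgebra k V)) (G : Set (PathAlgebra k V))
    (x : PathAlgebra k V) : PathAlgebra k V :=
  if h : ∃ y, IsNormalForm I G x y then h.choose else 0

/-! ### The bar construction -/

/-- `[w_1|⋯|w_n]`, starting at the vertex `v`, is a bar term: the `w_i` are composable paths of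
positive length in `NonTip(I)`. For `n = 0` the bar term is just the vertex `v`. -/
def IsBarTerm (G : Set (PathAlgebra k V)) : V → List (QPath V) → Prop
  | _, [] => True
  | v, w :: l => w.src = v ∧ 0 < w.length ∧ NonTip G w ∧ IsBarTerm G w.tgt l

/-- The set of all bar terms. -/
def BarTerm (G : Set (PathAlgebra k V)) : Type _ :=
  {c : V × List (QPath V) // IsBarTerm G c.1 c.2}

/-- The homological degree of `[w_1|⋯|w_n]` is `n`. -/
def BarTerm.deg {G : Set (PathAlgebra k V)} (c : BarTerm G) : ℕ := c.1.2.length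

/-- The bar construction `E ⊗_A B_* ⊗_A E`, where `B_*` is the reduced bar resolution: its part of
degree `n` is `Ā ⊗_E ⋯ ⊗_E Ā` (`n` factors; `E = kQ_0` if `n = 0`), with the bar terms
`[w_1|⋯|w_n]` as a basis. -/
abbrev Bar (G : Set (PathAlgebra k V)) : Type _ := BarTerm G →₀ k

open Classical in
/-- The element `[w_1|⋯|w_n]` of the bar construction (`0` if this is not a bar term). -/
def bar (G : Set (PathAlgebra k V)) (v : V) (l : List (QPath V)) : Bar G :=
  if h : IsBarTerm G v l then Finsupp.single ⟨(v, l), h⟩ 1 else 0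

/-- `[u|ab|t]`, where the product `ab` is taken in `A` and expanded in the basis `NonTip(I)`. -/
def contract (I : TwoSidedIdeal (PathAlgebra k V)) (G : Set (PathAlgebra k V)) (v : V)
    (u : List (QPath V)) (a b : QPath V) (t : List (QPath V)) : Bar G :=
  ∑ q ∈ supp (normalForm I G (ofPath k a * ofPath k b)),
    coeff (normalForm I G (ofPath k a * ofPath k b)) q • bar G v (u ++ q :: t)

/-- The sum of the `(-1)^i [w_1|⋯|w_i w_{i+1}|⋯|w_n]` over all `i` greater than the length of
`u`, for `[w_1|⋯|w_n] = [u|l]`. -/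
def faces (I : TwoSidedIdeal (PathAlgebra k V)) (G : Set (PathAlgebra k V)) (v : V) :
    List (QPath V) → List (QPath V) → Bar G
  | u, a :: b :: t =>
      (-1 : k) ^ (u.length + 1) • contract I G v u a b t + faces I G v (u ++ [a]) (b :: t)
  | _, _ => 0

/-- The differential
`d [w_1|⋯|w_n] = ∑_{0 < i < n} (-1)^i [w_1|⋯|w_i w_{i+1}|⋯|w_n]`. -/
def barD (I : TwoSidedIdeal (PathAlgebra k V)) (G : Set (PathAlgebra k V)) :
    Bar G →ₗ[k] Bar G :=
  Finsupp.linearCombination k fun c : BarTerm G => faces I G c.1.1 [] c.1.2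

/-! ### Anick chains and the Anick matching -/

/-- The vertices of the Ufnarovskii graph `Q_W`. -/
def UfVertex (G : Set (PathAlgebra k V)) (u : QPath V) : Prop :=
  u.length = 0 ∨ u.length = 1 ∨
    ∃ t ∈ TipSet G, ∃ a : QPath V, 1 ≤ a.length ∧ concat a u = some t

/-- The arrows `u → v` of the Ufnarovskii graph `Q_W`. -/
def UfEdge (G : Set (PathAlgebra k V)) (u v : QPath V) : Prop :=
  (u = triv v.src ∧ v.length = 1) ∨
  (UfVertex G u ∧ UfVertex G v ∧ ∃ m : QPath V, concat u v = some m ∧ InTipIdeal G m ∧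
    ∀ w p : QPath V, concat w p = some m → 1 ≤ p.length → ¬ InTipIdeal G w)

/-- `[w_1|⋯|w_n]` is an Anick chain (an `(n-1)`-chain): the `w_i` are of positive length and in
`NonTip(I)`, and `e → w_1 → ⋯ → w_n` is a path in `Q_W`, where `e` is a vertex. -/
def IsChain (G : Set (PathAlgebra k V)) : List (QPath V) → Prop
  | [] => True
  | w :: l => (∀ x ∈ w :: l, 0 < x.length ∧ NonTip G x) ∧
      List.IsChain (UfEdge G) (triv w.src :: w :: l)

/-- The arrows `x → y` of the Anick matching:
`[w_1|⋯|w_{i+1}|a|b|w_{i+3}|⋯|w_n] → [w_1|⋯|w_{i+1}|ab|w_{i+3}|⋯|w_n]`, where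
`u = [w_1|⋯|w_{i+1}]` is the longest chain with which the second term starts, and `[u|a]` is the
longest chain with which the first term starts. -/
def AnickMatching (G : Set (PathAlgebra k V)) (x y : BarTerm G) : Prop :=
  ∃ (u : List (QPath V)) (a b w : QPath V) (t : List (QPath V)),
    concat a b = some w ∧ x.1.1 = y.1.1 ∧ x.1.2 = u ++ a :: b :: t ∧ y.1.2 = u ++ w :: t ∧
    IsChain G u ∧ ¬ IsChain G (u ++ [w]) ∧ IsChain G (u ++ [a]) ∧ ¬ IsChain G (u ++ [a, b])

/-- The bar terms that are Anick chains: the `n`-th part is `W^{(n-1)}`. -/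
def Chain (G : Set (PathAlgebra k V)) : Type _ := {c : BarTerm G // IsChain G c.1.2}

/-- The homological degree. -/
def Chain.deg {G : Set (PathAlgebra k V)} (c : Chain G) : ℕ := BarTerm.deg c.1

/-- The graded vector space `T_*`, with `T_n = kW^{(n-1)}`. -/
abbrev Tor (G : Set (PathAlgebra k V)) : Type _ := Chain G →₀ k

open Classical in
/-- The element of `T_*` given by a chain (`0` if it is not a chain). -/
def tor (G : Set (PathAlgebra k V)) (v : V) (l : List (QPath V)) : Tor G :=
  if h : IsBarTerm G v l ∧ IsChain G l then Finsupp.single ⟨⟨(v, l), h.1⟩, h.2⟩ 1 else 0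

/-! ### Attached bar terms and the splitting algorithm -/

/-- `[w_0|⋯|w_r]` is attached: every product `w_{i-1} w_i` is divisible by a tip. -/
def IsAttached (G : Set (PathAlgebra k V)) (l : List (QPath V)) : Prop :=
  List.IsChain (fun a b => ∃ m : QPath V, concat a b = some m ∧ InTipIdeal G m) l

/-- `l = [u|ab|t]`, where `a` and `b` have positive length and `[u|a]` is a chain. -/
def IsSplit (G : Set (PathAlgebra k V)) (l u : List (QPath V)) (a b : QPath V)
    (t : List (QPath V)) : Prop :=
  ∃ w : QPath V, concat a b = some w ∧ l = u ++ w :: t ∧ 0 < a.length ∧ 0 < b.length ∧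
    IsChain G (u ++ [a])

/-- `l = [u|ab|t]` as above, where the place of `ab` is the largest possible one. -/
def IsMaxSplit (G : Set (PathAlgebra k V)) (l u : List (QPath V)) (a b : QPath V)
    (t : List (QPath V)) : Prop :=
  IsSplit G l u a b t ∧ ∀ u' a' b' t', IsSplit G l u' a' b' t' → u'.length ≤ u.length

/-- `Splitting I G v l γs Γ`: the splitting algorithm, started with the bar term `l` (with source
`v`), produces the list `γs = (γ^1, …, γ^n)` and ends with `Γ = Γ^n`, which is a chain or `0`.
If `l = [u|w|c|t]` is not a chain, where `w = ab` is the last place such that `[u|a]` is a chain,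
then `γ^1 = (-1)^{|u|} [u|a|b|c|t]` and `Γ^1 = [u|a|bc|t]`. One has `Γ^1 = 0` if `bc = 0` in `A`
or if `w` is the last entry of `l`. -/
inductive Splitting (I : TwoSidedIdeal (PathAlgebra k V)) (G : Set (PathAlgebra k V)) (v : V) :
    List (QPath V) → List (Bar G) → Tor G → Prop
  | chain (l : List (QPath V)) : IsChain G l → Splitting I G v l [] (tor G v l)
  | last (l u : List (QPath V)) (a b : QPath V) : ¬ IsChain G l → IsMaxSplit G l u a b [] →
      Splitting I G v l [(-1 : k) ^ u.length • bar G v (u ++ [a, b])] 0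
  | zero (l u : List (QPath V)) (a b c : QPath V) (t : List (QPath V)) : ¬ IsChain G l →
      IsMaxSplit G l u a b (c :: t) → ofPath k b * ofPath k c ∈ I →
      Splitting I G v l [(-1 : k) ^ u.length • bar G v (u ++ a :: b :: c :: t)] 0
  | step (l u : List (QPath V)) (a b c m : QPath V) (t : List (QPath V)) (γs : List (Bar G))
      (Γ : Tor G) : ¬ IsChain G l →
      IsMaxSplit G l u a b (c :: t) → ofPath k b * ofPath k c ∉ I → concat b c = some m →
      Splitting I G v (u ++ a :: m :: t) γs Γ →
      Splitting I G v l ((-1 : k) ^ u.length • bar G v (u ++ a :: b :: c :: t) :: γs) Γ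

end Relations

/-! ### Algebraic Morse theory, for complexes with a basis -/

section Morse

variable {k ι : Type*} [Field k] (d : (ι →₀ k) →ₗ[k] (ι →₀ k)) (M : ι → ι → Prop)

/-- The weight of `x → y` in the weighted quiver of the complex: the coefficient of `y` in `d x`.
There is an arrow `x → y` if it is not zero. -/
def wt (x y : ι) : k := d (Finsupp.single x 1) y

/-- The arrows `x → y` of the modified quiver: the dotted ones (the reversed arrows of the
matching) for `true`, the thick ones (the arrows that are not in the matching) for `false`. -/
def MorseArrow : Bool → ι → ι → Prop
  | true, x, y => M y x
  | false, x, y => wt d x y ≠ 0 ∧ ¬ M x y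

/-- `x → l_1 → l_2 → ⋯` is a path in which dotted and thick arrows alternate; the first arrow is
dotted if the argument is `true`, and thick otherwise. -/
def IsAlternating : Bool → ι → List ι → Prop
  | _, _, [] => True
  | b, x, y :: l => MorseArrow d M b x y ∧ IsAlternating (!b) y l

/-- The zigzag paths that start at `x` (`l` lists the further vertices). -/
def IsZigzag (x : ι) (l : List ι) : Prop :=
  IsAlternating d M true x l ∨ IsAlternating d M false x l

open Classical in
/-- The weight of an arrow of the modified quiver. -/
def arrowWeight (x y : ι) : k := if M y x then -(wt d y x)⁻¹ else wt d x y

/-- The weight of a path of the modified quiver. -/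
def pathWeight : ι → List ι → k
  | _, [] => 1
  | x, y :: l => arrowWeight d M x y * pathWeight y l

/-- `Γ(x, y)`: the sum of the weights of all zigzag paths from `x` to `y`. -/
def zigzagSum (x y : ι) : k :=
  ∑ᶠ l ∈ {l : List ι | IsZigzag d M x l ∧ l.getLastD x = y}, pathWeight d M x l

/-- `M` is a Morse matching: its arrows are arrows of the weighted quiver with invertible weights,
every vertex lies on at most one of them, and every zigzag path has finite length. -/
structure IsMorseMatching : Prop where
  invertible : ∀ x y, M x y → IsUnit (wt d x y)
  matching : ∀ x y x' y', M x y → M x' y' → (x = x' ∨ x = y' ∨ y = x' ∨ y = y') →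
    x = x' ∧ y = y'
  finite : ∀ (f : ℕ → ι) (b : Bool),
    ¬ ∀ n, MorseArrow d M (if Even n then b else !b) (f n) (f (n + 1))

/-- The critical vertices: those on no arrow of the matching. -/
def IsCritical (x : ι) : Prop := ∀ y, ¬ M x y ∧ ¬ M y x

variable (deg : ι → ℕ) (S : ι → Prop)

/-- `h x = ∑ Γ(x, y) y`, over all `y` of degree one more than `x`. -/
def morseH : (ι →₀ k) →ₗ[k] (ι →₀ k) :=
  Finsupp.linearCombination k fun x =>
    ∑ᶠ (y : ι) (_ : deg y = deg x + 1), Finsupp.single y (zigzagSum d M x y)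

/-- `p x = ∑ Γ(x, y) y`, over all `y` in `S` of the same degree as `x`; here `S` is the set of
critical vertices. -/
def morseP : (ι →₀ k) →ₗ[k] ({x // S x} →₀ k) :=
  Finsupp.linearCombination k fun x =>
    ∑ᶠ (y : {x // S x}) (_ : deg y.1 = deg x), Finsupp.single y (zigzagSum d M x y.1)

/-- `i x = ∑ Γ(x, y) y`, over all `y` of the same degree as `x`, for `x` in `S`. -/
def morseI : ({x // S x} →₀ k) →ₗ[k] (ι →₀ k) :=
  Finsupp.linearCombination k fun x =>
    ∑ᶠ (y : ι) (_ : deg y = deg x.1), Finsupp.single y (zigzagSum d M x.1 y)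

/-- The differential `x ↦ ∑ Γ(x, y) y` of the Morse complex, over all `y` in `S` of degree one
less than `x`. -/
def morseD : ({x // S x} →₀ k) →ₗ[k] ({x // S x} →₀ k) :=
  Finsupp.linearCombination k fun x =>
    ∑ᶠ (y : {x // S x}) (_ : deg y.1 + 1 = deg x.1), Finsupp.single y (zigzagSum d M x.1 y.1)

end Morse

/-! ### Strong deformation retracts -/

section SDR

variable {k ι κ : Type*} [Field k]

/-- A linear map between graded vector spaces (with bases of homogeneous elements) is homogeneous
of degree `j`. -/
def IsHomog (degι : ι → ℕ) (degκ : κ → ℕ) (j : ℤ) (f : (ι →₀ k) →ₗ[k] (κ →₀ k)) : Prop :=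
  ∀ x, ∀ y ∈ (f (Finsupp.single x 1)).support, (degκ y : ℤ) = degι x + j

/-- `(p, i, h)` is a strong deformation retract datum between the chain complexes `(C, d)` and
`(D, d')`, where `C` and `D` have bases of homogeneous elements `ι` and `κ`. -/
structure IsSDR (degι : ι → ℕ) (degκ : κ → ℕ)
    (d : (ι →₀ k) →ₗ[k] (ι →₀ k)) (d' : (κ →₀ k) →ₗ[k] (κ →₀ k))
    (p : (ι →₀ k) →ₗ[k] (κ →₀ k)) (i : (κ →₀ k) →ₗ[k] (ι →₀ k))
    (h : (ι →₀ k) →ₗ[k] (ι →₀ k)) : Prop where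
  homog_d : IsHomog degι degι (-1) d
  homog_d' : IsHomog degκ degκ (-1) d'
  homog_p : IsHomog degι degκ 0 p
  homog_i : IsHomog degκ degι 0 i
  homog_h : IsHomog degι degι 1 h
  d_sq : d ∘ₗ d = 0
  d'_sq : d' ∘ₗ d' = 0
  p_comm : d' ∘ₗ p = p ∘ₗ d
  i_comm : d ∘ₗ i = i ∘ₗ d'
  homotopy : LinearMap.id - i ∘ₗ p = d ∘ₗ h + h ∘ₗ d
  p_i : p ∘ₗ i = LinearMap.id
  h_sq : h ∘ₗ h = 0
  h_i : h ∘ₗ i = 0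
  p_h : p ∘ₗ h = 0

end SDR

section Maps

variable {k V : Type*} [Field k] [Quiver V] [Fintype V] [LinearOrder (QPath V)]

/-- The map `h` on the bar construction that the Anick matching induces. -/
def anickH (I : TwoSidedIdeal (PathAlgebra k V)) (G : Set (PathAlgebra k V)) :
    Bar G →ₗ[k] Bar G :=
  morseH (barD I G) (AnickMatching G) BarTerm.deg

/-- The map `p` from the bar construction to `T_*` that the Anick matching induces. -/
def anickP (I : TwoSidedIdeal (PathAlgebra k V)) (G : Set (PathAlgebra k V)) :
    Bar G →ₗ[k] Tor G :=
  morseP (barD I G) (AnickMatching G) BarTerm.deg fun c => IsChain G c.1.2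

/-- The map `i` from `T_*` to the bar construction that the Anick matching induces. -/
def anickI (I : TwoSidedIdeal (PathAlgebra k V)) (G : Set (PathAlgebra k V)) :
    Tor G →ₗ[k] Bar G :=
  morseI (barD I G) (AnickMatching G) BarTerm.deg fun c => IsChain G c.1.2

/-- The differential of the Morse complex of the Anick matching. -/
def anickD (I : TwoSidedIdeal (PathAlgebra k V)) (G : Set (PathAlgebra k V)) :
    Tor G →ₗ[k] Tor G :=
  morseD (barD I G) (AnickMatching G) BarTerm.deg fun c => IsChain G c.1.2

end Maps

end Toupie

end

noncomputable section

namespace Toupie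

/-! ### Algebraic Morse theory for matchings with a descending measure -/

section MorseTheory

variable {k ι : Type*} [Field k]

/-! Three observations carry the proof.

Normal forms. Nothing of positive length ends at `o` or starts at `ω`, so a branch is a proper
factor of no path. Hence a path lies in ⟨W⟩ iff it contains a monomial relation or is itself the tip
of a non-monomial relation (`inTipIdeal_iff`). One rewriting step therefore suffices: kill the paths
of the first kind, and replace a tip t of a non-monomial g by t − g. This map `reduce` is compatible
with products and vanishes on `I`, so it computes normal forms in A.

Monomial differential. Two consecutive entries of a bar term can multiply to a branch only if the
term has no other entries. Outside degree two the differential is therefore that of the bar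
construction of the monomial algebra kQ/⟨W⟩, where a face is a signed bar term or zero
(`barD_eq_of_length`); in degree two d[a|b] = −[reduce(ab)] (`barD_pair`).

Morse theory. A bar term that is not a chain has a longest initial chain u and a next entry w.
Either w = ab with [u|a] a chain, and the term is a target of the matching, or merging the last
entry of u with w gives its partner (`isCritical_iff`, `AnickMatching.eq`). A dotted arrow followed
by a thick one lengthens the initial chain, because faces inside a chain vanish (`barD_descent`).
This measure makes all zigzag sums finite and gives the recursion h(x) = −c⁻¹(z + h(thick z)) when z
→ x is matched with weight c, and h(x) = 0 otherwise. It follows that h takes values in the span of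
the matched sources, that v + dhv has no coefficient at a matched target and restricts to p(v) on
the critical vertices, and that i(x) = x + h(dx). Since hd(z) = −z for matched sources z, this
yields ip = id + dh + hd.

The explicit formulas come from the same recursion. On chains d vanishes outside degree two; in
degree two it gives terms [q] with q of length at least two, which p kills and h sends to [first
arrow|rest]. Hence the Morse differential is zero and i has the stated form. If [u|ab|t] is
attached, the matched source [u|a|b|t] has at most two nonzero faces, [u|ab|t] and [u|a|bt], so the
recursion for h and p is one step of the splitting procedure (`anick_split`). -/

theorem finsum_single_eq_filter (P : ι → Prop) (g : ι →₀ k) [DecidablePred P] :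
    (∑ᶠ (y : ι) (_ : P y), Finsupp.single y (g y)) = g.filter P := by
  rw [finsum_eq_sum_of_support_subset (s := g.support), Finsupp.filter_eq_sum,
    Finset.sum_filter]
  · exact Finset.sum_congr rfl fun y _ => finsum_eq_if
  · intro y hy
    rw [Function.mem_support] at hy
    simp only [Finset.mem_coe, Finsupp.mem_support_iff]
    intro h
    exact hy (by simp [h])

/-- Linear maps that agree on the support of `v` agree at `v`. -/
theorem apply_eq_of_support {N : Type*} [AddCommMonoid N] [Module k N]
    {f g : (ι →₀ k) →ₗ[k] N} {v : ι →₀ k}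
    (h : ∀ y, v y ≠ 0 → f (Finsupp.single y 1) = g (Finsupp.single y 1)) : f v = g v := by
  rw [← Finsupp.sum_single v, Finsupp.sum, map_sum, map_sum]
  refine Finset.sum_congr rfl fun y hy => ?_
  have e : Finsupp.single y (v y) = v y • Finsupp.single y (1 : k) := by simp
  rw [e, map_smul, map_smul, h y (Finsupp.mem_support_iff.1 hy)]

theorem linearMap_apply_eq_zero {N : Type*} [AddCommMonoid N] [Module k N]
    {f : (ι →₀ k) →ₗ[k] N} {v : ι →₀ k}
    (h : ∀ y, v y ≠ 0 → f (Finsupp.single y 1) = 0) : f v = 0 :=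
  apply_eq_of_support (g := 0) h

theorem exists_of_apply_ne_zero {κ : Type*} {f : (ι →₀ k) →ₗ[k] (κ →₀ k)} {v : ι →₀ k} {x : κ}
    (h : f v x ≠ 0) : ∃ y, v y ≠ 0 ∧ f (Finsupp.single y 1) x ≠ 0 := by
  by_contra! hc
  exact h (linearMap_apply_eq_zero (f := Finsupp.lapply x ∘ₗ f) hc)

variable {d : (ι →₀ k) →ₗ[k] (ι →₀ k)} {M : ι → ι → Prop} {deg f : ι → ℕ} {S : ι → Prop}

variable (d M deg f S) in
/-- A matching on a complex with a basis, whose critical vertices are given by `S`, with a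
measure `f` that descends along the zigzag paths. -/
structure DescendingMatching : Prop where
  homog : ∀ x y, wt d x y ≠ 0 → deg x = deg y + 1
  sq : ∀ v, d (d v) = 0
  weight_ne : ∀ x y, M x y → wt d x y ≠ 0
  matching : ∀ x y x' y', M x y → M x' y' → (x = x' ∨ x = y' ∨ y = x' ∨ y = y') →
    x = x' ∧ y = y'
  descent : ∀ z y y', M z y → wt d z y' ≠ 0 → ¬ M z y' → f y' < f y
  critical_iff : ∀ x, IsCritical M x ↔ S x

variable (d M) in
/-- The alternating paths from `x`. -/
def alternating (b : Bool) (x : ι) : Set (List ι) := {l | IsAlternating d M b x l}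

theorem alternating_eq (b : Bool) (x : ι) :
    alternating d M b x = insert [] (⋃ y ∈ {y | MorseArrow d M b x y},
      (y :: ·) '' alternating d M (!b) y) := by
  ext l
  cases l with
  | nil => simp [alternating, IsAlternating]
  | cons y l => simp [alternating, IsAlternating, and_comm]

variable (d M) in
/-- The sum of the weights of the alternating paths from `x`, times their last vertices. -/
def zigzagTotal (b : Bool) (x : ι) : ι →₀ k :=
  ∑ᶠ l ∈ alternating d M b x, Finsupp.single (l.getLastD x) (pathWeight d M x l)

variable (d M) in
open Classical in
/-- The part of the differential that is not in the matching. -/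
def thick : (ι →₀ k) →ₗ[k] (ι →₀ k) :=
  Finsupp.linearCombination k fun x => (d (Finsupp.single x 1)).filter fun y => ¬ M x y

theorem thick_single_apply (x y : ι) [Decidable (M x y)] :
    thick d M (Finsupp.single x 1) y = if M x y then 0 else wt d x y := by
  classical
  by_cases h : M x y <;> simp [thick, wt, h]

theorem thick_single_of_not {x : ι} (h : ∀ y, ¬ M x y) :
    thick d M (Finsupp.single x 1) = d (Finsupp.single x 1) := by
  classical
  ext y
  rw [thick_single_apply, if_neg (h y)]
  rfl

theorem thick_single_ne_zero {x y : ι} :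
    thick d M (Finsupp.single x 1) y ≠ 0 ↔ MorseArrow d M false x y := by
  classical
  rw [thick_single_apply]
  by_cases h : M x y <;> simp [MorseArrow, h]

variable (k S) in
/-- The projection to the part of a complex that is spanned by the basis elements in `S`. -/
def restrict : (ι →₀ k) →ₗ[k] ({x // S x} →₀ k) where
  toFun v := v.subtypeDomain S
  map_add' _ _ := Finsupp.subtypeDomain_add
  map_smul' _ _ := by ext; simp

theorem restrict_apply (v : ι →₀ k) : restrict k S v = v.subtypeDomain S := rfl

namespace DescendingMatching

variable (D : DescendingMatching d M deg f S)
include D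

theorem deg_of_mem {x y : ι} (h : M x y) : deg x = deg y + 1 := D.homog _ _ (D.weight_ne _ _ h)

theorem not_mem_symm {x y : ι} (h : wt d x y ≠ 0) : ¬ M y x := fun h' => by
  have := D.homog _ _ h
  have := D.deg_of_mem h'
  omega

/-! ### Finiteness of the zigzag paths. -/

theorem succ_finite (b : Bool) (x : ι) : {y | MorseArrow d M b x y}.Finite := by
  cases b with
  | true =>
    refine Set.Subsingleton.finite fun y hy z hz => ?_
    exact (D.matching _ _ _ _ hy hz (by simp)).1
  | false =>
    refine (d (Finsupp.single x 1)).support.finite_toSet.subset fun y hy => ?_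
    exact Finsupp.mem_support_iff.2 hy.1

/-- A dotted arrow followed by a thick one lowers `f`, so the induction on `f` proceeds two arrows
at a time; each vertex has finitely many successors. -/
theorem alternating_finite (b : Bool) (x : ι) : (alternating d M b x).Finite := by
  have key : ∀ b x, (∀ y, MorseArrow d M b x y → (alternating d M (!b) y).Finite) →
      (alternating d M b x).Finite := fun b x h => by
    rw [alternating_eq]
    exact ((D.succ_finite b x).biUnion fun y hy => (h y hy).image _).insert _
  have ht : ∀ n x, f x < n → (alternating d M true x).Finite := by
    intro n
    induction n with
    | zero => simp
    | succ n ih =>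
      intro x hx
      refine key _ _ fun z hz => key _ _ fun y hy => ih _ ?_
      have := D.descent _ _ _ hz hy.1 hy.2
      omega
  cases b with
  | true => exact ht _ x (Nat.lt_succ_self _)
  | false => exact key _ _ fun y _ => ht _ y (Nat.lt_succ_self _)

theorem zigzag_finite (x : ι) : {l | IsZigzag d M x l}.Finite :=
  (D.alternating_finite true x).union (D.alternating_finite false x)

theorem isMorseMatching : IsMorseMatching d M where
  invertible x y h := (D.weight_ne x y h).isUnit
  matching := D.matching
  finite g b hg := by
    -- The offset `n` is 0 or 1, depending on the kind of the first arrow, so that the arrow leaving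
    -- position `n + 2 * j` is always dotted.
    obtain ⟨n, hn⟩ : ∃ n, ∀ j, M (g (n + 2 * j + 1)) (g (n + 2 * j)) ∧
        MorseArrow d M false (g (n + 2 * j + 1)) (g (n + 2 * j + 2)) := by
      cases b with
      | true =>
        refine ⟨0, fun j => ⟨?_, ?_⟩⟩
        · have := hg (0 + 2 * j)
          simpa [MorseArrow] using this
        · have := hg (0 + 2 * j + 1)
          simpa [parity_simps] using this
      | false =>
        refine ⟨1, fun j => ⟨?_, ?_⟩⟩
        · have := hg (1 + 2 * j)
          simpa [parity_simps, MorseArrow] using this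
        · have := hg (1 + 2 * j + 1)
          simpa [parity_simps] using this
    have hd : ∀ j, f (g (n + 2 * j)) + j ≤ f (g n) := by
      intro j
      induction j with
      | zero => simp
      | succ j ih =>
        have := D.descent _ _ _ (hn j).1 (hn j).2.1 (hn j).2.2
        rw [show n + 2 * (j + 1) = n + 2 * j + 2 by ring]
        omega
    have := hd (f (g n) + 1)
    omega

/-! ### Recursion and degrees for the zigzag sums. -/

theorem zigzagTotal_eq (b : Bool) (x : ι) :
    zigzagTotal d M b x = Finsupp.single x 1 +
      ∑ᶠ y ∈ {y | MorseArrow d M b x y}, arrowWeight d M x y • zigzagTotal d M (!b) y := by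
  have hfin : ∀ y, ((y :: ·) '' alternating d M (!b) y).Finite :=
    fun y => (D.alternating_finite _ y).image _
  rw [zigzagTotal, alternating_eq, finsum_mem_insert _ (by simp)
    ((D.succ_finite b x).biUnion fun y _ => hfin y), finsum_mem_biUnion]
  · congr 1
    refine finsum_mem_congr rfl fun y _ => ?_
    rw [finsum_mem_image (fun _ _ _ _ h => (List.cons.inj h).2), zigzagTotal,
      finsum_mem_eq_finite_toFinset_sum _ (D.alternating_finite _ y),
      finsum_mem_eq_finite_toFinset_sum _ (D.alternating_finite _ y), Finset.smul_sum]
    refine Finset.sum_congr rfl fun l _ => ?_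
    rw [Finsupp.smul_single, List.getLastD_cons]
    rfl
  · intro y _ z _ hyz
    refine Set.disjoint_left.2 ?_
    rintro _ ⟨l, _, rfl⟩ ⟨l', _, h⟩
    exact hyz (List.cons.inj h).1.symm
  · exact D.succ_finite b x
  · exact fun y _ => hfin y

theorem zigzagTotal_true_of_mem {z x : ι} (h : M z x) :
    zigzagTotal d M true x = Finsupp.single x 1 + -(wt d z x)⁻¹ • zigzagTotal d M false z := by
  have e : {y | MorseArrow d M true x y} = {z} := by
    ext y
    exact ⟨fun hy => (D.matching _ _ _ _ hy h (by simp)).1, fun hy => hy ▸ h⟩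
  rw [D.zigzagTotal_eq, e, finsum_mem_singleton, arrowWeight, if_pos h]
  rfl

theorem zigzagTotal_true_of_not {x : ι} (h : ∀ z, ¬ M z x) :
    zigzagTotal d M true x = Finsupp.single x 1 := by
  have e : {y | MorseArrow d M true x y} = ∅ := by
    ext y
    exact ⟨fun hy => h y hy, fun hy => hy.elim⟩
  rw [D.zigzagTotal_eq, e, finsum_mem_empty, add_zero]

theorem zigzagTotal_false (x : ι) :
    zigzagTotal d M false x = Finsupp.single x 1 +
      Finsupp.linearCombination k (zigzagTotal d M true) (thick d M (Finsupp.single x 1)) := by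
  classical
  rw [D.zigzagTotal_eq, Finsupp.linearCombination_apply, Finsupp.sum,
    finsum_mem_eq_finite_toFinset_sum _ (D.succ_finite false x)]
  congr 1
  refine Finset.sum_congr ?_ fun y hy => ?_
  · ext y
    simp [← thick_single_ne_zero]
  · have hy' : MorseArrow d M false x y := by
      rw [Finsupp.mem_support_iff, thick_single_ne_zero] at hy
      exact hy
    rw [thick_single_apply, if_neg hy'.2, arrowWeight, if_neg (D.not_mem_symm hy'.1)]
    rfl

/-- The paths that begin dotted and those that begin thick share only the path of length zero, which
is subtracted once: dotted and thick arrows change the degree in opposite directions. -/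
theorem zigzagSum_eq (x y : ι) : zigzagSum d M x y =
    (zigzagTotal d M true x + zigzagTotal d M false x - Finsupp.single x 1 : ι →₀ k) y := by
  classical
  have h0 : alternating d M true x ∩ alternating d M false x = {[]} := by
    ext l
    cases l with
    | nil => simp [alternating, IsAlternating]
    | cons y l =>
      simp only [alternating, IsAlternating, Set.mem_inter_iff, Set.mem_ofPred_eq,
        Set.mem_singleton_iff, reduceCtorEq, iff_false]
      rintro ⟨⟨h, -⟩, ⟨h', -⟩, -⟩
      exact D.not_mem_symm h' h
  have h1 := finsum_mem_union_inter
    (f := fun l : List ι => Finsupp.single (l.getLastD x) (pathWeight d M x l))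
    (D.alternating_finite true x) (D.alternating_finite false x)
  rw [h0, finsum_mem_singleton] at h1
  have h2 : zigzagTotal d M true x + zigzagTotal d M false x - Finsupp.single x 1 =
      ∑ᶠ l ∈ {l | IsZigzag d M x l}, Finsupp.single (l.getLastD x) (pathWeight d M x l) :=
    sub_eq_of_eq_add h1.symm
  have hs : {l : List ι | IsZigzag d M x l ∧ l.getLastD x = y}.Finite :=
    (D.zigzag_finite x).subset fun l hl => hl.1
  rw [h2, finsum_mem_eq_finite_toFinset_sum _ (D.zigzag_finite x), Finset.sum_apply', zigzagSum,
    finsum_mem_eq_finite_toFinset_sum _ hs]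
  simp only [Finsupp.single_apply]
  rw [← Finset.sum_filter]
  refine Finset.sum_congr ?_ fun _ _ => rfl
  ext l
  simp

theorem wt_ne_zero_of_thick {x y : ι} (h : thick d M (Finsupp.single x 1) y ≠ 0) :
    deg x = deg y + 1 := D.homog _ _ (thick_single_ne_zero.1 h).1

/-- Dotted arrows raise the degree by one and thick arrows lower it by one, so a path that begins
dotted alternates between two degrees. -/
theorem zigzagTotal_true_deg (x : ι) : ∀ y, zigzagTotal d M true x y ≠ 0 →
    deg y = deg x ∨ deg y = deg x + 1 := by
  induction hn : f x using Nat.strong_induction_on generalizing x with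
  | _ n ih =>
  intro y hy
  by_cases hx : ∃ z, M z x
  · obtain ⟨z, hz⟩ := hx
    rw [D.zigzagTotal_true_of_mem hz, D.zigzagTotal_false] at hy
    have hdz := D.deg_of_mem hz
    by_cases h1 : y = x
    · exact Or.inl (h1 ▸ rfl)
    by_cases h2 : y = z
    · exact Or.inr (h2 ▸ hdz)
    have h3 : Finsupp.linearCombination k (zigzagTotal d M true)
        (thick d M (Finsupp.single z 1)) y ≠ 0 := by
      intro h
      simp [Ne.symm h1, Ne.symm h2, h] at hy
    obtain ⟨w, hw, hwy⟩ := exists_of_apply_ne_zero h3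
    have hw' := thick_single_ne_zero.1 hw
    have := D.wt_ne_zero_of_thick hw
    rw [Finsupp.linearCombination_single, one_smul] at hwy
    have := ih _ (hn ▸ D.descent _ _ _ hz hw'.1 hw'.2) w rfl y hwy
    omega
  · rw [D.zigzagTotal_true_of_not (by simpa using hx)] at hy
    by_cases h1 : y = x
    · exact Or.inl (h1 ▸ rfl)
    · simp [Ne.symm h1] at hy

theorem linearCombination_thick_deg {x y : ι}
    (h : Finsupp.linearCombination k (zigzagTotal d M true)
      (thick d M (Finsupp.single x 1)) y ≠ 0) : deg y + 1 = deg x ∨ deg y = deg x := by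
  obtain ⟨w, hw, hwy⟩ := exists_of_apply_ne_zero h
  have := D.wt_ne_zero_of_thick hw
  rw [Finsupp.linearCombination_single, one_smul] at hwy
  have := D.zigzagTotal_true_deg w y hwy
  omega

/-- Paths that begin with a thick arrow never rise above the degree of `x`, so they do not
contribute to `morseH`. -/
theorem morseH_single_eq_filter (x : ι) [DecidablePred fun y => deg y = deg x + 1] :
    morseH d M deg (Finsupp.single x 1) =
      (zigzagTotal d M true x).filter fun y => deg y = deg x + 1 := by
  rw [morseH, Finsupp.linearCombination_single, one_smul]
  simp only [D.zigzagSum_eq]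
  rw [finsum_single_eq_filter, D.zigzagTotal_false, add_sub_assoc, add_sub_cancel_left,
    Finsupp.filter_add, add_eq_left]
  ext y
  by_cases hy : deg y = deg x + 1
  · rw [Finsupp.filter_apply_pos (fun y => deg y = _) _ hy, Finsupp.zero_apply]
    by_contra h
    have := D.linearCombination_thick_deg h
    omega
  · rw [Finsupp.filter_apply_neg (fun y => deg y = _) _ hy, Finsupp.zero_apply]

/-- On homogeneous elements, `h` is the part of degree one more of the sum of all zigzags. -/
theorem filter_linearCombination {v : ι →₀ k} {n : ℕ} (hv : ∀ y, v y ≠ 0 → deg y = n)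
    [DecidablePred fun y => deg y = n + 1] :
    (Finsupp.linearCombination k (zigzagTotal d M true) v).filter (fun y => deg y = n + 1) =
      morseH d M deg v := by
  classical
  ext y
  by_cases hy : deg y = n + 1
  · rw [Finsupp.filter_apply_pos (fun y => deg y = _) _ hy]
    refine apply_eq_of_support (f := Finsupp.lapply y ∘ₗ Finsupp.linearCombination k _)
      (g := Finsupp.lapply y ∘ₗ morseH d M deg) fun w hw => ?_
    simp only [LinearMap.comp_apply, Finsupp.lapply_apply, D.morseH_single_eq_filter,
      Finsupp.linearCombination_single, one_smul]
    rw [Finsupp.filter_apply_pos (fun y => deg y = _)]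
    rw [hy, hv w hw]
  · rw [Finsupp.filter_apply_neg (fun y => deg y = _) _ hy]
    by_contra h
    obtain ⟨w, hw, hwy⟩ := exists_of_apply_ne_zero (Ne.symm h)
    rw [D.morseH_single_eq_filter] at hwy
    have h' : deg y = deg w + 1 := by
      by_contra h'
      exact hwy (Finsupp.filter_apply_neg (fun y => deg y = _) _ h')
    exact hy (h'.trans (by rw [hv w hw]))

/-! ### The recursion for `morseH` and its image. -/

theorem morseH_single_of_not {x : ι} (h : ∀ z, ¬ M z x) :
    morseH d M deg (Finsupp.single x 1) = 0 := by
  classical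
  rw [D.morseH_single_eq_filter, D.zigzagTotal_true_of_not h, Finsupp.filter_single_of_neg]
  omega

/-- The only dotted arrow from `x` leads to `z`. There the path stops, or it continues with a thick
arrow to a vertex of the degree of `x`, where the situation repeats. -/
theorem morseH_single_of_mem {z x : ι} (h : M z x) :
    morseH d M deg (Finsupp.single x 1) = -(wt d z x)⁻¹ • (Finsupp.single z 1 +
      morseH d M deg (thick d M (Finsupp.single z 1))) := by
  classical
  have hz := D.deg_of_mem h
  rw [D.morseH_single_eq_filter, D.zigzagTotal_true_of_mem h, Finsupp.filter_add,
    Finsupp.filter_single_of_neg _ (by omega), zero_add, Finsupp.filter_smul,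
    D.zigzagTotal_false, Finsupp.filter_add, Finsupp.filter_single_of_pos (fun y => deg y = _) hz,
    D.filter_linearCombination]
  intro y hy
  have := D.wt_ne_zero_of_thick hy
  omega

/-- A zigzag that raises the degree ends with a dotted arrow, hence at a source of the matching.
Sources are neither targets nor critical, which is behind all the side conditions of the retract
datum. -/
theorem mem_of_morseH_single_ne_zero (x : ι) : ∀ y,
    morseH d M deg (Finsupp.single x 1) y ≠ 0 → ∃ w, M y w := by
  induction hn : f x using Nat.strong_induction_on generalizing x with
  | _ n ih =>
  intro y hy
  by_cases hx : ∃ z, M z x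
  · obtain ⟨z, hz⟩ := hx
    rw [D.morseH_single_of_mem hz] at hy
    by_cases h2 : y = z
    · exact ⟨x, h2 ▸ hz⟩
    have h3 : morseH d M deg (thick d M (Finsupp.single z 1)) y ≠ 0 := by
      intro h
      simp [Ne.symm h2, h] at hy
    obtain ⟨w, hw, hwy⟩ := exists_of_apply_ne_zero h3
    have hw' := thick_single_ne_zero.1 hw
    exact ih _ (hn ▸ D.descent _ _ _ hz hw'.1 hw'.2) w rfl y hwy
  · rw [D.morseH_single_of_not (by simpa using hx)] at hy
    exact (hy rfl).elim

theorem mem_of_morseH_ne_zero {v : ι →₀ k} {y : ι} (h : morseH d M deg v y ≠ 0) :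
    ∃ w, M y w := by
  obtain ⟨x, -, hx⟩ := exists_of_apply_ne_zero h
  exact D.mem_of_morseH_single_ne_zero x y hx

theorem morseH_morseH (v : ι →₀ k) : morseH d M deg (morseH d M deg v) = 0 := by
  refine linearMap_apply_eq_zero fun y hy => D.morseH_single_of_not fun z hz => ?_
  obtain ⟨w, hw⟩ := D.mem_of_morseH_ne_zero hy
  have := D.deg_of_mem hw
  have h1 := (D.matching _ _ _ _ hz hw (by simp)).1
  subst h1
  have := D.deg_of_mem hz
  omega

/-! ### Restriction to the critical vertices: `morseP`, `morseI` and `morseD`. -/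

theorem critical_not {x : ι} (hx : S x) (y : ι) : ¬ M x y ∧ ¬ M y x := (D.critical_iff x).2 hx y

theorem subtypeDomain_morseH (v : ι →₀ k) : (morseH d M deg v).subtypeDomain S = 0 := by
  ext ⟨y, hy⟩
  rw [Finsupp.subtypeDomain_apply, Finsupp.zero_apply]
  by_contra h
  obtain ⟨w, hw⟩ := D.mem_of_morseH_ne_zero h
  exact (D.critical_not hy w).1 hw

theorem finsum_subtype_eq (x : ι) (P : ι → Prop) [DecidablePred P] :
    (∑ᶠ (y : {x // S x}) (_ : P y.1), Finsupp.single y (zigzagSum d M x y.1)) =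
      ((zigzagTotal d M true x + zigzagTotal d M false x -
        Finsupp.single x 1 : ι →₀ k).filter P).subtypeDomain S := by
  classical
  have h := finsum_single_eq_filter (fun y : {x // S x} => P y.1)
    ((zigzagTotal d M true x + zigzagTotal d M false x -
        Finsupp.single x 1 : ι →₀ k).subtypeDomain S)
  simp only [Finsupp.subtypeDomain_apply, ← D.zigzagSum_eq] at h
  rw [h]
  ext y
  by_cases hy : P y.1 <;> simp [hy]

/-- A nonempty path that begins thick and returns to the degree of `x` ends with a dotted arrow, at
a source of the matching; restriction to `S` discards it. -/
theorem morseP_single_eq_filter (x : ι) [DecidablePred fun y => deg y = deg x] :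
    morseP d M deg S (Finsupp.single x 1) =
      ((zigzagTotal d M true x).filter fun y => deg y = deg x).subtypeDomain S := by
  classical
  rw [morseP, Finsupp.linearCombination_single, one_smul,
    D.finsum_subtype_eq x fun y => deg y = deg x, D.zigzagTotal_false,
    add_sub_assoc, add_sub_cancel_left, Finsupp.filter_add, Finsupp.subtypeDomain_add,
    add_eq_left]
  have : ∀ n, deg x = n + 1 → (Finsupp.linearCombination k (zigzagTotal d M true)
      (thick d M (Finsupp.single x 1))).filter (fun y => deg y = deg x) =
      morseH d M deg (thick d M (Finsupp.single x 1)) := by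
    intro n hn
    simp only [hn]
    refine D.filter_linearCombination fun y hy => ?_
    have := D.wt_ne_zero_of_thick hy
    omega
  obtain hn | ⟨n, hn⟩ : deg x = 0 ∨ ∃ n, deg x = n + 1 := by cases deg x <;> simp
  · have : thick d M (Finsupp.single x 1) = 0 := by
      ext y
      by_contra h
      have := D.wt_ne_zero_of_thick h
      omega
    rw [this, map_zero, Finsupp.filter_zero, Finsupp.subtypeDomain_zero]
  · rw [this n hn, D.subtypeDomain_morseH]

theorem morseP_single_of_not {x : ι} (h : ∀ z, ¬ M z x) :
    morseP d M deg S (Finsupp.single x 1) = (Finsupp.single x 1).subtypeDomain S := by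
  classical
  rw [D.morseP_single_eq_filter, D.zigzagTotal_true_of_not h, Finsupp.filter_single_of_pos]
  rfl

theorem subtypeDomain_filter_linearCombination {v : ι →₀ k} {n : ℕ}
    (hv : ∀ y, v y ≠ 0 → deg y = n) [DecidablePred fun y => deg y = n] :
    ((Finsupp.linearCombination k (zigzagTotal d M true) v).filter
      (fun y => deg y = n)).subtypeDomain S = morseP d M deg S v := by
  classical
  ext y
  by_cases hy : deg y.1 = n
  · rw [Finsupp.subtypeDomain_apply, Finsupp.filter_apply_pos (fun y => deg y = _) _ hy]
    refine apply_eq_of_support (f := Finsupp.lapply y.1 ∘ₗ Finsupp.linearCombination k _)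
      (g := Finsupp.lapply y ∘ₗ morseP d M deg S) fun w hw => ?_
    simp only [LinearMap.comp_apply, Finsupp.lapply_apply, D.morseP_single_eq_filter,
      Finsupp.linearCombination_single, one_smul, Finsupp.subtypeDomain_apply]
    rw [Finsupp.filter_apply_pos (fun y => deg y = _)]
    rw [hy, hv w hw]
  · rw [Finsupp.subtypeDomain_apply, Finsupp.filter_apply_neg (fun y => deg y = _) _ hy]
    by_contra h
    obtain ⟨w, hw, hwy⟩ := exists_of_apply_ne_zero (Ne.symm h)
    rw [D.morseP_single_eq_filter, Finsupp.subtypeDomain_apply] at hwy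
    have h' : deg y.1 = deg w := by
      by_contra h'
      exact hwy (Finsupp.filter_apply_neg (fun y => deg y = _) _ h')
    exact hy (h'.trans (hv w hw))

theorem subtypeDomain_single_of_mem {z x : ι} (h : M z x) :
    (Finsupp.single x (1 : k)).subtypeDomain S = 0 := by
  classical
  ext ⟨y, hy⟩
  rw [Finsupp.subtypeDomain_apply, Finsupp.single_apply, if_neg, Finsupp.zero_apply]
  rintro rfl
  exact (D.critical_not hy z).2 h

theorem morseP_single_of_mem {z x : ι} (h : M z x) :
    morseP d M deg S (Finsupp.single x 1) =
      -(wt d z x)⁻¹ • morseP d M deg S (thick d M (Finsupp.single z 1)) := by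
  classical
  have hz := D.deg_of_mem h
  rw [D.morseP_single_eq_filter, D.zigzagTotal_true_of_mem h, Finsupp.filter_add,
    Finsupp.filter_single_of_pos (fun y => deg y = deg x) rfl, Finsupp.filter_smul,
    D.zigzagTotal_false, Finsupp.filter_add, Finsupp.filter_single_of_neg _ (by omega), zero_add,
    Finsupp.subtypeDomain_add, D.subtypeDomain_single_of_mem h, zero_add]
  rw [← D.subtypeDomain_filter_linearCombination (n := deg x), ← restrict_apply, map_smul,
    restrict_apply]
  · intro y hy
    have := D.wt_ne_zero_of_thick hy
    omega

theorem apply_single_of_mem {x y : ι} (h : M x y) : d (Finsupp.single x 1) =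
    wt d x y • Finsupp.single y 1 + thick d M (Finsupp.single x 1) := by
  classical
  ext w
  rw [Finsupp.add_apply, thick_single_apply, Finsupp.smul_apply, Finsupp.single_apply]
  by_cases hw : M x w
  · have := (D.matching _ _ _ _ h hw (by simp)).2
    subst this
    simp [hw, wt]
  · have : y ≠ w := fun e => hw (e ▸ h)
    simp [this, hw, wt]

/-- No dotted arrow leaves a critical vertex and all of its differential is thick, so every nonempty
zigzag is a term of `d` followed by a path counted by `morseH`. -/
theorem morseI_single (x : {x // S x}) :
    morseI d M deg S (Finsupp.single x 1) =
      Finsupp.single x.1 1 + morseH d M deg (d (Finsupp.single x.1 1)) := by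
  classical
  rw [morseI, Finsupp.linearCombination_single, one_smul]
  simp only [D.zigzagSum_eq]
  rw [finsum_single_eq_filter, D.zigzagTotal_true_of_not fun z => (D.critical_not x.2 z).2,
    add_sub_cancel_left, D.zigzagTotal_false, Finsupp.filter_add,
    Finsupp.filter_single_of_pos (fun y => deg y = deg x.1) rfl,
    thick_single_of_not fun z => (D.critical_not x.2 z).1]
  congr 1
  cases hn : deg x.1 with
  | succ n =>
    refine D.filter_linearCombination fun y hy => ?_
    have := D.homog _ _ hy
    omega
  | zero =>
    have : d (Finsupp.single x.1 1) = 0 := by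
      ext y
      by_contra h
      have := D.homog _ _ h
      omega
    rw [this, map_zero, map_zero, Finsupp.filter_zero]

theorem morseD_single (x : {x // S x}) :
    morseD d M deg S (Finsupp.single x 1) = morseP d M deg S (d (Finsupp.single x.1 1)) := by
  classical
  rw [morseD, Finsupp.linearCombination_single, one_smul,
    D.finsum_subtype_eq x.1 (fun y => deg y + 1 = deg x.1),
    D.zigzagTotal_true_of_not fun z => (D.critical_not x.2 z).2,
    add_sub_cancel_left, D.zigzagTotal_false, Finsupp.filter_add,
    Finsupp.filter_single_of_neg _ (by omega), zero_add,
    thick_single_of_not fun z => (D.critical_not x.2 z).1]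
  cases hn : deg x.1 with
  | succ n =>
    simp only [Nat.add_right_cancel_iff]
    refine D.subtypeDomain_filter_linearCombination fun y hy => ?_
    have := D.homog _ _ hy
    omega
  | zero =>
    have : d (Finsupp.single x.1 1) = 0 := by
      ext y
      by_contra h
      have := D.homog _ _ h
      omega
    rw [this, map_zero, map_zero, Finsupp.filter_zero, Finsupp.subtypeDomain_zero]

/-! ### The homotopy identities. -/

theorem morseH_d_single {z y : ι} (h : M z y) :
    morseH d M deg (d (Finsupp.single z 1)) = -Finsupp.single z 1 := by
  rw [D.apply_single_of_mem h, map_add, map_smul, D.morseH_single_of_mem h, smul_smul,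
    mul_neg, mul_inv_cancel₀ (D.weight_ne _ _ h)]
  simp

/-- Induction along `f`: in d(z + h(thick z)) the thick part of dz is cancelled at matched targets
by the induction hypothesis, and only the matched term of dz remains. -/
theorem d_morseH_apply (x : ι) : ∀ y, (∃ z, M z y) →
    d (morseH d M deg (Finsupp.single x 1)) y = -(Finsupp.single x (1 : k) y) := by
  classical
  induction hn : f x using Nat.strong_induction_on generalizing x with
  | _ n ih =>
  rintro y hy
  by_cases hx : ∃ z, M z x
  · obtain ⟨z, hz⟩ := hx
    have h1 : d (morseH d M deg (thick d M (Finsupp.single z 1))) y =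
        -(thick d M (Finsupp.single z 1) y) := by
      have := apply_eq_of_support
        (f := Finsupp.lapply y ∘ₗ d ∘ₗ morseH d M deg) (g := -Finsupp.lapply y)
        (v := thick d M (Finsupp.single z 1)) fun w hw => by
          have hw' := thick_single_ne_zero.1 hw
          simpa using ih _ (hn ▸ D.descent _ _ _ hz hw'.1 hw'.2) w rfl y hy
      simpa using this
    have hne := D.weight_ne _ _ hz
    rw [D.morseH_single_of_mem hz, map_smul, map_add, Finsupp.smul_apply, Finsupp.add_apply, h1,
      D.apply_single_of_mem hz]
    simp only [Finsupp.add_apply, Finsupp.smul_apply, smul_eq_mul]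
    field_simp
    ring
  · rw [D.morseH_single_of_not (by simpa using hx), map_zero, Finsupp.zero_apply,
      Finsupp.single_apply, if_neg (by rintro rfl; exact hx hy), neg_zero]

theorem add_d_morseH_apply (v : ι →₀ k) {y : ι} (hy : ∃ z, M z y) :
    (v + d (morseH d M deg v)) y = 0 := by
  have : d (morseH d M deg v) y = -(v y) := by
    have := apply_eq_of_support
        (f := Finsupp.lapply y ∘ₗ d ∘ₗ morseH d M deg) (g := -Finsupp.lapply y)
        (v := v) fun w _ => by simpa using D.d_morseH_apply w y hy
    simpa using this
  simp [this]

theorem subtypeDomain_thick {z x : ι} (h : M z x) :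
    (d (Finsupp.single z 1)).subtypeDomain S =
      (thick d M (Finsupp.single z 1)).subtypeDomain S := by
  have := D.subtypeDomain_single_of_mem h
  rw [← restrict_apply] at this
  rw [D.apply_single_of_mem h, ← restrict_apply, map_add, map_smul, this, smul_zero, zero_add,
    restrict_apply]

/-- Both sides satisfy the same recursion along the matching: a target is not critical, so after
restriction to `S` only the thick part of dz is visible. -/
theorem morseP_single (x : ι) : morseP d M deg S (Finsupp.single x 1) =
    (Finsupp.single x 1 + d (morseH d M deg (Finsupp.single x 1))).subtypeDomain S := by
  induction hn : f x using Nat.strong_induction_on generalizing x with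
  | _ n ih =>
  by_cases hx : ∃ z, M z x
  · obtain ⟨z, hz⟩ := hx
    have h1 := apply_eq_of_support (f := morseP d M deg S)
      (g := restrict k S ∘ₗ (LinearMap.id + d ∘ₗ morseH d M deg))
      (v := thick d M (Finsupp.single z 1)) fun w hw => by
        have hw' := thick_single_ne_zero.1 hw
        simpa only [LinearMap.comp_apply, LinearMap.add_apply, LinearMap.id_apply,
          restrict_apply] using ih _ (hn ▸ D.descent _ _ _ hz hw'.1 hw'.2) w rfl
    simp only [LinearMap.comp_apply, LinearMap.add_apply, LinearMap.id_apply] at h1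
    have h2 := D.subtypeDomain_single_of_mem hz
    have h3 := D.subtypeDomain_thick hz
    rw [← restrict_apply] at h2
    rw [← restrict_apply, ← restrict_apply] at h3
    rw [D.morseP_single_of_mem hz, h1, ← restrict_apply, map_add, map_add, h2,
      zero_add, D.morseH_single_of_mem hz, map_smul, map_smul, map_add, map_add, h3]
  · have hx' : ∀ z, ¬ M z x := by simpa using hx
    rw [D.morseH_single_of_not hx', D.morseP_single_of_not hx', map_zero, add_zero]

theorem morseP_apply (v : ι →₀ k) : morseP d M deg S v =
    (v + d (morseH d M deg v)).subtypeDomain S := by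
  have h1 := apply_eq_of_support (f := morseP d M deg S)
    (g := restrict k S ∘ₗ (LinearMap.id + d ∘ₗ morseH d M deg)) (v := v) fun w _ => by
      simpa only [LinearMap.comp_apply, LinearMap.add_apply, LinearMap.id_apply,
        restrict_apply] using D.morseP_single w
  simpa only [LinearMap.comp_apply, LinearMap.add_apply, LinearMap.id_apply,
    restrict_apply] using h1

/-- Checked on the basis elements of `v`: on critical ones it is the formula for `morseI`; on
sources both sides vanish since hd(y) = −y; targets are excluded by `hv`. -/
theorem morseI_subtypeDomain {v : ι →₀ k} (hv : ∀ y, (∃ z, M z y) → v y = 0) :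
    morseI d M deg S (v.subtypeDomain S) = v + morseH d M deg (d v) := by
  refine apply_eq_of_support (f := morseI d M deg S ∘ₗ restrict k S)
    (g := LinearMap.id + morseH d M deg ∘ₗ d) (v := v) fun y hy => ?_
  classical
  rw [LinearMap.comp_apply, restrict_apply, LinearMap.add_apply,
    LinearMap.comp_apply, LinearMap.id_apply]
  by_cases hS : S y
  · have : (Finsupp.single y (1 : k)).subtypeDomain S = Finsupp.single ⟨y, hS⟩ 1 := by
      ext w
      simp [Finsupp.single_apply, Subtype.ext_iff]
    rw [← D.morseI_single ⟨y, hS⟩, ← this]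
  · have h0 : (Finsupp.single y (1 : k)).subtypeDomain S = 0 := by
      ext w
      rw [Finsupp.subtypeDomain_apply, Finsupp.single_apply, if_neg, Finsupp.zero_apply]
      rintro rfl
      exact hS w.2
    obtain ⟨w, hw⟩ : ∃ w, M y w := by
      rw [← D.critical_iff] at hS
      by_contra! hc
      exact hS fun w => ⟨hc w, fun hw => hy (hv y ⟨w, hw⟩)⟩
    rw [D.morseH_d_single hw, add_neg_cancel]
    rw [h0, map_zero]

/-- The previous formula, applied to w = v + dhv: it has no coefficient at a target, and dw = dv. -/
theorem morseI_morseP (v : ι →₀ k) : morseI d M deg S (morseP d M deg S v) =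
    v + d (morseH d M deg v) + morseH d M deg (d v) := by
  rw [D.morseP_apply, D.morseI_subtypeDomain fun y hy => D.add_d_morseH_apply v hy, map_add,
    D.sq, add_zero]

theorem morseP_morseH (v : ι →₀ k) : morseP d M deg S (morseH d M deg v) = 0 := by
  rw [D.morseP_apply, D.morseH_morseH, map_zero, add_zero, D.subtypeDomain_morseH]

theorem morseH_morseI (v : {x // S x} →₀ k) : morseH d M deg (morseI d M deg S v) = 0 := by
  refine linearMap_apply_eq_zero (f := morseH d M deg ∘ₗ morseI d M deg S) fun x _ => ?_
  rw [LinearMap.comp_apply, D.morseI_single, map_add, D.morseH_morseH, add_zero]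
  exact D.morseH_single_of_not fun z => (D.critical_not x.2 z).2

theorem morseP_morseI (v : {x // S x} →₀ k) : morseP d M deg S (morseI d M deg S v) = v := by
  classical
  refine apply_eq_of_support (f := morseP d M deg S ∘ₗ morseI d M deg S) (g := LinearMap.id)
    fun x _ => ?_
  rw [LinearMap.comp_apply, D.morseI_single, map_add, D.morseP_morseH, add_zero,
    D.morseP_single_of_not fun z => (D.critical_not x.2 z).2]
  ext w
  simp [Finsupp.single_apply, Subtype.ext_iff]

/-- As d² = 0, ip(dv) = dv + dhdv. Applying p and pi = id gives p(dhdv) = 0, and this is the only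
correction term that occurs. -/
theorem morseD_morseP (v : ι →₀ k) :
    morseD d M deg S (morseP d M deg S v) = morseP d M deg S (d v) := by
  have h1 : ∀ w, morseD d M deg S w = morseP d M deg S (d (morseI d M deg S w)) := fun w => by
    refine apply_eq_of_support (f := morseD d M deg S)
      (g := morseP d M deg S ∘ₗ d ∘ₗ morseI d M deg S) fun x _ => ?_
    have h2 := D.morseI_morseP (d (Finsupp.single x.1 1))
    rw [D.sq, map_zero, add_zero] at h2
    have h3 := congrArg (morseP d M deg S) h2
    rw [D.morseP_morseI, map_add, left_eq_add] at h3
    rw [LinearMap.comp_apply, LinearMap.comp_apply, D.morseI_single, D.morseD_single, map_add,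
      map_add, h3, add_zero]
  have h2 := D.morseI_morseP (d v)
  rw [D.sq, map_zero, add_zero] at h2
  have h3 := congrArg (morseP d M deg S) h2
  rw [D.morseP_morseI, map_add, left_eq_add] at h3
  rw [h1, D.morseI_morseP, map_add, map_add, map_add, D.sq, add_zero, h3, add_zero]

theorem isSDR (hD : morseD d M deg S = 0) :
    IsSDR deg (fun x : {x // S x} => deg x.1) d 0 (morseP d M deg S) (morseI d M deg S)
      (-morseH d M deg) := by
  classical
  have hPd : ∀ v, morseP d M deg S (d v) = 0 := fun v => by
    rw [← D.morseD_morseP, hD, LinearMap.zero_apply]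
  have homH : ∀ x y, morseH d M deg (Finsupp.single x 1) y ≠ 0 → deg y = deg x + 1 := by
    intro x y h
    by_contra hy
    rw [D.morseH_single_eq_filter, Finsupp.filter_apply_neg (fun y => deg y = _) _ hy] at h
    exact h rfl
  constructor
  case homog_d =>
    intro x y hy
    have := D.homog x y (Finsupp.mem_support_iff.1 hy)
    omega
  case homog_d' => intro x y hy; simp at hy
  case homog_p =>
    intro x y hy
    rw [Finsupp.mem_support_iff, D.morseP_single_eq_filter, Finsupp.subtypeDomain_apply] at hy
    by_contra h
    dsimp only at h
    exact hy (Finsupp.filter_apply_neg (fun y => deg y = _) _ (by omega))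
  case homog_i =>
    intro x y hy
    rw [Finsupp.mem_support_iff, D.morseI_single] at hy
    by_cases h : y = x.1
    · simp [h]
    · rw [Finsupp.add_apply, Finsupp.single_apply, if_neg (Ne.symm h), zero_add] at hy
      obtain ⟨w, hw, hwy⟩ := exists_of_apply_ne_zero hy
      have := D.homog _ _ hw
      have := homH _ _ hwy
      dsimp only
      omega
  case homog_h =>
    intro x y hy
    rw [Finsupp.mem_support_iff, LinearMap.neg_apply, Finsupp.neg_apply, neg_ne_zero] at hy
    have := homH _ _ hy
    omega
  case d_sq => exact LinearMap.ext D.sq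
  case d'_sq => rfl
  case p_comm => exact (LinearMap.zero_comp _).trans (LinearMap.ext fun v => (hPd v).symm)
  case i_comm =>
    refine LinearMap.ext fun v => ?_
    -- Since pd = 0, the homotopy formula at di(v) gives di(v) + dhdi(v) = 0. At i(v), with pi = id
    -- and hi = 0, it gives hdi(v) = 0.
    have h := D.morseI_morseP (d (morseI d M deg S v))
    have h2 := D.morseI_morseP (morseI d M deg S v)
    rw [hPd, map_zero, D.sq, map_zero, add_zero] at h
    rw [D.morseP_morseI, D.morseH_morseI, map_zero, add_zero, left_eq_add] at h2
    rw [h2, map_zero, add_zero] at h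
    simpa using h.symm
  case homotopy =>
    refine LinearMap.ext fun v => ?_
    simp only [LinearMap.sub_apply, LinearMap.add_apply, LinearMap.comp_apply, LinearMap.id_apply,
      LinearMap.neg_apply, D.morseI_morseP, map_neg]
    abel
  case p_i => exact LinearMap.ext D.morseP_morseI
  case h_sq => exact LinearMap.ext fun v => by simp [D.morseH_morseH]
  case h_i => exact LinearMap.ext fun v => by simp [D.morseH_morseI]
  case p_h => exact LinearMap.ext fun v => by simp [D.morseP_morseH]

end DescendingMatching

/-- Existence is the homotopy identity at a cycle. For uniqueness apply p, which kills boundaries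
and is inverse to `i` on the left. Together with di = 0 this says that `i` identifies its domain
with the homology. -/
theorem IsSDR.existsUnique_homology {κ : Type*} {degκ : κ → ℕ} {p : (ι →₀ k) →ₗ[k] (κ →₀ k)}
    {i : (κ →₀ k) →ₗ[k] (ι →₀ k)} {h : (ι →₀ k) →ₗ[k] (ι →₀ k)}
    (H : IsSDR deg degκ d 0 p i h) {z : ι →₀ k} (hz : d z = 0) :
    ∃! y, ∃ b, z - i y = d b := by
  refine ⟨p z, ⟨h z, ?_⟩, ?_⟩
  · have := LinearMap.congr_fun H.homotopy z
    simpa [hz] using this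
  · rintro y ⟨b, hb⟩
    have h1 := congrArg p hb
    have h2 := LinearMap.congr_fun H.p_comm b
    have h3 := LinearMap.congr_fun H.p_i y
    simp only [LinearMap.comp_apply, LinearMap.zero_apply, LinearMap.id_apply] at h2 h3
    rw [map_sub, ← h2, h3, sub_eq_zero] at h1
    exact h1.symm

end MorseTheory

end Toupie

end

noncomputable section

namespace Toupie

open QPath

/-! ### Factorizations of paths -/

section Paths

variable {V : Type*} [Quiver V]

/-- The list of the arrows of a path. -/
def arrowList : ∀ {a b : V}, Quiver.Path a b → List (Σ a b : V, a ⟶ b)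
  | _, _, .nil => []
  | _, _, .cons p e => arrowList p ++ [⟨_, _, e⟩]

theorem arrowList_comp {a b c : V} (p : Quiver.Path a b) (q : Quiver.Path b c) :
    arrowList (p.comp q) = arrowList p ++ arrowList q := by
  induction q with
  | nil => simp [arrowList]
  | cons q e ih => simp [arrowList, ih]

theorem length_arrowList {a b : V} (p : Quiver.Path a b) : (arrowList p).length = p.length := by
  induction p with
  | nil => simp [arrowList]
  | cons p e ih => simp [arrowList, ih]

/-- Lists of arrows allow paths to be compared without casts between endpoints. The common source is
needed for the empty list. -/
theorem mk_eq_of_arrowList_eq {a b c : V} (p : Quiver.Path a b) (q : Quiver.Path a c)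
    (h : arrowList p = arrowList q) : (⟨p⟩ : QPath V) = ⟨q⟩ := by
  induction p generalizing c with
  | nil =>
    cases q with
    | nil => rfl
    | cons q e => simp [arrowList] at h
  | cons p e ih =>
    cases q with
    | nil => simp [arrowList] at h
    | cons q e' =>
      simp only [arrowList] at h
      obtain ⟨h1, h2⟩ := List.append_inj' h rfl
      have h3 := ih q h1
      simp only [List.cons.injEq, and_true] at h2
      cases h2
      cases h3
      rfl

theorem concat_eq_some_iff {p q m : QPath V} : concat p q = some m ↔
    p.tgt = q.src ∧ m.src = p.src ∧ arrowList m.path = arrowList p.path ++ arrowList q.path := by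
  obtain ⟨p⟩ := p
  rename_i a b
  obtain ⟨q⟩ := q
  rename_i c e
  obtain ⟨m⟩ := m
  rename_i r s
  by_cases h : b = c
  · subst h
    rw [concat_mk, Option.some_inj]
    constructor
    · intro h
      cases h
      exact ⟨rfl, rfl, arrowList_comp p q⟩
    · rintro ⟨-, h1, h2⟩
      dsimp only at h1
      subst h1
      refine mk_eq_of_arrowList_eq _ _ ?_
      rw [arrowList_comp, ← h2]
  · rw [concat_of_ne h]
    simp [h]

variable {a b c a' b' m m' x y z : QPath V}

theorem exists_concat (h : a.tgt = b.src) : ∃ m, concat a b = some m := by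
  simp [concat, h]

theorem concat_meet (h : concat a b = some m) : a.tgt = b.src := (concat_eq_some_iff.1 h).1

theorem concat_src (h : concat a b = some m) : m.src = a.src := (concat_eq_some_iff.1 h).2.1

theorem concat_tgt (h : concat a b = some m) : m.tgt = b.tgt := by
  have h1 := concat_meet h
  simp only [concat, h1, dite_true, Option.some_inj] at h
  rw [← h]

theorem concat_length (h : concat a b = some m) : m.length = a.length + b.length := by
  have := congrArg List.length (concat_eq_some_iff.1 h).2.2
  rwa [List.length_append, length_arrowList, length_arrowList, length_arrowList] at this

theorem exists_split (m : QPath V) {n : ℕ} (h : n ≤ m.length) :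
    ∃ a b, concat a b = some m ∧ a.length = n := by
  obtain ⟨m⟩ := m
  obtain ⟨v, p, q, rfl, rfl⟩ := m.exists_eq_comp_of_le_length h
  exact ⟨⟨p⟩, ⟨q⟩, concat_mk p q, rfl⟩

theorem concat_inj (h : concat a b = some m) (h' : concat a' b' = some m)
    (hl : a.length = a'.length) : a = a' ∧ b = b' := by
  have h1 := concat_eq_some_iff.1 h
  have h2 := concat_eq_some_iff.1 h'
  obtain ⟨e1, e2⟩ := List.append_inj (h1.2.2.symm.trans h2.2.2)
    (by rw [length_arrowList, length_arrowList]; exact hl)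
  have hs : a.src = a'.src := h1.2.1.symm.trans h2.2.1
  have ha : a = a' := by
    obtain ⟨a⟩ := a
    obtain ⟨a'⟩ := a'
    dsimp only at hs
    subst hs
    exact mk_eq_of_arrowList_eq _ _ e1
  subst ha
  have hs' : b.src = b'.src := (concat_meet h).symm.trans (concat_meet h')
  refine ⟨rfl, ?_⟩
  obtain ⟨b⟩ := b
  obtain ⟨b'⟩ := b'
  dsimp only at hs'
  subst hs'
  exact mk_eq_of_arrowList_eq _ _ e2

theorem concat_left_cancel (h : concat a b = some m) (h' : concat a b' = some m) : b = b' :=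
  (concat_inj h h' rfl).2

theorem concat_assoc_left (h : concat a b = some x) (h' : concat x c = some m) :
    ∃ y, concat b c = some y ∧ concat a y = some m := by
  have := concat_assoc a b c
  rw [h, Option.bind_some, h'] at this
  obtain ⟨y, hy⟩ := exists_concat (a := b) (b := c) ((concat_tgt h).symm.trans (concat_meet h'))
  rw [hy, Option.bind_some] at this
  exact ⟨y, hy, this.symm⟩

theorem concat_assoc_right (h : concat b c = some y) (h' : concat a y = some m) :
    ∃ x, concat a b = some x ∧ concat x c = some m := by
  have := concat_assoc a b c
  rw [h, Option.bind_some, h'] at this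
  obtain ⟨x, hx⟩ := exists_concat (a := a) (b := b) ((concat_meet h').trans (concat_src h))
  rw [hx, Option.bind_some] at this
  exact ⟨x, hx, this⟩

/-- Two factorizations of a path have a common refinement. -/
theorem concat_refine (h : concat a b = some m) (h' : concat a' b' = some m)
    (hl : a.length ≤ a'.length) : ∃ c, concat a c = some a' ∧ concat c b' = some b := by
  obtain ⟨a₁, c, h1, h2⟩ := exists_split a' hl
  obtain ⟨y, hy, hy'⟩ := concat_assoc_left h1 h'
  obtain ⟨e1, e2⟩ := concat_inj hy' h h2
  exact ⟨c, e1 ▸ h1, e2 ▸ hy⟩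

theorem eq_triv_of_length (h : a.length = 0) : a = triv a.src := by
  obtain ⟨p⟩ := a
  cases p with
  | nil => rfl
  | cons p e => simp [QPath.length] at h

theorem length_triv (v : V) : (triv v).length = 0 := rfl

theorem concat_of_left_length (h : a.length = 0) (h' : concat a b = some m) : m = b := by
  have h1 := eq_triv_of_length h
  have h2 : a.src = b.src := by
    rw [← concat_meet h', h1]; rfl
  rw [h1, h2, triv_concat] at h'
  exact (Option.some_inj.1 h').symm

theorem concat_of_right_length (h : b.length = 0) (h' : concat a b = some m) : m = a := by
  have h1 := eq_triv_of_length h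
  have h2 := concat_triv a
  rw [concat_meet h', ← h1, h'] at h2
  exact Option.some_inj.1 h2

theorem QPath.Divides.refl (a : QPath V) : Divides a a :=
  ⟨triv a.src, a, triv a.tgt, triv_concat a, concat_triv a⟩

theorem QPath.Divides.concat_right (h : Divides x a) (h' : concat a b = some m) : Divides x m := by
  obtain ⟨u, n, v, h1, h2⟩ := h
  obtain ⟨y, -, h4⟩ := concat_assoc_left h2 h'
  exact ⟨u, n, y, h1, h4⟩

theorem QPath.Divides.concat_left (h : Divides x b) (h' : concat a b = some m) : Divides x m := by
  obtain ⟨u, n, v, h1, h2⟩ := h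
  obtain ⟨y, h3, h4⟩ := concat_assoc_right h2 h'
  obtain ⟨z, h5, h6⟩ := concat_assoc_right h1 h3
  exact ⟨z, y, v, h6, h4⟩

theorem QPath.Divides.trans (h : Divides x y) (h' : Divides y z) : Divides x z := by
  obtain ⟨u, n, v, h1, h2⟩ := h'
  exact (h.concat_left h1).concat_right h2

theorem QPath.Divides.length_le (h : Divides x y) : x.length ≤ y.length := by
  obtain ⟨u, n, v, h1, h2⟩ := h
  rw [concat_length h2, concat_length h1]
  omega

end Paths

/-! ### The reduction of the path algebra modulo the relations -/

section Reduction

variable {k V : Type*} [Field k] [Quiver V]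

theorem ofPath_mul_of_concat {a b m : QPath V} (h : concat a b = some m) :
    ofPath k a * ofPath k b = ofPath k m := by
  rw [ofPath_mul, pathMul, h]
  rfl

theorem coeff_ofPath_self (p : QPath V) : coeff (ofPath k p) p = 1 := Finsupp.single_eq_same

theorem mem_supp {x : PathAlgebra k V} {p : QPath V} : p ∈ supp x ↔ coeff x p ≠ 0 :=
  Finsupp.mem_support_iff

theorem supp_ofPath (p : QPath V) : supp (ofPath k p) = {p} :=
  Finsupp.support_single _ one_ne_zero

/-- The coefficient of a path, as a linear map. -/
def coeffLin (p : QPath V) : PathAlgebra k V →ₗ[k] k :=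
  (Finsupp.lapply p : (QPath V →₀ k) →ₗ[k] k)

theorem coeff_sub (x y : PathAlgebra k V) (p : QPath V) :
    coeff (x - y) p = coeff x p - coeff y p := Finsupp.sub_apply x y p

theorem sum_coeff_smul (x : PathAlgebra k V) : ∑ p ∈ supp x, coeff x p • ofPath k p = x := by
  refine Eq.trans ?_ (Finsupp.sum_single (show QPath V →₀ k from x))
  refine Finset.sum_congr rfl fun p _ => ?_
  exact (Finsupp.smul_single _ _ _).trans (congrArg _ (mul_one _))

theorem lin_eq_of_supp {N : Type*} [AddCommMonoid N] [Module k N]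
    {f g : PathAlgebra k V →ₗ[k] N} {x : PathAlgebra k V}
    (h : ∀ p ∈ supp x, f (ofPath k p) = g (ofPath k p)) : f x = g x := by
  rw [← sum_coeff_smul x, map_sum, map_sum]
  exact Finset.sum_congr rfl fun p hp => by rw [map_smul, map_smul, h p hp]

theorem ofPath_mul_eq_sum (a : QPath V) (x : PathAlgebra k V) :
    ofPath k a * x = ∑ p ∈ supp x, coeff x p • (ofPath k a * ofPath k p) := by
  conv_lhs => rw [← sum_coeff_smul x, Finset.mul_sum]
  exact Finset.sum_congr rfl fun p _ => mul_smul_aux _ _ _ _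

theorem mul_ofPath_eq_sum (a : QPath V) (x : PathAlgebra k V) :
    x * ofPath k a = ∑ p ∈ supp x, coeff x p • (ofPath k p * ofPath k a) := by
  conv_lhs => rw [← sum_coeff_smul x, Finset.sum_mul]
  exact Finset.sum_congr rfl fun p _ => smul_mul_aux _ _ _ _

/-- The path `p` contains a monomial relation. -/
def MonoDiv (G : Set (PathAlgebra k V)) (p : QPath V) : Prop :=
  ∃ m, ofPath k m ∈ G ∧ Divides m p

theorem MonoDiv.of_divides {G : Set (PathAlgebra k V)} {p q : QPath V} (h : MonoDiv G p)
    (h' : Divides p q) : MonoDiv G q :=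
  let ⟨m, hm, hd⟩ := h
  ⟨m, hm, hd.trans h'⟩

theorem smul_mem_ideal [Fintype V] {I : TwoSidedIdeal (PathAlgebra k V)} {x : PathAlgebra k V}
    (hx : x ∈ I) (c : k) : c • x ∈ I := by
  have : c • x = (c • (1 : PathAlgebra k V)) * x := by rw [smul_mul_aux, one_mul]
  rw [this]
  exact I.mul_mem_left _ _ hx

variable [LinearOrder (QPath V)]

theorem IsTip.unique {x : PathAlgebra k V} {t t' : QPath V} (h : IsTip x t) (h' : IsTip x t') :
    t = t' := le_antisymm (h'.2 _ h.1) (h.2 _ h'.1)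

theorem isTip_ofPath {p t : QPath V} : IsTip (ofPath k p) t ↔ t = p := by
  simp only [IsTip, supp_ofPath, Finset.mem_singleton, forall_eq]
  exact ⟨fun h => h.1, fun h => ⟨h, h.ge⟩⟩

theorem exists_isTip {x : PathAlgebra k V} (h : IsNonMonomial x) : ∃ t, IsTip x t := by
  have : (supp x).Nonempty := Finset.card_pos.1 (by unfold IsNonMonomial at h; omega)
  exact ⟨(supp x).max' this, Finset.max'_mem _ _, fun q hq => Finset.le_max' _ _ hq⟩

variable {G : Set (PathAlgebra k V)}

theorem InTipIdeal.of_divides {p q : QPath V} (h : InTipIdeal G p) (h' : Divides p q) :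
    InTipIdeal G q :=
  let ⟨m, hm, hd⟩ := h
  ⟨m, hm, hd.trans h'⟩

theorem InTipIdeal.concat_right {a b m : QPath V} (h : InTipIdeal G a)
    (h' : concat a b = some m) : InTipIdeal G m := h.of_divides ((Divides.refl a).concat_right h')

theorem InTipIdeal.concat_left {a b m : QPath V} (h : InTipIdeal G b)
    (h' : concat a b = some m) : InTipIdeal G m := h.of_divides ((Divides.refl b).concat_left h')

theorem NonTip.left {a b m : QPath V} (h : NonTip G m) (h' : concat a b = some m) :
    NonTip G a := fun h1 => h (h1.concat_right h')

theorem NonTip.right {a b m : QPath V} (h : NonTip G m) (h' : concat a b = some m) :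
    NonTip G b := fun h1 => h (h1.concat_left h')

variable [Fintype V]

variable {I : TwoSidedIdeal (PathAlgebra k V)} {o ω : V}

variable (o ω I G) in
/-- The relations of a quiver algebra, where the non monomial relations are between paths from a
source `o` to a sink `ω`. -/
structure BranchRelations : Prop where
  noIn : ∀ p : QPath V, p.tgt = o → p.length = 0
  noOut : ∀ p : QPath V, p.src = ω → p.length = 0
  two_le : ∀ x ∈ I, ∀ p ∈ supp x, 2 ≤ p.length
  gens : IsToupieGenerators o ω I G

theorem IsToupie.branchRelations (hV : IsToupie V o ω) (hI : IsAdmissible I)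
    (hG : IsToupieGenerators o ω I G) : BranchRelations G I o ω where
  noIn p hp := by
    obtain ⟨p⟩ := p
    cases p with
    | nil => rfl
    | cons p e => exact (((hV.source_iff _).2 hp _).false e).elim
  noOut p hp := by
    by_contra h
    obtain ⟨a, b, h1, h2⟩ := exists_split p (n := 1) (by omega)
    rw [concat_src h1] at hp
    obtain ⟨a⟩ := a
    cases a with
    | nil => simp [QPath.length] at h2
    | cons a e =>
      have : a.length = 0 := by simpa [QPath.length] using h2
      have ha := a.eq_of_length_zero this
      dsimp only at hp
      subst ha
      exact ((hV.sink_iff _).2 hp _).false e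
  two_le := hI.two_le
  gens := hG

namespace BranchRelations

variable (R : BranchRelations G I o ω)
include R

theorem mem_ideal {g : PathAlgebra k V} (hg : g ∈ G) : g ∈ I := by
  rw [← R.gens.span_eq]
  exact TwoSidedIdeal.subset_span hg

theorem not_monoDiv {g : PathAlgebra k V} (hg : g ∈ G) (hn : IsNonMonomial g) {q : QPath V}
    (hq : q ∈ supp g) : ¬ MonoDiv G q :=
  fun ⟨m, hm, hd⟩ => R.gens.no_monomial g hg hn q hq m hm hd

/-- A monomial relation is determined by its tip, it is not a branch of a non-monomial relation, and
two non-monomial relations are separated by the echelon form. -/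
theorem tip_unique {g g' : PathAlgebra k V} (hg : g ∈ G) (hg' : g' ∈ G) {t : QPath V}
    (ht : IsTip g t) (ht' : IsTip g' t) : g = g' := by
  rcases R.gens.monomial_or g hg with ⟨p, rfl⟩ | hn
  · rcases R.gens.monomial_or g' hg' with ⟨p', rfl⟩ | hn'
    · rw [← isTip_ofPath.1 ht, ← isTip_ofPath.1 ht']
    · refine (R.not_monoDiv hg' hn' ht'.1 ⟨p, hg, ?_⟩).elim
      rw [isTip_ofPath.1 ht]
      exact Divides.refl p
  · rcases R.gens.monomial_or g' hg' with ⟨p', rfl⟩ | hn'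
    · refine (R.not_monoDiv hg hn ht.1 ⟨p', hg', ?_⟩).elim
      rw [isTip_ofPath.1 ht']
      exact Divides.refl p'
    · by_contra h
      exact mem_supp.1 ht'.1 (R.gens.reduced g hg g' hg' hn hn' h t ht)

/-- A path that is divided by a branch is equal to this branch. -/
theorem eq_of_divides {t p : QPath V} (h1 : t.src = o) (h2 : t.tgt = ω) (h : Divides t p) :
    p = t := by
  obtain ⟨a, m, b, h3, h4⟩ := h
  have ha := R.noIn a ((concat_meet h3).trans h1)
  have hm := concat_of_left_length ha h3
  subst hm
  exact concat_of_right_length (R.noOut b ((concat_meet h4).symm.trans h2)) h4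

/-- The tip of a non-monomial relation runs from `o` to `ω`, so it divides no path but itself. -/
theorem inTipIdeal_iff {p : QPath V} : InTipIdeal G p ↔
    MonoDiv G p ∨ ∃ g ∈ G, IsNonMonomial g ∧ IsTip g p := by
  constructor
  · rintro ⟨t, ⟨g, hg, ht⟩, hd⟩
    rcases R.gens.monomial_or g hg with ⟨q, rfl⟩ | hn
    · rw [isTip_ofPath] at ht
      subst ht
      exact Or.inl ⟨t, hg, hd⟩
    · have := R.gens.branches g hg hn t ht.1
      have := R.eq_of_divides this.1 this.2 hd
      subst this
      exact Or.inr ⟨g, hg, hn, ht⟩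
  · rintro (⟨m, hm, hd⟩ | ⟨g, hg, -, ht⟩)
    · exact ⟨m, ⟨_, hm, isTip_ofPath.2 rfl⟩, hd⟩
    · exact ⟨p, ⟨g, hg, ht⟩, Divides.refl p⟩

theorem two_le_of_mem_supp {g : PathAlgebra k V} (hg : g ∈ G) {q : QPath V} (hq : q ∈ supp g) :
    2 ≤ q.length := R.two_le g (R.mem_ideal hg) q hq

theorem two_le_of_inTipIdeal {p : QPath V} (h : InTipIdeal G p) : 2 ≤ p.length := by
  obtain ⟨t, ⟨g, hg, ht⟩, hd⟩ := h
  exact (R.two_le_of_mem_supp hg ht.1).trans hd.length_le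

theorem nonTip_of_length {p : QPath V} (h : p.length ≤ 1) : NonTip G p := fun h' => by
  have := R.two_le_of_inTipIdeal h'
  omega

/-- Here the echelon form is used: a branch of `g` other than its tip is no tip of another relation.
So t − g is already in normal form, and rewriting ends after one step. -/
theorem nonTip_of_mem_supp {g : PathAlgebra k V} (hg : g ∈ G) (hn : IsNonMonomial g)
    {q t : QPath V} (hq : q ∈ supp g) (ht : IsTip g t) (hqt : q ≠ t) : NonTip G q := by
  intro h
  rcases R.inTipIdeal_iff.1 h with h | ⟨g', hg', hn', ht'⟩
  · exact R.not_monoDiv hg hn hq h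
  · by_cases e : g' = g
    · subst e
      exact hqt (ht'.unique ht)
    · exact mem_supp.1 hq (R.gens.reduced g' hg' g hg hn' hn e q ht')

end BranchRelations

open Classical in
variable (G) in
/-- The expansion of the class of a path in `NonTip(I)`. -/
def reducePath (p : QPath V) : PathAlgebra k V :=
  if MonoDiv G p then 0
  else if h : ∃ g ∈ G, IsNonMonomial g ∧ IsTip g p then ofPath k p - h.choose else ofPath k p

variable (G) in
/-- The expansion of the class of an element of the path algebra in `NonTip(I)`. -/
def reduce : PathAlgebra k V →ₗ[k] PathAlgebra k V :=
  (Finsupp.linearCombination k (reducePath G) : (QPath V →₀ k) →ₗ[k] PathAlgebra k V)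

theorem reduce_ofPath (p : QPath V) : reduce G (ofPath k p) = reducePath G p :=
  (Finsupp.linearCombination_single k _ _).trans (one_smul _ _)

theorem reduce_of_monoDiv {p : QPath V} (h : MonoDiv G p) : reduce G (ofPath k p) = 0 := by
  rw [reduce_ofPath, reducePath, if_pos h]

namespace BranchRelations

variable (R : BranchRelations G I o ω)
include R

theorem reduce_of_nonTip {p : QPath V} (h : NonTip G p) :
    reduce G (ofPath k p) = ofPath k p := by
  rw [NonTip, R.inTipIdeal_iff, not_or] at h
  rw [reduce_ofPath, reducePath, if_neg h.1, dif_neg h.2]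

theorem reduce_of_isTip {g : PathAlgebra k V} (hg : g ∈ G) (hn : IsNonMonomial g) {p : QPath V}
    (ht : IsTip g p) : reduce G (ofPath k p) = ofPath k p - g := by
  have h : ∃ g ∈ G, IsNonMonomial g ∧ IsTip g p := ⟨g, hg, hn, ht⟩
  rw [reduce_ofPath, reducePath, if_neg (R.not_monoDiv hg hn ht.1), dif_pos h,
    R.tip_unique h.choose_spec.1 hg h.choose_spec.2.2 ht]

theorem reduce_of_supp {x : PathAlgebra k V} (h : ∀ q ∈ supp x, NonTip G q) :
    reduce G x = x :=
  lin_eq_of_supp (g := LinearMap.id) fun p hp => R.reduce_of_nonTip (h p hp)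

theorem nonTip_of_mem_supp_sub {g : PathAlgebra k V} (hg : g ∈ G) (hn : IsNonMonomial g)
    {t : QPath V} (ht : IsTip g t) : ∀ q ∈ supp (ofPath k t - g), NonTip G q := by
  intro q hq
  rw [mem_supp, coeff_sub] at hq
  have hqt : q ≠ t := by
    rintro rfl
    rw [coeff_ofPath_self, R.gens.monic g hg hn q ht, sub_self] at hq
    exact hq rfl
  have h0 : coeff (ofPath k t) q = 0 := Finsupp.single_eq_of_ne hqt
  rw [h0, zero_sub, neg_ne_zero] at hq
  exact R.nonTip_of_mem_supp hg hn (mem_supp.2 hq) ht hqt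

theorem nonTip_of_mem_supp_reducePath (p : QPath V) :
    ∀ q ∈ supp (reducePath G p), NonTip G q := by
  intro q hq
  by_cases h1 : MonoDiv G p
  · rw [reducePath, if_pos h1] at hq
    exact (mem_supp.1 hq rfl).elim
  by_cases h2 : ∃ g ∈ G, IsNonMonomial g ∧ IsTip g p
  · obtain ⟨g, hg, hn, ht⟩ := h2
    rw [← reduce_ofPath, R.reduce_of_isTip hg hn ht] at hq
    exact R.nonTip_of_mem_supp_sub hg hn ht q hq
  · have : NonTip G p := by
      rw [NonTip, R.inTipIdeal_iff, not_or]
      exact ⟨h1, h2⟩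
    rw [← reduce_ofPath, R.reduce_of_nonTip this, supp_ofPath, Finset.mem_singleton] at hq
    rwa [hq]

theorem nonTip_of_mem_supp_reduce (x : PathAlgebra k V) :
    ∀ q ∈ supp (reduce G x), NonTip G q := by
  intro q hq
  by_contra h
  have h0 : coeffLin q (reduce G x) = 0 :=
    lin_eq_of_supp (f := coeffLin q ∘ₗ reduce G) (g := 0) fun p _ => by
      by_contra hp
      rw [LinearMap.comp_apply, reduce_ofPath] at hp
      exact h (R.nonTip_of_mem_supp_reducePath p q (mem_supp.2 hp))
  exact mem_supp.1 hq h0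

theorem reduce_relation {g : PathAlgebra k V} (hg : g ∈ G) : reduce G g = 0 := by
  rcases R.gens.monomial_or g hg with ⟨p, rfl⟩ | hn
  · exact reduce_of_monoDiv ⟨p, hg, Divides.refl p⟩
  · obtain ⟨t, ht⟩ := exists_isTip hn
    have h1 := R.reduce_of_isTip hg hn ht
    have h2 := R.reduce_of_supp (R.nonTip_of_mem_supp_sub hg hn ht)
    rw [map_sub, h1] at h2
    simpa using h2

/-- Either `a` is trivial at `o` and a g = g, or no path of `g` composes with `a`, since nothing of
positive length ends at `o`. -/
theorem reduce_ofPath_mul_relation (a : QPath V) {g : PathAlgebra k V} (hg : g ∈ G)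
    (hn : IsNonMonomial g) : reduce G (ofPath k a * g) = 0 := by
  by_cases ha : a = triv o
  · have : ofPath k a * g = g := by
      rw [ofPath_mul_eq_sum]
      refine (Finset.sum_congr rfl fun p hp => ?_).trans (sum_coeff_smul g)
      have h := triv_concat p
      rw [(R.gens.branches g hg hn p hp).1, ← ha] at h
      rw [ofPath_mul_of_concat h]
    rw [this, R.reduce_relation hg]
  · have : ofPath k a * g = 0 := by
      rw [ofPath_mul_eq_sum]
      refine Finset.sum_eq_zero fun p hp => ?_
      rw [ofPath_mul, pathMul, concat_of_ne]
      · exact smul_zero _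
      · intro h
        rw [(R.gens.branches g hg hn p hp).1] at h
        have h1 := R.noIn a h
        have h2 := concat_of_right_length (a := triv a.src) (b := a) h1 (triv_concat a)
        rw [h2] at h
        exact ha (h2.trans (congrArg triv h))
    rw [this, map_zero]

theorem reduce_relation_mul_ofPath (a : QPath V) {g : PathAlgebra k V} (hg : g ∈ G)
    (hn : IsNonMonomial g) : reduce G (g * ofPath k a) = 0 := by
  by_cases ha : a = triv ω
  · have : g * ofPath k a = g := by
      rw [mul_ofPath_eq_sum]
      refine (Finset.sum_congr rfl fun p hp => ?_).trans (sum_coeff_smul g)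
      have h := concat_triv p
      rw [(R.gens.branches g hg hn p hp).2, ← ha] at h
      rw [ofPath_mul_of_concat h]
    rw [this, R.reduce_relation hg]
  · have : g * ofPath k a = 0 := by
      rw [mul_ofPath_eq_sum]
      refine Finset.sum_eq_zero fun p hp => ?_
      rw [ofPath_mul, pathMul, concat_of_ne]
      · exact smul_zero _
      · intro h
        rw [(R.gens.branches g hg hn p hp).2] at h
        have h1 := R.noOut a h.symm
        exact ha ((eq_triv_of_length h1).trans (congrArg triv h.symm))
    rw [this, map_zero]

theorem reduce_ofPath_mul_reduce (a p : QPath V) :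
    reduce G (ofPath k a * reduce G (ofPath k p)) = reduce G (ofPath k a * ofPath k p) := by
  by_cases h1 : MonoDiv G p
  · rw [reduce_of_monoDiv h1, mul_zero, map_zero, ofPath_mul, pathMul]
    cases h : concat a p with
    | none => exact (map_zero _).symm
    | some m => exact (reduce_of_monoDiv (h1.of_divides ((Divides.refl p).concat_left h))).symm
  by_cases h2 : ∃ g ∈ G, IsNonMonomial g ∧ IsTip g p
  · obtain ⟨g, hg, hn, ht⟩ := h2
    rw [R.reduce_of_isTip hg hn ht, mul_sub, map_sub, R.reduce_ofPath_mul_relation a hg hn,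
      sub_zero]
  · rw [R.reduce_of_nonTip]
    rw [NonTip, R.inTipIdeal_iff, not_or]
    exact ⟨h1, h2⟩

theorem reduce_reduce_mul_ofPath (a p : QPath V) :
    reduce G (reduce G (ofPath k p) * ofPath k a) = reduce G (ofPath k p * ofPath k a) := by
  by_cases h1 : MonoDiv G p
  · rw [reduce_of_monoDiv h1, zero_mul, map_zero, ofPath_mul, pathMul]
    cases h : concat p a with
    | none => exact (map_zero _).symm
    | some m => exact (reduce_of_monoDiv (h1.of_divides ((Divides.refl p).concat_right h))).symm
  by_cases h2 : ∃ g ∈ G, IsNonMonomial g ∧ IsTip g p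
  · obtain ⟨g, hg, hn, ht⟩ := h2
    rw [R.reduce_of_isTip hg hn ht, sub_mul, map_sub, R.reduce_relation_mul_ofPath a hg hn,
      sub_zero]
  · rw [R.reduce_of_nonTip]
    rw [NonTip, R.inTipIdeal_iff, not_or]
    exact ⟨h1, h2⟩

theorem reduce_mul_reduce (x y : PathAlgebra k V) :
    reduce G (x * reduce G y) = reduce G (x * y) := by
  refine lin_eq_of_supp (f := reduce G ∘ₗ (mulLin k).flip (reduce G y))
    (g := reduce G ∘ₗ (mulLin k).flip y) fun a _ => ?_
  refine lin_eq_of_supp (f := reduce G ∘ₗ mulLin k (ofPath k a) ∘ₗ reduce G)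
    (g := reduce G ∘ₗ mulLin k (ofPath k a)) fun p _ => ?_
  exact R.reduce_ofPath_mul_reduce a p

theorem reduce_reduce_mul (x y : PathAlgebra k V) :
    reduce G (reduce G x * y) = reduce G (x * y) := by
  refine lin_eq_of_supp (f := reduce G ∘ₗ mulLin k (reduce G x))
    (g := reduce G ∘ₗ mulLin k x) fun a _ => ?_
  refine lin_eq_of_supp (f := reduce G ∘ₗ (mulLin k).flip (ofPath k a) ∘ₗ reduce G)
    (g := reduce G ∘ₗ (mulLin k).flip (ofPath k a)) fun p _ => ?_
  exact R.reduce_reduce_mul_ofPath a p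

/-- The ideal consists of sums of products a g b with `g` in `G`; reducing inside the product
replaces g by zero. -/
theorem reduce_eq_zero_of_mem {x : PathAlgebra k V} (hx : x ∈ I) : reduce G x = 0 := by
  rw [← R.gens.span_eq, TwoSidedIdeal.mem_span_iff_mem_addSubgroup_closure] at hx
  induction hx using AddSubgroup.closure_induction with
  | mem y hy =>
    obtain ⟨_, ⟨a, -, g, hg, rfl⟩, b, -, rfl⟩ := hy
    change reduce G (a * g * b) = 0
    rw [← R.reduce_reduce_mul, ← R.reduce_mul_reduce a g, R.reduce_relation hg, mul_zero,
      map_zero, zero_mul, map_zero]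
  | zero => exact map_zero _
  | add y z _ _ hy hz => rw [map_add, hy, hz, add_zero]
  | neg y _ hy => rw [map_neg, hy, neg_zero]

theorem ofPath_mem_of_monoDiv {p : QPath V} (h : MonoDiv G p) : ofPath k p ∈ I := by
  obtain ⟨m, hm, a, n, b, h1, h2⟩ := h
  rw [← ofPath_mul_of_concat h2, ← ofPath_mul_of_concat h1]
  exact I.mul_mem_right _ _ (I.mul_mem_left _ _ (R.mem_ideal hm))

theorem reduce_sub_mem (x : PathAlgebra k V) : reduce G x - x ∈ I := by
  have hp : ∀ p, reduce G (ofPath k p) - ofPath k p ∈ I := by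
    intro p
    by_cases h1 : MonoDiv G p
    · rw [reduce_of_monoDiv h1, zero_sub]
      exact I.neg_mem (R.ofPath_mem_of_monoDiv h1)
    by_cases h2 : ∃ g ∈ G, IsNonMonomial g ∧ IsTip g p
    · obtain ⟨g, hg, hn, ht⟩ := h2
      rw [R.reduce_of_isTip hg hn ht, sub_sub_cancel_left]
      exact I.neg_mem (R.mem_ideal hg)
    · rw [R.reduce_of_nonTip, sub_self]
      · exact I.zero_mem
      · rw [NonTip, R.inTipIdeal_iff, not_or]
        exact ⟨h1, h2⟩
  induction x using lin_induction with
  | h0 => rw [map_zero, sub_zero]; exact I.zero_mem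
  | hadd y z hy hz =>
    rw [map_add, add_sub_add_comm]
    exact I.add_mem hy hz
  | hs c p =>
    rw [map_smul, ← smul_sub]
    exact smul_mem_ideal (hp p) c

/-- A combination of paths in `NonTip` is fixed by `reduce`, and `reduce` depends only on the class
modulo `I`. -/
theorem isNormalForm_iff {x y : PathAlgebra k V} : IsNormalForm I G x y ↔ y = reduce G x := by
  have hq : (y : QuiverAlgebra I) = (x : QuiverAlgebra I) ↔ y - x ∈ I :=
    (RingCon.eq _).trans (TwoSidedIdeal.rel_iff I _ _)
  rw [IsNormalForm, hq]
  constructor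
  · rintro ⟨h1, h2⟩
    have := R.reduce_eq_zero_of_mem h2
    rw [map_sub, R.reduce_of_supp h1, sub_eq_zero] at this
    exact this
  · rintro rfl
    exact ⟨R.nonTip_of_mem_supp_reduce x, R.reduce_sub_mem x⟩

theorem existsUnique_isNormalForm (x : PathAlgebra k V) : ∃! y, IsNormalForm I G x y :=
  ⟨_, R.isNormalForm_iff.2 rfl, fun _ h => R.isNormalForm_iff.1 h⟩

theorem normalForm_eq (x : PathAlgebra k V) : normalForm I G x = reduce G x := by
  have h : ∃ y, IsNormalForm I G x y := (R.existsUnique_isNormalForm x).exists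
  rw [normalForm, dif_pos h]
  exact R.isNormalForm_iff.1 h.choose_spec

theorem ofPath_not_mem_of_nonTip {p : QPath V} (h : NonTip G p) : ofPath k p ∉ I := by
  intro hp
  have h1 := R.reduce_eq_zero_of_mem hp
  rw [R.reduce_of_nonTip h] at h1
  exact one_ne_zero (α := k) ((coeff_ofPath_self p).symm.trans (congrArg (coeff · p) h1))

end BranchRelations

end Reduction

end Toupie

end

noncomputable section

namespace Toupie

open QPath

/-! ### Chains and the Anick matching -/

section Chains

variable {k V : Type*} [Field k] [Quiver V] [LinearOrder (QPath V)] {G : Set (PathAlgebra k V)}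

theorem isChain_cons_iff {a : QPath V} {l : List (QPath V)} : IsChain G (a :: l) ↔
    (∀ x ∈ a :: l, 0 < x.length ∧ NonTip G x) ∧
      List.IsChain (UfEdge G) (triv a.src :: a :: l) := Iff.rfl

theorem IsChain.of_append {u t : List (QPath V)} (h : IsChain G (u ++ t)) : IsChain G u := by
  cases u with
  | nil => trivial
  | cons a u =>
    refine ⟨fun x hx => h.1 x (List.mem_append_left _ hx), ?_⟩
    have h2 : List.IsChain (UfEdge G) ((triv a.src :: a :: u) ++ t) := h.2
    exact (List.isChain_append.1 h2).1

theorem IsChain.of_mem {u : List (QPath V)} (h : IsChain G u) {x : QPath V} (hx : x ∈ u) :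
    0 < x.length ∧ NonTip G x := by
  cases u with
  | nil => simp at hx
  | cons a u => exact h.1 x hx

variable (G) in
/-- The product `e a` is in `⟨W⟩`, but none of its proper left factors is. -/
def IsMinimalProduct (e a : QPath V) : Prop :=
  ∃ m : QPath V, concat e a = some m ∧ InTipIdeal G m ∧
    ∀ w p : QPath V, concat w p = some m → 1 ≤ p.length → ¬ InTipIdeal G w

/-- If `e w` is in `⟨W⟩`, then there is a minimal left factor `a` of `w` with `e a ∈ ⟨W⟩`. -/
theorem exists_isMinimalProduct {e w m : QPath V} (he : NonTip G e) (hm : concat e w = some m)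
    (h : InTipIdeal G m) :
    ∃ a b, concat a b = some w ∧ 0 < a.length ∧ IsMinimalProduct G e a := by
  classical
  -- Lengths of the left factors a of `w` with ea ∈ ⟨W⟩. The least one gives the minimal product; it
  -- is not 0 because `e` is in `NonTip`.
  let P : ℕ → Prop := fun n => ∃ a b m', a.length = n ∧ concat a b = some w ∧
    concat e a = some m' ∧ InTipIdeal G m'
  have hP : ∃ n, P n := ⟨_, w, triv w.tgt, m, rfl, concat_triv w, hm, h⟩
  obtain ⟨a, b, m', hn, hab, hea, hm'⟩ := Nat.find_spec hP
  refine ⟨a, b, hab, ?_, m', hea, hm', fun x p hx hp hxt => ?_⟩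
  · by_contra h0
    rw [concat_of_right_length (by omega) hea] at hm'
    exact he hm'
  · rcases le_total x.length e.length with hl | hl
    · obtain ⟨c, hc, -⟩ := concat_refine hx hea hl
      exact he (hxt.concat_right hc)
    · obtain ⟨c, hc, hc'⟩ := concat_refine hea hx hl
      obtain ⟨y, -, hy⟩ := concat_assoc_left hc' hab
      have h1 := concat_length hc'
      exact Nat.find_min hP (m := c.length) (by omega) ⟨c, y, x, rfl, hy, hc, hxt⟩

/-- A minimal product `e a` is of the form `x s` with `s ∈ W`. -/
theorem exists_tip_of_minimal {e a m : QPath V} (hm : concat e a = some m) (h : InTipIdeal G m)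
    (hmin : ∀ w p : QPath V, concat w p = some m → 1 ≤ p.length → ¬ InTipIdeal G w)
    (ha : NonTip G a) :
    ∃ s ∈ TipSet G, ∃ x y, concat x s = some m ∧ 1 ≤ y.length ∧ concat x y = some e ∧
      concat y a = some s := by
  obtain ⟨s, hs, x, n, z, hx, hz⟩ := h
  -- The tip s must end where m ends, by minimality. It must begin inside e, as otherwise it would
  -- be a factor of a.
  have hzl : z.length = 0 := by
    by_contra hz0
    exact hmin n z hz (by omega) ⟨s, hs, (Divides.refl s).concat_left hx⟩
  have := concat_of_right_length hzl hz
  subst this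
  have hl : x.length < e.length := by
    by_contra hl
    obtain ⟨c, -, hc⟩ := concat_refine hm hx (by omega)
    exact ha ⟨s, hs, (Divides.refl s).concat_left hc⟩
  obtain ⟨y, hy, hy'⟩ := concat_refine hx hm hl.le
  have := concat_length hy
  exact ⟨s, hs, x, y, hx, by omega, hy, hy'⟩

/-- The tip that completes the product begins inside `e` and contains all of `a`, so `a` is a proper
right factor of it. The vertex conditions in `UfEdge` are thus automatic along chains. -/
theorem IsMinimalProduct.ufVertex {e a : QPath V} (h : IsMinimalProduct G e a)
    (ha : NonTip G a) : UfVertex G a := by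
  obtain ⟨m, hm, hmt, hmin⟩ := h
  obtain ⟨s, hs, -, y, -, hy, -, hya⟩ := exists_tip_of_minimal hm hmt hmin ha
  exact Or.inr (Or.inr ⟨s, hs, y, hy, hya⟩)

theorem UfEdge.isMinimalProduct {e a : QPath V} (h : UfEdge G e a) (he : 0 < e.length) :
    UfVertex G a ∧ IsMinimalProduct G e a := by
  rcases h with ⟨h, -⟩ | ⟨-, h, h'⟩
  · rw [h, length_triv] at he
    omega
  · exact ⟨h, h'⟩

/-- An edge of the second kind from a trivial path would put `a` itself into ⟨W⟩. -/
theorem isChain_singleton_iff {a : QPath V} :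
    IsChain G [a] ↔ a.length = 1 ∧ NonTip G a := by
  rw [isChain_cons_iff]
  simp only [List.mem_singleton, forall_eq, List.isChain_cons_cons, List.isChain_singleton,
    and_true]
  constructor
  · rintro ⟨⟨h1, h2⟩, ⟨-, h⟩ | ⟨-, -, m, hm, hmt, -⟩⟩
    · exact ⟨h, h2⟩
    · rw [concat_of_left_length (length_triv _) hm] at hmt
      exact (h2 hmt).elim
  · rintro ⟨h1, h2⟩
    exact ⟨⟨by omega, h2⟩, Or.inl ⟨rfl, h1⟩⟩

theorem isChain_append_pair_iff_ufEdge {u : List (QPath V)} {e a : QPath V} :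
    IsChain G (u ++ [e, a]) ↔
      IsChain G (u ++ [e]) ∧ 0 < a.length ∧ NonTip G a ∧ UfEdge G e a := by
  cases u with
  | nil =>
    simp only [List.nil_append, isChain_cons_iff, List.isChain_cons_cons,
      List.isChain_singleton, List.mem_cons, forall_eq_or_imp, List.not_mem_nil,
      and_true, false_imp_iff, forall_true_iff]
    tauto
  | cons x u =>
    have e1 : triv x.src :: x :: (u ++ [e, a]) = (triv x.src :: x :: (u ++ [e])) ++ [a] := by
      simp
    simp only [List.cons_append, isChain_cons_iff]
    rw [e1, List.isChain_append]
    simp only [List.mem_cons, List.mem_append, List.not_mem_nil, or_false,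
      List.isChain_singleton, true_and, List.head?_cons, Option.mem_def, Option.some.injEq,
      forall_eq']
    have e2 : (triv x.src :: x :: (u ++ [e])).getLast? = some e := by
      simp [List.getLast?_cons]
    rw [e2]
    simp only [Option.some.injEq, forall_eq']
    constructor
    · rintro ⟨h1, h2, h3⟩
      exact ⟨⟨fun y hy => h1 y (by tauto), h2⟩, (h1 a (by simp)).1, (h1 a (by simp)).2, h3⟩
    · rintro ⟨⟨h1, h2⟩, h3, h4, h5⟩
      refine ⟨fun y hy => ?_, h2, h5⟩
      by_cases hya : y = a
      · subst hya; exact ⟨h3, h4⟩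
      · exact h1 y (by tauto)

theorem IsChain.ufVertex {u : List (QPath V)} {e : QPath V} (h : IsChain G (u ++ [e])) :
    UfVertex G e := by
  rcases List.eq_nil_or_concat u with rfl | ⟨u, x, rfl⟩
  · exact Or.inr (Or.inl (isChain_singleton_iff.1 h).1)
  · rw [List.concat_eq_append, List.append_assoc] at h
    obtain ⟨h1, -, -, h2⟩ := isChain_append_pair_iff_ufEdge.1 h
    exact (h2.isMinimalProduct (h1.of_mem (by simp)).1).1

theorem isChain_append_pair_iff {u : List (QPath V)} {e a : QPath V} :
    IsChain G (u ++ [e, a]) ↔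
      IsChain G (u ++ [e]) ∧ 0 < a.length ∧ NonTip G a ∧ IsMinimalProduct G e a := by
  rw [isChain_append_pair_iff_ufEdge]
  refine and_congr_right fun h => and_congr_right fun h1 => and_congr_right fun h2 => ?_
  have he := h.of_mem (x := e) (by simp)
  exact ⟨fun h3 => (h3.isMinimalProduct he.1).2,
    fun h3 => Or.inr ⟨h.ufVertex, h3.ufVertex h2, h3⟩⟩

/-- The continuation of a chain by a left factor of a given path is unique. -/
theorem eq_of_isChain_append {u : List (QPath V)} {a b a' b' w : QPath V}
    (h : IsChain G (u ++ [a])) (h' : IsChain G (u ++ [a'])) (hw : concat a b = some w)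
    (hw' : concat a' b' = some w) : a = a' := by
  rcases List.eq_nil_or_concat u with rfl | ⟨s, e, rfl⟩
  · exact (concat_inj hw hw' ((isChain_singleton_iff.1 h).1.trans
      (isChain_singleton_iff.1 h').1.symm)).1
  · have key : ∀ {a b a' b' : QPath V}, IsMinimalProduct G e a → IsMinimalProduct G e a' →
        concat a b = some w → concat a' b' = some w → a.length ≤ a'.length → a = a' := by
      rintro a b a' b' ⟨m, hm, hmt, -⟩ ⟨m', hm', -, hmin⟩ hw hw' hl
      obtain ⟨c, hc, -⟩ := concat_refine hw hw' hl
      by_cases hc0 : c.length = 0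
      · exact (concat_of_right_length hc0 hc).symm
      · obtain ⟨x, hx, hx'⟩ := concat_assoc_right hc hm'
        rw [hm, Option.some_inj] at hx
        subst hx
        exact (hmin _ _ hx' (by omega) hmt).elim
    rw [List.concat_eq_append, List.append_assoc] at h h'
    have h1 := (isChain_append_pair_iff.1 h).2.2.2
    have h2 := (isChain_append_pair_iff.1 h').2.2.2
    rcases le_total a.length a'.length with hl | hl
    · exact key h1 h2 hw hw' hl
    · exact (key h2 h1 hw' hw hl).symm

theorem not_isChain_of_split {u : List (QPath V)} {a b w : QPath V}
    (h : IsChain G (u ++ [a])) (hw : concat a b = some w) (hb : 0 < b.length) :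
    ¬ IsChain G (u ++ [w]) := fun h' => by
  have := eq_of_isChain_append h h' hw (concat_triv w)
  subst this
  have := concat_length hw
  omega

theorem not_isChain_of_nonTip {u : List (QPath V)} {a b w : QPath V} (hw : concat a b = some w)
    (h : NonTip G w) : ¬ IsChain G (u ++ [a, b]) := fun h' => by
  obtain ⟨m, hm, hmt, -⟩ := (isChain_append_pair_iff.1 h').2.2.2
  rw [hw, Option.some_inj] at hm
  subst hm
  exact h hmt

/-- The longest chain with which a list starts is unique. -/
theorem eq_of_longest {u u' t t' : List (QPath V)} {w w' : QPath V}
    (e : u ++ w :: t = u' ++ w' :: t') (h : IsChain G u) (h' : IsChain G u')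
    (hw : ¬ IsChain G (u ++ [w])) (hw' : ¬ IsChain G (u' ++ [w'])) :
    u = u' ∧ w = w' ∧ t = t' := by
  have key : ∀ {u u' t t' : List (QPath V)} {w w' : QPath V}, u ++ w :: t = u' ++ w' :: t' →
      IsChain G u' → ¬ IsChain G (u ++ [w]) → u'.length ≤ u.length := by
    intro u u' t t' w w' e h' hw
    by_contra hl
    rw [List.append_eq_append_iff] at e
    rcases e with ⟨a, rfl, h1⟩ | ⟨a, rfl, h1⟩
    · cases a with
      | nil => simp at hl
      | cons x a =>
        rw [List.cons_append, List.cons_eq_cons] at h1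
        rw [← h1.1, List.append_cons] at h'
        exact hw h'.of_append
    · simp at hl
  have := List.append_inj e (le_antisymm (key e.symm h hw') (key e h' hw))
  simpa using this

theorem exists_longest {l : List (QPath V)} (h : ¬ IsChain G l) :
    ∃ u w t, l = u ++ w :: t ∧ IsChain G u ∧ ¬ IsChain G (u ++ [w]) := by
  have key : ∀ l u, IsChain G u → ¬ IsChain G (u ++ l) →
      ∃ u' w t, u ++ l = u' ++ w :: t ∧ IsChain G u' ∧ ¬ IsChain G (u' ++ [w]) := by
    intro l
    induction l with
    | nil => intro u h h'; simp [h] at h'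
    | cons w l ih =>
      intro u h h'
      by_cases hw : IsChain G (u ++ [w])
      · rw [List.append_cons] at h' ⊢
        exact ih _ hw h'
      · exact ⟨u, w, l, rfl, h, hw⟩
  exact key l [] trivial h

open Classical in
variable (G) in
/-- The length of the longest chain with which a list starts. -/
def chainPrefix (l : List (QPath V)) : ℕ :=
  Nat.findGreatest (fun n => IsChain G (l.take n)) l.length

theorem le_chainPrefix {u t : List (QPath V)} (h : IsChain G u) :
    u.length ≤ chainPrefix G (u ++ t) := by
  classical
  exact Nat.le_findGreatest (by simp) (by simpa using h)

theorem chainPrefix_eq {u t : List (QPath V)} {w : QPath V} (h : IsChain G u)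
    (hw : ¬ IsChain G (u ++ [w])) : chainPrefix G (u ++ w :: t) = u.length := by
  classical
  refine le_antisymm ?_ (le_chainPrefix h)
  by_contra hl
  have h1 : IsChain G ((u ++ w :: t).take (chainPrefix G (u ++ w :: t))) :=
    Nat.findGreatest_spec (P := fun n => IsChain G ((u ++ w :: t).take n)) (m := u.length)
      (by simp) (by simpa using h)
  obtain ⟨n, hn⟩ : ∃ n, chainPrefix G (u ++ w :: t) = u.length + (n + 1) :=
    ⟨chainPrefix G (u ++ w :: t) - u.length - 1, by omega⟩
  rw [hn, List.take_length_add_append, List.take_succ_cons, List.append_cons] at h1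
  exact hw h1.of_append

/-! ### Bar terms -/

theorem isBarTerm_split {v : V} {u t : List (QPath V)} {a b w : QPath V}
    (hw : concat a b = some w) (ha : 0 < a.length) (hb : 0 < b.length) (hn : NonTip G w) :
    IsBarTerm G v (u ++ w :: t) ↔ IsBarTerm G v (u ++ a :: b :: t) := by
  induction u generalizing v with
  | nil =>
    have := concat_length hw
    simp only [List.nil_append, IsBarTerm, concat_src hw, concat_tgt hw, concat_meet hw, hn,
      hn.left hw, hn.right hw, ha, hb, true_and, and_congr_right_iff]
    intro
    exact ⟨fun h => h.2, fun h => ⟨by omega, h⟩⟩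
  | cons x u ih => simp only [List.cons_append, IsBarTerm, ih]

theorem IsBarTerm.of_mem {v : V} {l : List (QPath V)} (h : IsBarTerm G v l) {x : QPath V}
    (hx : x ∈ l) : 0 < x.length ∧ NonTip G x := by
  induction l generalizing v with
  | nil => simp at hx
  | cons w l ih =>
    rcases List.mem_cons.1 hx with rfl | hx
    · exact ⟨h.2.1, h.2.2.1⟩
    · exact ih h.2.2.2 hx

theorem IsBarTerm.exists_of_append {v : V} {u t : List (QPath V)} (h : IsBarTerm G v (u ++ t)) :
    ∃ v', IsBarTerm G v' t := by
  induction u generalizing v with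
  | nil => exact ⟨v, h⟩
  | cons w l ih => exact ih h.2.2.2

theorem IsBarTerm.meet {v : V} {u t : List (QPath V)} {a b : QPath V}
    (h : IsBarTerm G v (u ++ a :: b :: t)) : a.tgt = b.src := by
  obtain ⟨v', h⟩ := h.exists_of_append
  exact h.2.2.2.1.symm

/-- The longest initial chain recovers all data: it is [u|a] for a source [u|a|b|t] and u for a
target [u|w|t], and u and w determine a. -/
theorem AnickMatching.eq {x y x' y' : BarTerm G} (h : AnickMatching G x y)
    (h' : AnickMatching G x' y') (e : x = x' ∨ x = y' ∨ y = x' ∨ y = y') : x = x' ∧ y = y' := by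
  -- If [u|a|b|t] were also a target, its entry b would split as a'b' with [u|a|a'] a chain. Then
  -- aa', and with it ab, would lie in ⟨W⟩, but ab is an entry of a bar term.
  have ne : ∀ {x y x' y' : BarTerm G}, AnickMatching G x y → AnickMatching G x' y' →
      x ≠ y' := by
    rintro x y x' y' ⟨u, a, b, w, t, hab, -, hx, hy, hu, hw, ha, hb⟩
      ⟨u', a', b', w', t', hab', -, -, hy', hu', hw', ha', hb'⟩ rfl
    have e : (u ++ [a]) ++ b :: t = u' ++ w' :: t' := by rw [← hy', hx]; simp
    obtain ⟨rfl, rfl, rfl⟩ := eq_of_longest e ha hu' (by simpa using hb) hw'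
    rw [List.append_assoc] at ha'
    obtain ⟨m, hm, hmt, -⟩ := (isChain_append_pair_iff.1 ha').2.2.2
    obtain ⟨z, hz, hz'⟩ := concat_assoc_right hab' hab
    rw [hm, Option.some_inj] at hz
    subst hz
    have hyb := y.2
    rw [hy] at hyb
    exact (hyb.of_mem (x := w) (by simp)).2 (hmt.concat_right hz')
  rcases e with e | e | e | e
  · subst e
    obtain ⟨u, a, b, w, t, hab, hv, hx, hy, hu, hw, ha, hb⟩ := h
    obtain ⟨u', a', b', w', t', hab', hv', hx', hy', hu', hw', ha', hb'⟩ := h'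
    have e : (u ++ [a]) ++ b :: t = (u' ++ [a']) ++ b' :: t' := by
      simpa using hx.symm.trans hx'
    obtain ⟨h1, rfl, rfl⟩ := eq_of_longest e ha ha' (by simpa using hb) (by simpa using hb')
    obtain ⟨rfl, h2⟩ := List.append_inj' h1 rfl
    simp only [List.cons.injEq, and_true] at h2
    subst h2
    rw [hab, Option.some_inj] at hab'
    subst hab'
    exact ⟨rfl, Subtype.ext (Prod.ext (hv.symm.trans hv') (hy.trans hy'.symm))⟩
  · exact (ne h h' e).elim
  · exact (ne h' h e.symm).elim
  · subst e
    obtain ⟨u, a, b, w, t, hab, hv, hx, hy, hu, hw, ha, hb⟩ := h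
    obtain ⟨u', a', b', w', t', hab', hv', hx', hy', hu', hw', ha', hb'⟩ := h'
    obtain ⟨rfl, rfl, rfl⟩ := eq_of_longest (hy.symm.trans hy') hu hu' hw hw'
    have := eq_of_isChain_append ha ha' hab hab'
    subst this
    have := concat_left_cancel hab hab'
    subst this
    exact ⟨Subtype.ext (Prod.ext (hv.trans hv'.symm) (hx.trans hx'.symm)), rfl⟩

variable [Fintype V] {I : TwoSidedIdeal (PathAlgebra k V)} {o ω : V}

namespace BranchRelations

variable (R : BranchRelations G I o ω)
include R

/-- A chain can be continued by a left factor of `w`, if the product of its last entry and `w` is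
in `⟨W⟩`. -/
theorem exists_split_of_inTipIdeal {u t : List (QPath V)} {v : V} {w : QPath V}
    (hu : IsChain G u) (hv : IsBarTerm G v (u ++ w :: t))
    (h : ∀ s e m, u = s ++ [e] → concat e w = some m → InTipIdeal G m) :
    ∃ a b, concat a b = some w ∧ IsChain G (u ++ [a]) := by
  have hw := hv.of_mem (x := w) (by simp)
  rcases List.eq_nil_or_concat u with rfl | ⟨s, e, rfl⟩
  · obtain ⟨a, b, hab, ha⟩ := exists_split w (n := 1) hw.1
    exact ⟨a, b, hab, isChain_singleton_iff.2 ⟨ha, R.nonTip_of_length ha.le⟩⟩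
  · rw [List.concat_eq_append] at hu hv h ⊢
    rw [List.append_assoc] at hv
    obtain ⟨m, hm⟩ := exists_concat hv.meet
    obtain ⟨a, b, hab, ha, hmin⟩ := exists_isMinimalProduct (hu.of_mem (x := e) (by simp)).2 hm
      (h s e m rfl hm)
    refine ⟨a, b, hab, ?_⟩
    rw [List.append_assoc]
    exact isChain_append_pair_iff.2 ⟨hu, ha, hw.2.left hab, hmin⟩

theorem isCritical_iff (x : BarTerm G) : IsCritical (AnickMatching G) x ↔ IsChain G x.1.2 := by
  constructor
  · intro hx
    by_contra hc
    obtain ⟨⟨v, l⟩, hl⟩ := x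
    obtain ⟨u, w, t, rfl, hu, hw⟩ := exists_longest hc
    have hwb := hl.of_mem (x := w) (by simp)
    by_cases hs : ∃ a b, concat a b = some w ∧ IsChain G (u ++ [a])
    · obtain ⟨a, b, hab, ha⟩ := hs
      have hb : 0 < b.length := by
        by_contra hb
        rw [concat_of_right_length (by omega) hab] at hw
        exact hw ha
      have hal := (ha.of_mem (x := a) (by simp)).1
      refine (hx ⟨(v, u ++ a :: b :: t), (isBarTerm_split hab hal hb hwb.2).1 hl⟩).2
        ⟨u, a, b, w, t, hab, rfl, rfl, rfl, hu, hw, ha, not_isChain_of_nonTip hab hwb.2⟩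
    -- The initial chain is nonempty, as an empty one is continued by the first arrow of w. Its last
    -- entry e satisfies ew ∉ ⟨W⟩, so merging e and w gives a bar term, the partner of x.
    · have h1 : ¬ ∀ s e m, u = s ++ [e] → concat e w = some m → InTipIdeal G m :=
        fun h => hs (R.exists_split_of_inTipIdeal hu hl h)
      push Not at h1
      obtain ⟨s, e, m, rfl, hm, hmt⟩ := h1
      rw [List.append_assoc] at hw
      have hl' : IsBarTerm G v (s ++ e :: w :: t) := by
        have : (s ++ [e]) ++ w :: t = s ++ e :: w :: t := by simp
        exact this ▸ hl
      refine (hx ⟨(v, s ++ m :: t), (isBarTerm_split hm (hu.of_mem (by simp)).1 hwb.1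
        hmt).2 hl'⟩).1
        ⟨s, e, w, m, t, hm, rfl, by simp, rfl, hu.of_append,
          not_isChain_of_split hu hm hwb.1, hu, hw⟩
  · intro hc y
    constructor
    · rintro ⟨u, a, b, w, t, -, -, hx, -, -, -, -, h⟩
      rw [hx] at hc
      have : u ++ a :: b :: t = (u ++ [a, b]) ++ t := by simp
      rw [this] at hc
      exact h hc.of_append
    · rintro ⟨u, a, b, w, t, -, -, -, hx, -, h, -⟩
      rw [hx, List.append_cons] at hc
      exact h hc.of_append

end BranchRelations

end Chains

end Toupie

end

noncomputable section

namespace Toupie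

open QPath

/-! ### The differential of the monomial bar construction -/

section MonomialDifferential

variable {k V : Type*} [Field k] [Quiver V]

variable (k) in
/-- `[l] ↦ [u|l]`. -/
def appendLin (u : List (QPath V)) : (List (QPath V) →₀ k) →ₗ[k] (List (QPath V) →₀ k) :=
  Finsupp.linearCombination k fun l => Finsupp.single (u ++ l) 1

theorem appendLin_single (u l : List (QPath V)) :
    appendLin k u (Finsupp.single l 1) = Finsupp.single (u ++ l) 1 := by
  simp [appendLin]

theorem appendLin_appendLin (u u' : List (QPath V)) (x : List (QPath V) →₀ k) :
    appendLin k u (appendLin k u' x) = appendLin k (u ++ u') x :=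
  apply_eq_of_support (f := appendLin k u ∘ₗ appendLin k u') fun l _ => by
    rw [LinearMap.comp_apply, appendLin_single, appendLin_single, appendLin_single,
      List.append_assoc]

variable [LinearOrder (QPath V)]
  {G : Set (PathAlgebra k V)}

open Classical in
variable (G) in
/-- The product of two paths in the monomial algebra `kQ/⟨W⟩`. -/
def tipMul (a b : QPath V) : Option (QPath V) := (concat a b).filter (NonTip G ·)

theorem tipMul_eq_some_iff {a b m : QPath V} :
    tipMul G a b = some m ↔ concat a b = some m ∧ NonTip G m := by
  simp [tipMul, Option.filter_eq_some_iff]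

theorem tipMul_eq_none {a b m : QPath V} (h : concat a b = some m) (hm : InTipIdeal G m) :
    tipMul G a b = none := by
  simp [tipMul, h, NonTip, hm]

theorem tipMul_assoc (a b c : QPath V) :
    (tipMul G a b).bind (fun m => tipMul G m c) = (tipMul G b c).bind (fun m => tipMul G a m) := by
  ext p
  simp only [Option.bind_eq_some_iff, tipMul_eq_some_iff]
  constructor
  · rintro ⟨m, ⟨h1, -⟩, h2, h3⟩
    obtain ⟨y, hy, hy'⟩ := concat_assoc_left h1 h2
    exact ⟨y, ⟨hy, h3.right hy'⟩, hy', h3⟩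
  · rintro ⟨m, ⟨h1, -⟩, h2, h3⟩
    obtain ⟨y, hy, hy'⟩ := concat_assoc_right h1 h2
    exact ⟨y, ⟨hy, h3.left hy'⟩, hy', h3⟩

variable (G) in
/-- `[b|t] ↦ [ab|t]`, with the product of the monomial algebra. -/
def headMul (a : QPath V) : (List (QPath V) →₀ k) →ₗ[k] (List (QPath V) →₀ k) :=
  Finsupp.linearCombination k fun l => match l with
    | [] => 0
    | b :: t => (tipMul G a b).elim 0 fun m => Finsupp.single (m :: t) 1

variable (G) in
/-- The differential of the bar construction of the monomial algebra. -/
def monoD : List (QPath V) → (List (QPath V) →₀ k)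
  | [] => 0
  | a :: l => -headMul G a (Finsupp.single l 1) - appendLin k [a] (monoD l)

variable (G) in
/-- The linear extension of `monoD`. -/
def monoDLin : (List (QPath V) →₀ k) →ₗ[k] (List (QPath V) →₀ k) :=
  Finsupp.linearCombination k (monoD G)

theorem headMul_nil (a : QPath V) :
    headMul G a (Finsupp.single [] 1 : List (QPath V) →₀ k) = 0 := by
  simp [headMul]

theorem headMul_cons (a b : QPath V) (t : List (QPath V)) :
    headMul G a (Finsupp.single (b :: t) (1 : k)) =
      (tipMul G a b).elim 0 fun m => Finsupp.single (m :: t) 1 := by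
  simp [headMul]

theorem monoDLin_single (l : List (QPath V)) :
    monoDLin G (Finsupp.single l 1) = monoD G l := by
  simp [monoDLin]

theorem monoDLin_cons (a : QPath V) (x : List (QPath V) →₀ k) :
    monoDLin G (appendLin k [a] x) = -headMul G a x - appendLin k [a] (monoDLin G x) :=
  apply_eq_of_support (f := monoDLin G ∘ₗ appendLin k [a])
    (g := -headMul G a - appendLin k [a] ∘ₗ monoDLin G) fun l _ => by
      rw [LinearMap.comp_apply, appendLin_single, monoDLin_single, LinearMap.sub_apply,
        LinearMap.comp_apply, monoDLin_single]
      rfl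

theorem headMul_headMul (a b : QPath V) (x : List (QPath V) →₀ k) :
    headMul G a (headMul G b x) = (tipMul G a b).elim 0 fun m => headMul G m x := by
  refine (apply_eq_of_support (f := headMul G a ∘ₗ headMul G b)
    (g := (tipMul G a b).elim 0 fun m => headMul G m) fun l _ => ?_).trans ?_
  · cases l with
    | nil => cases h : tipMul G a b <;> simp [headMul_nil]
    | cons c t =>
      have h := congrArg (fun o : Option (QPath V) => o.elim (0 : List (QPath V) →₀ k)
        fun m => Finsupp.single (m :: t) 1) (tipMul_assoc (G := G) a b c)
      rw [LinearMap.comp_apply, headMul_cons]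
      cases h1 : tipMul G a b <;> cases h2 : tipMul G b c <;>
        simp only [h1, h2, Option.bind_none, Option.bind_some, Option.elim_none,
          Option.elim_some] at h ⊢
      · rw [map_zero, LinearMap.zero_apply]
      · rw [headMul_cons, ← h, LinearMap.zero_apply]
      · rw [headMul_cons, h, map_zero]
      · rw [headMul_cons, headMul_cons, h]
  · cases tipMul G a b <;> rfl

theorem headMul_appendLin (a b : QPath V) (x : List (QPath V) →₀ k) :
    headMul G a (appendLin k [b] x) = (tipMul G a b).elim 0 fun m => appendLin k [m] x := by
  refine (apply_eq_of_support (f := headMul G a ∘ₗ appendLin k [b])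
    (g := (tipMul G a b).elim 0 fun m => appendLin k [m]) fun l _ => ?_).trans ?_
  · rw [LinearMap.comp_apply, appendLin_single, List.singleton_append, headMul_cons]
    cases tipMul G a b <;> simp [appendLin_single]
  · cases tipMul G a b <;> rfl

theorem monoDLin_headMul (a : QPath V) (x : List (QPath V) →₀ k) :
    monoDLin G (headMul G a x) = headMul G a (monoDLin G x) :=
  apply_eq_of_support (f := monoDLin G ∘ₗ headMul G a) (g := headMul G a ∘ₗ monoDLin G)
    fun l _ => by
      rw [LinearMap.comp_apply, LinearMap.comp_apply, monoDLin_single]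
      cases l with
      | nil => simp [headMul_nil, monoD]
      | cons b t =>
        rw [headMul_cons, monoD, map_sub, map_neg, headMul_headMul, headMul_appendLin]
        cases tipMul G a b with
        | none => simp
        | some m => simp [monoDLin_single, monoD]

/-- By associativity, multiplying the head of a list from the left commutes with d; so the two mixed
terms in d² cancel, and the rest is the induction hypothesis. -/
theorem monoDLin_monoD (l : List (QPath V)) :
    monoDLin G (monoD G l : List (QPath V) →₀ k) = 0 := by
  induction l with
  | nil => simp [monoD]
  | cons a l ih =>
    rw [monoD, map_sub, map_neg, monoDLin_headMul, monoDLin_cons, monoDLin_single, ih]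
    simp

theorem headMul_single_apply_ne_zero {a : QPath V} {l l' : List (QPath V)}
    (h : headMul G a (Finsupp.single l (1 : k)) l' ≠ 0) :
    ∃ b t m, l = b :: t ∧ concat a b = some m ∧ NonTip G m ∧ l' = m :: t := by
  cases l with
  | nil => simp [headMul_nil] at h
  | cons b t =>
    rw [headMul_cons] at h
    cases hm : tipMul G a b with
    | none => simp [hm] at h
    | some m =>
      rw [hm, Option.elim_some] at h
      obtain ⟨h1, h2⟩ := tipMul_eq_some_iff.1 hm
      refine ⟨b, t, m, rfl, h1, h2, ?_⟩
      by_contra hl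
      exact h (Finsupp.single_eq_of_ne hl)

theorem exists_of_monoD_ne_zero {l l' : List (QPath V)}
    (h : (monoD G l : List (QPath V) →₀ k) l' ≠ 0) : ∃ u a b m t, l = u ++ a :: b :: t ∧
      concat a b = some m ∧ NonTip G m ∧ l' = u ++ m :: t := by
  induction l generalizing l' with
  | nil => simp [monoD] at h
  | cons a l ih =>
    rw [monoD, Finsupp.sub_apply, Finsupp.neg_apply] at h
    by_cases h1 : headMul G a (Finsupp.single l (1 : k)) l' = 0
    · rw [h1, neg_zero, zero_sub, neg_ne_zero] at h
      obtain ⟨l'', h2, h3⟩ := exists_of_apply_ne_zero h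
      rw [appendLin_single] at h3
      obtain ⟨u, x, y, m, t, rfl, h4, h5, rfl⟩ := ih h2
      refine ⟨a :: u, x, y, m, t, rfl, h4, h5, ?_⟩
      by_contra hl
      exact h3 (Finsupp.single_eq_of_ne hl)
    · obtain ⟨b, t, m, rfl, h2, h3, rfl⟩ := headMul_single_apply_ne_zero h1
      exact ⟨[], a, b, m, t, rfl, h2, h3, rfl⟩

theorem monoD_cons_of_eq_none {a b : QPath V} {t : List (QPath V)} (h : tipMul G a b = none) :
    monoD G (a :: b :: t) = -appendLin k [a] (monoD G (b :: t)) := by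
  rw [monoD, headMul_cons, h]
  simp

/-- The consecutive products of the entries of the list are zero in the monomial algebra. -/
def IsZeroChain (G : Set (PathAlgebra k V)) (l : List (QPath V)) : Prop :=
  List.IsChain (fun a b => tipMul G a b = none) l

theorem IsAttached.isZeroChain {l : List (QPath V)} (h : IsAttached G l) : IsZeroChain G l :=
  h.imp fun _ _ ⟨_, h1, h2⟩ => tipMul_eq_none h1 h2

/-- All faces that multiply two entries of [u|a] vanish, and d picks up a sign at each entry of `u`
that it passes. -/
theorem IsZeroChain.monoD_append {u t : List (QPath V)} {a : QPath V}
    (h : IsZeroChain G (u ++ [a])) :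
    (monoD G (u ++ a :: t) : List (QPath V) →₀ k) =
      (-1 : k) ^ u.length • appendLin k u (monoD G (a :: t)) := by
  induction u with
  | nil =>
    have : appendLin k ([] : List (QPath V)) = LinearMap.id :=
      Finsupp.lhom_ext' fun l => LinearMap.ext_ring (by simp [appendLin])
    simp [this]
  | cons x u ih =>
    have h2 : ∃ y r, u ++ a :: t = y :: r ∧ tipMul G x y = none := by
      cases u with
      | nil =>
        exact ⟨a, t, rfl, (List.isChain_cons_cons.1 h).1⟩
      | cons y u => exact ⟨y, u ++ a :: t, rfl, (List.isChain_cons_cons.1 h).1⟩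
    obtain ⟨y, r, h3, h4⟩ := h2
    have h5 : IsZeroChain G (u ++ [a]) := by
      unfold IsZeroChain at h ⊢
      rw [List.cons_append] at h
      exact h.tail
    rw [List.cons_append, h3, monoD_cons_of_eq_none h4, ← h3, ih h5, map_smul,
      appendLin_appendLin, List.length_cons, pow_succ]
    simp

theorem IsZeroChain.monoD_eq_zero {l : List (QPath V)} (h : IsZeroChain G l) :
    (monoD G l : List (QPath V) →₀ k) = 0 := by
  rcases List.eq_nil_or_concat l with rfl | ⟨u, a, rfl⟩
  · rfl
  · rw [List.concat_eq_append] at h ⊢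
    rw [h.monoD_append]
    simp [monoD, headMul_nil]

/-- No other face produces the same list: entries have positive length, so contracting at another
place changes the length of an entry where the lists should agree. -/
theorem monoD_apply_face {u t : List (QPath V)} {a b m : QPath V} (h : tipMul G a b = some m)
    (hpos : ∀ x ∈ u ++ a :: b :: t, 0 < x.length) :
    (monoD G (u ++ a :: b :: t) : List (QPath V) →₀ k) (u ++ m :: t) =
      (-1 : k) ^ (u.length + 1) := by
  have hcons : ∀ (a c : QPath V) (x : List (QPath V) →₀ k) l,
      appendLin k [a] x (c :: l) ≠ 0 → a = c := by
    intro a c x l h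
    obtain ⟨l', -, h'⟩ := exists_of_apply_ne_zero h
    rw [appendLin_single] at h'
    by_contra hac
    exact h' (Finsupp.single_eq_of_ne fun e => hac (List.cons.inj e).1.symm)
  induction u with
  | nil =>
    have hab := concat_length (tipMul_eq_some_iff.1 h).1
    have hb := hpos b (by simp)
    rw [List.nil_append, List.nil_append, monoD, headMul_cons, h, Finsupp.sub_apply,
      Finsupp.neg_apply]
    have : appendLin k [a] (monoD G (b :: t)) (m :: t) = 0 := by
      by_contra hne
      rw [hcons _ _ _ _ hne] at hab
      omega
    rw [this]
    simp
  | cons x u ih =>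
    have hx : headMul G x (Finsupp.single (u ++ a :: b :: t) (1 : k)) (x :: (u ++ m :: t)) = 0 := by
      by_contra hne
      obtain ⟨c, s, n, h1, h2, -, h3⟩ := headMul_single_apply_ne_zero hne
      have h4 := concat_length h2
      have h5 : 0 < c.length := hpos c (by simp [h1])
      rw [(List.cons.inj h3).1] at h4
      omega
    have happ : ∀ l, appendLin k [x] (monoD G (u ++ a :: b :: t)) (x :: l) =
        (monoD G (u ++ a :: b :: t) : List (QPath V) →₀ k) l := fun l =>
      apply_eq_of_support (f := Finsupp.lapply (x :: l) ∘ₗ appendLin k [x])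
        (g := Finsupp.lapply l) fun l' _ => by
          classical
          simp [appendLin_single, Finsupp.single_apply]
    rw [List.cons_append, List.cons_append, monoD, Finsupp.sub_apply, Finsupp.neg_apply, hx, happ,
      ih fun y hy => hpos y (List.mem_cons_of_mem _ hy), List.length_cons, pow_succ _ (u.length + 1)]
    simp

end MonomialDifferential

/-! ### The differential of the bar construction -/

section BarDifferential

variable {k V : Type*} [Field k] [Quiver V] [LinearOrder (QPath V)] {G : Set (PathAlgebra k V)}

variable (G) in
/-- The linear extension of `l ↦ [l]`. -/
def barLin (v : V) : (List (QPath V) →₀ k) →ₗ[k] Bar G :=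
  Finsupp.linearCombination k (bar G v)

variable (G) in
/-- The linear extension of `q ↦ [q]`. -/
def barPath (v : V) : PathAlgebra k V →ₗ[k] Bar G :=
  (Finsupp.linearCombination k fun q => bar G v [q] : (QPath V →₀ k) →ₗ[k] Bar G)

theorem barLin_single (v : V) (l : List (QPath V)) :
    barLin G v (Finsupp.single l 1) = bar G v l := by
  simp [barLin]

theorem barPath_ofPath (v : V) (q : QPath V) : barPath G v (ofPath k q) = bar G v [q] :=
  (Finsupp.linearCombination_single k _ _).trans (one_smul _ _)

/-- The bar term `[w_1|⋯|w_n]` that starts at `v`. -/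
def IsBarTerm.term {v : V} {l : List (QPath V)} (h : IsBarTerm G v l) : BarTerm G := ⟨(v, l), h⟩

theorem bar_of_isBarTerm {v : V} {l : List (QPath V)} (h : IsBarTerm G v l) :
    bar G v l = Finsupp.single h.term 1 := by
  rw [bar, dif_pos h]
  rfl

theorem bar_apply [DecidableEq V] [DecidableEq (List (QPath V))] (v : V) (l : List (QPath V))
    (c : BarTerm G) : bar G v l c = if v = c.1.1 ∧ l = c.1.2 then 1 else 0 := by
  classical
  by_cases h : IsBarTerm G v l
  · rw [bar_of_isBarTerm h, Finsupp.single_apply]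
    exact if_congr (Subtype.ext_iff.trans Prod.ext_iff) rfl rfl
  · rw [bar, dif_neg h, if_neg]
    · rfl
    · rintro ⟨rfl, rfl⟩
      exact h c.2

theorem barLin_apply_self (x : List (QPath V) →₀ k) (c : BarTerm G) :
    barLin G c.1.1 x c = x c.1.2 :=
  apply_eq_of_support (f := Finsupp.lapply c ∘ₗ barLin G c.1.1) (g := Finsupp.lapply c.1.2)
    fun l _ => by
      classical
      simp [barLin_single, bar_apply, Finsupp.single_apply]

theorem exists_of_barLin_ne_zero {v : V} {x : List (QPath V) →₀ k} {c : BarTerm G}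
    (h : barLin G v x c ≠ 0) : c.1.1 = v ∧ x c.1.2 ≠ 0 := by
  classical
  obtain ⟨l, h1, h2⟩ := exists_of_apply_ne_zero h
  rw [barLin_single, bar_apply] at h2
  have h3 : v = c.1.1 ∧ l = c.1.2 := by
    by_contra h3
    exact h2 (if_neg h3)
  exact ⟨h3.1.symm, h3.2 ▸ h1⟩

theorem isBarTerm_of_monoD_ne_zero {v : V} {l l' : List (QPath V)} (hl : IsBarTerm G v l)
    (h : (monoD G l : List (QPath V) →₀ k) l' ≠ 0) :
    IsBarTerm G v l' ∧ l'.length + 1 = l.length := by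
  obtain ⟨u, a, b, m, t, rfl, h1, h2, rfl⟩ := exists_of_monoD_ne_zero h
  refine ⟨(isBarTerm_split h1 (hl.of_mem (by simp)).1 (hl.of_mem (by simp)).1 h2).2 hl, ?_⟩
  simp
  omega

variable [Fintype V] {I : TwoSidedIdeal (PathAlgebra k V)} {o ω : V}

theorem barD_bar {v : V} {l : List (QPath V)} (h : IsBarTerm G v l) :
    barD I G (bar G v l) = faces I G v [] l := by
  rw [bar_of_isBarTerm h]
  exact (Finsupp.linearCombination_single k _ _).trans (one_smul _ _)

theorem barD_singleton (v : V) (q : QPath V) : barD I G (bar G v [q]) = 0 := by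
  by_cases h : IsBarTerm G v [q]
  · rw [barD_bar h]
    simp [faces]
  · rw [bar, dif_neg h, map_zero]

theorem barD_barPath (v : V) (x : PathAlgebra k V) : barD I G (barPath G v x) = 0 :=
  lin_eq_of_supp (f := barD I G ∘ₗ barPath G v) (g := 0) fun q _ => by
    rw [LinearMap.comp_apply, barPath_ofPath, barD_singleton]
    rfl

namespace BranchRelations

variable (R : BranchRelations G I o ω)
include R

/-- The hypothesis excludes just the products that are tips of non-monomial relations. Any other
product of two paths is the same in A as in the monomial algebra: a path in `NonTip`, or zero. -/
theorem contract_eq {v : V} {u t : List (QPath V)} {a b : QPath V}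
    (h : ∀ m, concat a b = some m → NonTip G m ∨ MonoDiv G m) :
    contract I G v u a b t =
      barLin G v (appendLin k u (headMul G a (Finsupp.single (b :: t) 1))) := by
  rw [contract, R.normalForm_eq, ofPath_mul, pathMul, headMul_cons]
  cases hm : concat a b with
  | none =>
    have : tipMul G a b = none := by simp [tipMul, hm]
    rw [this, Option.elim_none, Option.elim_none, map_zero, map_zero, map_zero]
    rfl
  | some m =>
    by_cases hn : NonTip G m
    · rw [tipMul_eq_some_iff.2 ⟨hm, hn⟩, Option.elim_some, Option.elim_some, R.reduce_of_nonTip hn,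
        supp_ofPath, Finset.sum_singleton, coeff_ofPath_self, one_smul, appendLin_single,
        barLin_single]
    · rw [tipMul_eq_none hm (not_not.1 hn), Option.elim_some, Option.elim_none,
        reduce_of_monoDiv ((h m hm).resolve_left hn), map_zero, map_zero]
      rfl

theorem faces_eq {v : V} {u l : List (QPath V)}
    (h : ∀ s a b t m, u ++ l = s ++ a :: b :: t → concat a b = some m →
      NonTip G m ∨ MonoDiv G m) :
    faces I G v u l = (-1 : k) ^ u.length • barLin G v (appendLin k u (monoD G l)) := by
  induction l generalizing u with
  | nil => simp [faces, monoD]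
  | cons a l ih =>
    cases l with
    | nil => simp [faces, monoD, headMul_nil]
    | cons b t =>
      have e : (monoD G (a :: b :: t) : List (QPath V) →₀ k) =
        -headMul G a (Finsupp.single (b :: t) 1) - appendLin k [a] (monoD G (b :: t)) := rfl
      rw [faces, ih (by rwa [List.append_assoc, List.singleton_append]), e,
        R.contract_eq (h u a b t · rfl), map_sub, map_sub, map_neg, map_neg,
        appendLin_appendLin, smul_sub, List.length_append, List.length_singleton, pow_succ]
      simp only [mul_neg, mul_one, neg_smul, smul_neg]
      rw [← sub_eq_add_neg]

theorem barD_eq {v : V} {l : List (QPath V)} (hl : IsBarTerm G v l)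
    (h : ∀ s a b t m, l = s ++ a :: b :: t → concat a b = some m →
      NonTip G m ∨ MonoDiv G m) :
    barD I G (bar G v l) = barLin G v (monoD G l) := by
  rw [barD_bar hl, R.faces_eq (u := []) (l := l) h, List.length_nil, pow_zero, one_smul]
  congr 1
  exact apply_eq_of_support (f := appendLin k []) (g := LinearMap.id) fun l _ =>
    appendLin_single [] l

/-- A path that can be preceded by one of positive length does not start at `o`, so it is not a
branch. -/
theorem monoDiv_of_left {c m : QPath V} (h : InTipIdeal G m) (hc : 0 < c.length)
    (he : c.tgt = m.src) : MonoDiv G m := by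
  refine (R.inTipIdeal_iff.1 h).resolve_right ?_
  rintro ⟨g, hg, hn, ht⟩
  have := R.noIn c (he.trans (R.gens.branches g hg hn m ht.1).1)
  omega

theorem monoDiv_of_right {c m : QPath V} (h : InTipIdeal G m) (hc : 0 < c.length)
    (he : m.tgt = c.src) : MonoDiv G m := by
  refine (R.inTipIdeal_iff.1 h).resolve_right ?_
  rintro ⟨g, hg, hn, ht⟩
  have := R.noOut c (he.symm.trans (R.gens.branches g hg hn m ht.1).2)
  omega

theorem nonTip_or_monoDiv {v : V} {s t : List (QPath V)} {a b m : QPath V}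
    (hl : IsBarTerm G v (s ++ a :: b :: t)) (h : (s ++ a :: b :: t).length ≠ 2)
    (hm : concat a b = some m) : NonTip G m ∨ MonoDiv G m := by
  refine or_iff_not_imp_left.2 fun hn => ?_
  rw [NonTip, not_not] at hn
  cases t with
  | cons c t =>
    refine R.monoDiv_of_right hn (hl.of_mem (x := c) (by simp)).1 ((concat_tgt hm).trans ?_)
    rw [List.append_cons] at hl
    exact hl.meet
  | nil =>
    rcases List.eq_nil_or_concat s with rfl | ⟨s, c, rfl⟩
    · simp at h
    · refine R.monoDiv_of_left hn (hl.of_mem (x := c) (by simp)).1 (Eq.trans ?_ (concat_src hm).symm)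
      rw [List.concat_eq_append, List.append_assoc] at hl
      exact hl.meet

theorem barD_eq_of_length {v : V} {l : List (QPath V)} (hl : IsBarTerm G v l)
    (h : l.length ≠ 2) : barD I G (bar G v l) = barLin G v (monoD G l) :=
  R.barD_eq hl fun s a b t m e hm => by
    subst e
    exact R.nonTip_or_monoDiv hl h hm

theorem barD_eq_of_nonTip {v : V} {u t : List (QPath V)} {a b m : QPath V}
    (hl : IsBarTerm G v (u ++ a :: b :: t)) (hab : concat a b = some m) (hm : NonTip G m) :
    barD I G (bar G v (u ++ a :: b :: t)) = barLin G v (monoD G (u ++ a :: b :: t)) := by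
  by_cases h : (u ++ a :: b :: t).length = 2
  · have hu : u = [] := by
      rw [List.length_append, List.length_cons, List.length_cons] at h
      exact List.length_eq_zero_iff.1 (by omega)
    have ht : t = [] := by
      rw [List.length_append, List.length_cons, List.length_cons] at h
      exact List.length_eq_zero_iff.1 (by omega)
    subst hu ht
    refine R.barD_eq hl fun s a' b' t m' e hm' => ?_
    have hs : s = [] := by
      have := congrArg List.length e
      simp at this
      exact List.length_eq_zero_iff.1 (by omega)
    subst hs
    simp only [List.nil_append, List.cons.injEq] at e
    obtain ⟨rfl, rfl, -⟩ := e
    rw [hab, Option.some_inj] at hm'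
    exact Or.inl (hm' ▸ hm)
  · exact R.barD_eq_of_length hl h

theorem barD_pair {v : V} {a b m : QPath V} (hl : IsBarTerm G v [a, b])
    (hm : concat a b = some m) :
    barD I G (bar G v [a, b]) = -barPath G v (reduce G (ofPath k m)) := by
  rw [barD_bar hl, faces, faces, contract, R.normalForm_eq, ofPath_mul_of_concat hm]
  · simp only [List.length_nil, zero_add, pow_one, add_zero, neg_smul, one_smul, List.nil_append]
    rfl
  · simp

/-- Both orders of multiplication give the normal form of abc, with opposite signs. If ab ∈ ⟨W⟩,
then, as c follows, ab contains a monomial relation and abc is zero too; similarly for bc. -/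
theorem barD_barD_triple {v : V} {a b c : QPath V} (hl : IsBarTerm G v [a, b, c]) :
    barD I G (barD I G (bar G v [a, b, c])) = 0 := by
  obtain ⟨m, hm⟩ := exists_concat (IsBarTerm.meet (u := []) hl)
  obtain ⟨n, hn⟩ := exists_concat (IsBarTerm.meet (u := [a]) (t := []) hl)
  have ha := hl.of_mem (x := a) (by simp)
  have hb := hl.of_mem (x := b) (by simp)
  have hc := hl.of_mem (x := c) (by simp)
  obtain ⟨p, hp⟩ := exists_concat (a := m) (b := c) ((concat_tgt hm).trans (concat_meet hn))
  obtain ⟨n', hn', hp'⟩ := concat_assoc_left hm hp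
  rw [hn, Option.some_inj] at hn'
  subst hn'
  have h1 : barD I G (barLin G v (headMul G a (Finsupp.single [b, c] 1))) =
      -barPath G v (reduce G (ofPath k p)) := by
    rw [headMul_cons]
    by_cases hmt : NonTip G m
    · rw [tipMul_eq_some_iff.2 ⟨hm, hmt⟩, Option.elim_some, barLin_single]
      exact R.barD_pair ((isBarTerm_split (u := []) hm ha.1 hb.1 hmt).2 hl) hp
    · rw [NonTip, not_not] at hmt
      rw [tipMul_eq_none hm hmt, Option.elim_none, reduce_of_monoDiv, map_zero, map_zero, map_zero,
        neg_zero]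
      exact (R.monoDiv_of_right hmt hc.1 (concat_meet hp)).of_divides
        ((Divides.refl m).concat_right hp)
  have h2 : barD I G (barLin G v (appendLin k [a] (headMul G b (Finsupp.single [c] 1)))) =
      -barPath G v (reduce G (ofPath k p)) := by
    rw [headMul_cons]
    by_cases hnt : NonTip G n
    · rw [tipMul_eq_some_iff.2 ⟨hn, hnt⟩, Option.elim_some, appendLin_single, barLin_single]
      exact R.barD_pair ((isBarTerm_split (u := [a]) hn hb.1 hc.1 hnt).2 hl) hp'
    · rw [NonTip, not_not] at hnt
      rw [tipMul_eq_none hn hnt, Option.elim_none, reduce_of_monoDiv, map_zero, map_zero, map_zero,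
        map_zero, neg_zero]
      exact (R.monoDiv_of_left hnt ha.1 (concat_meet hp')).of_divides
        ((Divides.refl n).concat_left hp')
  have e : (monoD G [a, b, c] : List (QPath V) →₀ k) =
      -headMul G a (Finsupp.single [b, c] 1) - appendLin k [a] (-headMul G b (Finsupp.single [c] 1) -
        appendLin k [b] (-headMul G c (Finsupp.single [] 1) - appendLin k [c] 0)) := rfl
  rw [R.barD_eq_of_length hl (by simp), e, headMul_nil]
  simp only [map_sub, map_neg, map_zero, h1, h2, neg_zero, sub_zero]
  abel

theorem barD_barD (x : Bar G) : barD I G (barD I G x) = 0 := by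
  refine linearMap_apply_eq_zero (f := barD I G ∘ₗ barD I G) fun c _ => ?_
  obtain ⟨⟨v, l⟩, hl⟩ := c
  change barD I G (barD I G (Finsupp.single hl.term 1)) = 0
  rw [← bar_of_isBarTerm hl]
  match l, hl with
  | [], hl => simp [barD_bar hl, faces]
  | [q], hl => rw [barD_singleton, map_zero]
  | [a, b], hl =>
    obtain ⟨m, hm⟩ := exists_concat (IsBarTerm.meet (u := []) hl)
    rw [R.barD_pair hl hm, map_neg, barD_barPath, neg_zero]
  | [a, b, c], hl => exact R.barD_barD_triple hl
  -- From length four on, neither of the two differentials meets the exceptional length two, so the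
  -- monomial identity applies.
  | a :: b :: c :: e :: t, hl =>
    rw [R.barD_eq_of_length hl (by simp)]
    have := apply_eq_of_support (f := barD I G ∘ₗ barLin G v) (g := barLin G v ∘ₗ monoDLin G)
      (v := monoD G (a :: b :: c :: e :: t)) fun l' hl' => by
        obtain ⟨h1, h2⟩ := isBarTerm_of_monoD_ne_zero hl hl'
        rw [LinearMap.comp_apply, LinearMap.comp_apply, barLin_single, monoDLin_single,
          R.barD_eq_of_length h1]
        simp at h2
        omega
    rw [LinearMap.comp_apply, LinearMap.comp_apply, monoDLin_monoD, map_zero] at this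
    exact this

end BranchRelations

end BarDifferential

end Toupie

end

noncomputable section

namespace Toupie

open QPath

/-! ### The Anick matching of the bar construction -/

section AnickMatching

variable {k V : Type*} [Field k] [Quiver V] [LinearOrder (QPath V)] {G : Set (PathAlgebra k V)}

theorem single_eq_bar (c : BarTerm G) : (Finsupp.single c 1 : Bar G) = bar G c.1.1 c.1.2 :=
  (bar_of_isBarTerm c.2).symm

theorem exists_of_barPath_ne_zero {v : V} {x : PathAlgebra k V} {c : BarTerm G}
    (h : barPath G v x c ≠ 0) : c.1.1 = v ∧ ∃ q, c.1.2 = [q] ∧ coeff x q ≠ 0 := by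
  classical
  by_contra hc
  refine h (lin_eq_of_supp (f := Finsupp.lapply c ∘ₗ barPath G v) (g := 0) fun q hq => ?_)
  rw [LinearMap.comp_apply, barPath_ofPath, Finsupp.lapply_apply, bar_apply, if_neg]
  · rfl
  · rintro ⟨h1, h2⟩
    exact hc ⟨h1.symm, q, h2.symm, mem_supp.1 hq⟩

theorem IsChain.isAttached {l : List (QPath V)} (h : IsChain G l) : IsAttached G l := by
  refine List.isChain_iff_forall_rel_of_append_cons_cons.2 fun {a b u t} e => ?_
  subst e
  have e : u ++ a :: b :: t = (u ++ [a, b]) ++ t := by simp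
  rw [e] at h
  obtain ⟨m, hm, hmt, -⟩ := (isChain_append_pair_iff.1 h.of_append).2.2.2
  exact ⟨m, hm, hmt⟩

theorem neg_inv_neg_one_pow (n : ℕ) : -((-1 : k) ^ (n + 1))⁻¹ = (-1) ^ n := by
  have h : (-1 : k) ^ n * (-1) ^ n = 1 := by rw [← mul_pow]; simp
  rw [pow_succ, mul_neg_one, neg_inv, neg_neg]
  exact inv_eq_of_mul_eq_one_left h

/-- A list whose entries belong to a chain, continued by a left factor of the next entry. -/
theorem IsAttached.split {u t : List (QPath V)} {a b c w m : QPath V}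
    (h : IsAttached G (u ++ w :: c :: t)) (hw : concat a b = some w) (hm : concat b c = some m)
    (ha : IsChain G (u ++ [a])) : IsAttached G (u ++ a :: m :: t) := by
  unfold IsAttached at h ⊢
  rw [List.isChain_append_cons_cons] at h ⊢
  obtain ⟨-, ⟨n, hn, hnt⟩, ht⟩ := h
  refine ⟨ha.isAttached, ?_, ?_⟩
  · obtain ⟨y, hy, hy'⟩ := concat_assoc_left hw hn
    rw [hm, Option.some_inj] at hy
    subst hy
    exact ⟨n, hy', hnt⟩
  · cases t with
    | nil => exact List.isChain_singleton _
    | cons e t =>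
      rw [List.isChain_cons_cons] at ht ⊢
      obtain ⟨⟨n, hn, hnt⟩, ht⟩ := ht
      obtain ⟨x, hx⟩ := exists_concat (a := m) (b := e) ((concat_tgt hm).trans (concat_meet hn))
      obtain ⟨y, hy, hy'⟩ := concat_assoc_left hm hx
      rw [hn, Option.some_inj] at hy
      subst hy
      exact ⟨⟨x, hx, hnt.concat_left hy'⟩, ht⟩

/-- A chain `[w₀|w₁]` comes from a relation with tip `w₀ w₁`. -/
theorem exists_relation_of_isChain {w₀ w₁ : QPath V} (h : IsChain G [w₀, w₁]) :
    w₀.length = 1 ∧ ∃ t g, concat w₀ w₁ = some t ∧ g ∈ G ∧ IsTip g t := by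
  obtain ⟨h0, -, h1, m, hm, hmt, hmin⟩ := (isChain_append_pair_iff (u := [])).1 h
  have h0' := (isChain_singleton_iff.1 h0).1
  obtain ⟨s, ⟨g, hg, hs⟩, x, y, hx, hy, hxy, -⟩ := exists_tip_of_minimal hm hmt hmin h1
  have := concat_length hxy
  rw [concat_of_left_length (by omega) hx] at hm
  exact ⟨h0', s, g, hm, hg, hs⟩

variable [Fintype V] {I : TwoSidedIdeal (PathAlgebra k V)} {o ω : V}

namespace BranchRelations

variable (R : BranchRelations G I o ω)
include R

theorem wt_barD_cases {x y : BarTerm G} (h : wt (barD I G) x y ≠ 0) :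
    (∃ a b m q, x.1.2 = [a, b] ∧ concat a b = some m ∧ y.1.2 = [q] ∧
      coeff (reduce G (ofPath k m)) q ≠ 0 ∧ y.1.1 = x.1.1) ∨
    (y.1.1 = x.1.1 ∧ (monoD G x.1.2 : List (QPath V) →₀ k) y.1.2 ≠ 0) := by
  rw [wt, single_eq_bar] at h
  obtain ⟨⟨v, l⟩, hl⟩ := x
  dsimp only at h ⊢
  by_cases h2 : l.length = 2
  · obtain ⟨a, b, rfl⟩ := List.length_eq_two.1 h2
    obtain ⟨m, hm⟩ := exists_concat (IsBarTerm.meet (u := []) hl)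
    rw [R.barD_pair hl hm, Finsupp.neg_apply, neg_ne_zero] at h
    obtain ⟨h3, q, h4, h5⟩ := exists_of_barPath_ne_zero h
    exact Or.inl ⟨a, b, m, q, rfl, hm, h4, h5, h3⟩
  · rw [R.barD_eq_of_length hl h2] at h
    exact Or.inr (exists_of_barLin_ne_zero h)

theorem wt_barD_of_mem {x y : BarTerm G} {u t : List (QPath V)} {a b w : QPath V}
    (hw : concat a b = some w) (hv : x.1.1 = y.1.1) (hx : x.1.2 = u ++ a :: b :: t)
    (hy : y.1.2 = u ++ w :: t) : wt (barD I G) x y = (-1) ^ (u.length + 1) := by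
  have hxl : IsBarTerm G x.1.1 (u ++ a :: b :: t) := hx ▸ x.2
  have hyl : IsBarTerm G y.1.1 (u ++ w :: t) := hy ▸ y.2
  have hn := (hyl.of_mem (x := w) (by simp)).2
  rw [wt, single_eq_bar, hx, R.barD_eq_of_nonTip hxl hw hn, hv, barLin_apply_self, hy]
  exact monoD_apply_face (tipMul_eq_some_iff.2 ⟨hw, hn⟩) fun c hc => (hxl.of_mem hc).1

theorem barD_homog {x y : BarTerm G} (h : wt (barD I G) x y ≠ 0) : x.deg = y.deg + 1 := by
  rcases R.wt_barD_cases h with ⟨a, b, m, q, h1, -, h2, -⟩ | ⟨-, h1⟩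
  · rw [BarTerm.deg, BarTerm.deg, h1, h2]
    rfl
  · exact (isBarTerm_of_monoD_ne_zero x.2 h1).2.symm

/-- Let z = [u|a|b|t]. A contraction inside the chain [u|a] is zero, the contraction of a and b
gives y, and one further to the right keeps [u|a] as an initial chain, whereas that of y is only u.
-/
theorem barD_descent {z y y' : BarTerm G} (hM : AnickMatching G z y)
    (h : wt (barD I G) z y' ≠ 0) (h' : ¬ AnickMatching G z y') :
    y'.deg - chainPrefix G y'.1.2 < y.deg - chainPrefix G y.1.2 := by
  have hM' := hM
  obtain ⟨u, a, b, w, t, hw, hv, hz, hy, hu, hwc, ha, hab⟩ := hM'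
  have hyl : IsBarTerm G y.1.1 (u ++ w :: t) := hy ▸ y.2
  have hn := (hyl.of_mem (x := w) (by simp)).2
  have hne : ¬ (y'.1.1 = z.1.1 ∧ y'.1.2 = u ++ w :: t) := fun e => by
    have : y' = y := Subtype.ext (Prod.ext (e.1.trans hv) (e.2.trans hy.symm))
    exact h' (this ▸ hM)
  have hdeg : y'.deg = y.deg := by
    have h1 := R.barD_homog h
    have h2 : wt (barD I G) z y ≠ 0 := by
      rw [R.wt_barD_of_mem hw hv hz hy]
      exact pow_ne_zero _ (neg_ne_zero.2 one_ne_zero)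
    have h3 := R.barD_homog h2
    omega
  have hlt : u.length + 1 ≤ chainPrefix G y'.1.2 := by
    rcases R.wt_barD_cases h with ⟨a', b', m, q, h1, hm, h2, hq, hv'⟩ | ⟨hv', h1⟩
    -- In degree two the only face is the normal form of w = ab. As w is in `NonTip`, this is y
    -- itself.
    · exfalso
      rw [hz] at h1
      have hl := congrArg List.length h1
      simp only [List.length_append, List.length_cons, List.length_nil] at hl
      have hu0 : u = [] := List.length_eq_zero_iff.1 (by omega)
      have ht0 : t = [] := List.length_eq_zero_iff.1 (by omega)
      subst hu0 ht0
      simp only [List.nil_append, List.cons.injEq, and_true] at h1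
      obtain ⟨rfl, rfl⟩ := h1
      rw [hw, Option.some_inj] at hm
      subst hm
      rw [R.reduce_of_nonTip hn] at hq
      have hqw := mem_supp.2 hq
      rw [supp_ofPath, Finset.mem_singleton] at hqw
      exact hne ⟨hv', by rw [h2, hqw]; rfl⟩
    · obtain ⟨u', a', b', m, t', h2, hm, hmn, h3⟩ := exists_of_monoD_ne_zero h1
      rw [hz] at h2
      have e1 : u ++ a :: b :: t = (u ++ [a]) ++ b :: t := by simp
      have e2 : u' ++ a' :: b' :: t' = (u' ++ [a', b']) ++ t' := by simp
      rcases lt_trichotomy u'.length u.length with hl | hl | hl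
      · exfalso
        have hp : u' ++ [a', b'] <+: u ++ [a] := by
          refine List.prefix_of_prefix_length_le (l₃ := u ++ a :: b :: t) ?_ ?_ ?_
          · rw [h2, e2]; exact List.prefix_append _ _
          · rw [e1]; exact List.prefix_append _ _
          · simp; omega
        obtain ⟨r, hr⟩ := hp
        rw [← hr] at ha
        exact not_isChain_of_nonTip hm hmn ha.of_append
      · exfalso
        obtain ⟨rfl, h4⟩ := List.append_inj h2 hl.symm
        simp only [List.cons.injEq] at h4
        obtain ⟨rfl, rfl, rfl⟩ := h4
        rw [hw, Option.some_inj] at hm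
        subst hm
        exact hne ⟨hv', h3⟩
      · have hp : u ++ [a] <+: u' := by
          refine List.prefix_of_prefix_length_le (l₃ := u ++ a :: b :: t) ?_ ?_ ?_
          · rw [e1]; exact List.prefix_append _ _
          · rw [h2]; exact List.prefix_append _ _
          · simp; omega
        obtain ⟨r, rfl⟩ := hp
        rw [h3, List.append_assoc]
        have := le_chainPrefix (t := r ++ m :: t') ha
        rwa [List.length_append, List.length_singleton] at this
  have h1 : chainPrefix G y.1.2 = u.length := by rw [hy, chainPrefix_eq hu hwc]
  have h2 : u.length < y.deg := by
    rw [BarTerm.deg, hy]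
    simp
  omega

/-- The measure counts the entries after the longest initial chain. -/
theorem descendingMatching : DescendingMatching (barD I G) (AnickMatching G) BarTerm.deg
    (fun c => c.deg - chainPrefix G c.1.2) (fun c => IsChain G c.1.2) where
  homog _ _ h := R.barD_homog h
  sq := R.barD_barD
  weight_ne x y := by
    rintro ⟨u, a, b, w, t, hw, hv, hx, hy, -⟩
    rw [R.wt_barD_of_mem hw hv hx hy]
    exact pow_ne_zero _ (neg_ne_zero.2 one_ne_zero)
  matching _ _ _ _ h h' e := h.eq h' e
  descent _ _ _ := R.barD_descent
  critical_iff := R.isCritical_iff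

/-! ### The splitting algorithm -/

/-- The first step of the splitting algorithm. -/
theorem anick_split {v : V} {u t : List (QPath V)} {a b w : QPath V}
    (hl : IsBarTerm G v (u ++ w :: t)) (hatt : IsAttached G (u ++ w :: t))
    (hw : concat a b = some w) (hb : 0 < b.length) (ha : IsChain G (u ++ [a])) :
    anickH I G (bar G v (u ++ w :: t)) = (-1 : k) ^ u.length • bar G v (u ++ a :: b :: t) +
      anickH I G (barLin G v (appendLin k (u ++ [a]) (headMul G b (Finsupp.single t 1)))) ∧
    anickP I G (bar G v (u ++ w :: t)) =
      anickP I G (barLin G v (appendLin k (u ++ [a]) (headMul G b (Finsupp.single t 1)))) := by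
  have hn := (hl.of_mem (x := w) (by simp)).2
  have hap := (ha.of_mem (x := a) (by simp)).1
  have hzl := (isBarTerm_split hw hap hb hn).1 hl
  have hM : AnickMatching G hzl.term hl.term :=
    ⟨u, a, b, w, t, hw, rfl, rfl, rfl, ha.of_append, not_isChain_of_split ha hw hb, ha,
      not_isChain_of_nonTip hw hn⟩
  have hwt : wt (barD I G) hzl.term hl.term = (-1) ^ (u.length + 1) :=
    R.wt_barD_of_mem hw rfl rfl rfl
  have hd := R.descendingMatching.apply_single_of_mem hM
  -- Attachedness kills the faces inside t, and those inside the chain [u|a] vanish as well. Only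
  -- the products ab and b·(head of t) remain.
  have ht : (monoD G t : List (QPath V) →₀ k) = 0 := by
    refine IsZeroChain.monoD_eq_zero (IsAttached.isZeroChain ?_)
    rw [List.append_cons] at hatt
    exact (List.isChain_append.1 hatt).2.1
  have e1 : (monoD G (a :: b :: t) : List (QPath V) →₀ k) =
    -headMul G a (Finsupp.single (b :: t) 1) - appendLin k [a]
      (-headMul G b (Finsupp.single t 1) - appendLin k [b] (monoD G t)) := rfl
  rw [ht, map_zero, sub_zero, headMul_cons, tipMul_eq_some_iff.2 ⟨hw, hn⟩, Option.elim_some,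
    map_neg, sub_neg_eq_add] at e1
  rw [hwt, ← bar_of_isBarTerm hzl, ← bar_of_isBarTerm hl, R.barD_eq_of_nonTip hzl hw hn,
    ha.isAttached.isZeroChain.monoD_append, e1, map_smul, map_add, map_add, map_neg, map_neg,
    appendLin_single, barLin_single, appendLin_appendLin, smul_add, smul_neg, pow_succ,
    mul_neg_one, neg_smul, add_right_inj] at hd
  have h1 := R.descendingMatching.morseH_single_of_mem hM
  have h2 := R.descendingMatching.morseP_single_of_mem hM
  have hs : (-1 : k) ^ u.length * (-1) ^ u.length = 1 := by rw [← mul_pow]; simp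
  rw [hwt, neg_inv_neg_one_pow, ← bar_of_isBarTerm hzl, ← bar_of_isBarTerm hl, ← hd, map_smul,
    smul_add, smul_smul, hs, one_smul] at h1
  rw [hwt, neg_inv_neg_one_pow, ← bar_of_isBarTerm hzl, ← bar_of_isBarTerm hl, ← hd, map_smul,
    smul_smul, hs, one_smul] at h2
  exact ⟨h1, h2⟩

theorem anickH_of_isChain {v : V} {l : List (QPath V)} (hl : IsBarTerm G v l)
    (h : IsChain G l) : anickH I G (bar G v l) = 0 := by
  rw [bar_of_isBarTerm hl]
  exact R.descendingMatching.morseH_single_of_not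
    fun z => (R.descendingMatching.critical_not (x := hl.term) h z).2

theorem anickP_of_isChain {v : V} {l : List (QPath V)} (hl : IsBarTerm G v l)
    (h : IsChain G l) : anickP I G (bar G v l) = tor G v l := by
  classical
  rw [bar_of_isBarTerm hl, tor, dif_pos ⟨hl, h⟩]
  refine (R.descendingMatching.morseP_single_of_not
    fun z => (R.descendingMatching.critical_not (x := hl.term) h z).2).trans ?_
  ext c
  rw [Finsupp.subtypeDomain_apply, Finsupp.single_apply]
  refine Eq.trans ?_ (Finsupp.single_apply (a := (⟨⟨(v, l), hl⟩, h⟩ : Chain G)) (a' := c)).symm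
  exact if_congr ⟨fun e => Subtype.ext e, fun e => congrArg Subtype.val e⟩ rfl rfl

/-- Each step of the procedure is one use of `anick_split`. The test bc = 0 in A agrees with bc ∈
⟨W⟩: as a precedes bc, the path bc is not a branch. -/
theorem splitting_spec {v : V} {l : List (QPath V)} {γs : List (Bar G)} {Γ : Tor G}
    (h : Splitting I G v l γs Γ) (hl : IsBarTerm G v l) (hatt : IsAttached G l) :
    anickH I G (bar G v l) = γs.sum ∧ anickP I G (bar G v l) = Γ := by
  induction h with
  | chain l h => exact ⟨R.anickH_of_isChain hl h, R.anickP_of_isChain hl h⟩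
  | last l u a b _ hm =>
    obtain ⟨⟨w, hw, rfl, -, hb, ha⟩, -⟩ := hm
    have := R.anick_split hl hatt hw hb ha
    rw [headMul_nil, map_zero, map_zero, map_zero, map_zero, add_zero] at this
    rwa [List.sum_singleton]
  | zero l u a b c t _ hm hbc =>
    obtain ⟨⟨w, hw, rfl, -, hb, ha⟩, -⟩ := hm
    have := R.anick_split hl hatt hw hb ha
    obtain ⟨m, hm⟩ := exists_concat (a := b) (b := c) ((concat_tgt hw).symm.trans hl.meet)
    have hmt : InTipIdeal G m := by
      by_contra hmt
      rw [ofPath_mul_of_concat hm] at hbc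
      exact R.ofPath_not_mem_of_nonTip hmt hbc
    rw [headMul_cons, tipMul_eq_none hm hmt, Option.elim_none, map_zero, map_zero, map_zero,
      map_zero, add_zero] at this
    rwa [List.sum_singleton]
  | step l u a b c m t γs Γ _ hm hbc hmc _ ih =>
    obtain ⟨⟨w, hw, rfl, hap, hb, ha⟩, -⟩ := hm
    have := R.anick_split hl hatt hw hb ha
    have hmn : NonTip G m := by
      intro hmt
      rw [ofPath_mul_of_concat hmc] at hbc
      exact hbc (R.ofPath_mem_of_monoDiv (R.monoDiv_of_left hmt hap
        ((concat_meet hw).trans (concat_src hmc).symm)))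
    have hwn := (hl.of_mem (x := w) (by simp)).2
    have hcp := (hl.of_mem (x := c) (by simp)).1
    have hl1 : IsBarTerm G v (u ++ a :: m :: t) := by
      have h1 := (isBarTerm_split hw hap hb hwn).1 hl
      rw [List.append_cons] at h1 ⊢
      exact (isBarTerm_split hmc hb hcp hmn).2 h1
    rw [headMul_cons, tipMul_eq_some_iff.2 ⟨hmc, hmn⟩, Option.elim_some, appendLin_single,
      barLin_single, List.append_assoc, List.singleton_append] at this
    obtain ⟨h1, h2⟩ := ih hl1 (hatt.split hw hmc ha)
    rw [List.sum_cons, ← h1, ← h2]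
    exact this

/-- Attachedness, which each step preserves, allows the entry after the longest initial chain to be
split. A step keeps the number of entries and lengthens that chain. -/
theorem exists_splitting {v : V} {l : List (QPath V)} (hl : IsBarTerm G v l)
    (hatt : IsAttached G l) : ∃ γs Γ, Splitting I G v l γs Γ := by
  induction hn : l.length - chainPrefix G l using Nat.strong_induction_on generalizing l with
  | _ n ih =>
  by_cases hc : IsChain G l
  · exact ⟨_, _, .chain l hc⟩
  obtain ⟨u, w, t, rfl, hu, hwc⟩ := exists_longest hc
  obtain ⟨a, b, hw, ha⟩ := R.exists_split_of_inTipIdeal hu hl fun s e m hs hm => by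
    subst hs
    rw [List.append_assoc, List.singleton_append] at hatt
    obtain ⟨m', hm', hmt⟩ := (List.isChain_append_cons_cons.1 hatt).2.1
    rw [hm, Option.some_inj] at hm'
    exact hm' ▸ hmt
  have hap := (ha.of_mem (x := a) (by simp)).1
  have hb : 0 < b.length := by
    by_contra hb
    rw [concat_of_right_length (by omega) hw] at hwc
    exact hwc ha
  -- Every admissible place is the end of the longest initial chain, so there is only one and it is
  -- the largest.
  have hmax : IsMaxSplit G (u ++ w :: t) u a b t := by
    refine ⟨⟨w, hw, rfl, hap, hb, ha⟩, ?_⟩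
    rintro u' a' b' t' ⟨w', hw', e, -, hb', ha'⟩
    rw [(eq_of_longest e hu ha'.of_append hwc (not_isChain_of_split ha' hw' hb')).1]
  cases t with
  | nil => exact ⟨_, _, .last _ u a b hc hmax⟩
  | cons c t =>
    by_cases hbc : ofPath k b * ofPath k c ∈ I
    · exact ⟨_, _, .zero _ u a b c t hc hmax hbc⟩
    · obtain ⟨m, hm⟩ := exists_concat (a := b) (b := c) ((concat_tgt hw).symm.trans hl.meet)
      have hmn : NonTip G m := by
        intro hmt
        rw [ofPath_mul_of_concat hm] at hbc
        exact hbc (R.ofPath_mem_of_monoDiv (R.monoDiv_of_left hmt hap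
          ((concat_meet hw).trans (concat_src hm).symm)))
      have hwn := (hl.of_mem (x := w) (by simp)).2
      have hcp := (hl.of_mem (x := c) (by simp)).1
      have hl1 : IsBarTerm G v (u ++ a :: m :: t) := by
        have h1 := (isBarTerm_split hw hap hb hwn).1 hl
        rw [List.append_cons] at h1 ⊢
        exact (isBarTerm_split hm hb hcp hmn).2 h1
      have h1 := chainPrefix_eq (t := c :: t) hu hwc
      have h2 := le_chainPrefix (t := m :: t) ha
      rw [List.append_assoc, List.singleton_append, List.length_append,
        List.length_singleton] at h2
      have hlt : (u ++ a :: m :: t).length - chainPrefix G (u ++ a :: m :: t) < n := by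
        rw [← hn, h1]
        simp only [List.length_append, List.length_cons]
        omega
      obtain ⟨γs, Γ, h⟩ := ih _ hlt hl1 (hatt.split hw hm ha) rfl
      exact ⟨_, _, .step _ u a b c m t γs Γ hc hmax hbc hm h⟩

/-! ### The chains of length two -/

/-- The zigzag stops after its dotted arrow, since [q] is the only face of [a|b] up to sign. -/
theorem anick_singleton {v : V} {a b q : QPath V} (hq : concat a b = some q) (hn : NonTip G q)
    (hv : q.src = v) (ha : a.length = 1) (hb : 0 < b.length) :
    anickH I G (bar G v [q]) = bar G v [a, b] ∧ anickP I G (bar G v [q]) = 0 := by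
  have hl : IsBarTerm G v ([] ++ [q]) :=
    ⟨hv, by have := concat_length hq; omega, hn, trivial⟩
  have := R.anick_split hl (List.isChain_singleton _) hq hb
    (isChain_singleton_iff.2 ⟨ha, hn.left hq⟩)
  rw [headMul_nil, map_zero, map_zero, map_zero, map_zero, add_zero, List.length_nil, pow_zero,
    one_smul] at this
  exact this

theorem reduce_ofPath_of_isTip {g : PathAlgebra k V} (hg : g ∈ G) {t : QPath V}
    (ht : IsTip g t) : reduce G (ofPath k t) = ofPath k t - g := by
  rcases R.gens.monomial_or g hg with ⟨p, rfl⟩ | hn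
  · have := isTip_ofPath.1 ht
    subst this
    rw [R.reduce_relation hg, sub_self]
  · exact R.reduce_of_isTip hg hn ht

theorem mem_supp_of_mem_reduce {g : PathAlgebra k V} (hg : g ∈ G) {t q : QPath V}
    (ht : IsTip g t) (hq : q ∈ supp (reduce G (ofPath k t))) : q ∈ supp g ∧ NonTip G q := by
  have hn := R.nonTip_of_mem_supp_reduce _ q hq
  refine ⟨?_, hn⟩
  rw [R.reduce_ofPath_of_isTip hg ht, mem_supp, coeff_sub] at hq
  have hqt : q ≠ t := by
    rintro rfl
    exact hn ⟨q, ⟨g, hg, ht⟩, Divides.refl q⟩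
  rw [show coeff (ofPath k t) q = 0 from Finsupp.single_eq_of_ne hqt, zero_sub, neg_ne_zero] at hq
  exact mem_supp.2 hq

theorem barD_of_isChain {v : V} {l : List (QPath V)} (hl : IsBarTerm G v l) (h : IsChain G l)
    (h2 : l.length ≠ 2) : barD I G (bar G v l) = 0 := by
  rw [R.barD_eq_of_length hl h2, h.isAttached.isZeroChain.monoD_eq_zero, map_zero]

theorem anickI_single (c : Chain G) : anickI I G (Finsupp.single c 1) =
    bar G c.1.1.1 c.1.1.2 + anickH I G (barD I G (bar G c.1.1.1 c.1.1.2)) := by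
  rw [← single_eq_bar]
  exact R.descendingMatching.morseI_single c

theorem anickI_of_deg (c : Chain G) (h : c.deg ≠ 2) :
    anickI I G (Finsupp.single c 1) = Finsupp.single c.1 1 := by
  rw [R.anickI_single, R.barD_of_isChain c.1.2 c.2 h, map_zero, add_zero, single_eq_bar]

/-- The differential of a chain vanishes outside degree two. In degree two it is a combination of
terms [q] with q in `NonTip` of length at least two, and p kills these because they can be split
after their first arrow. -/
theorem anickD_eq_zero : anickD I G = 0 := by
  refine Finsupp.lhom_ext' fun c => LinearMap.ext_ring ?_
  change anickD I G (Finsupp.single c 1) = 0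
  refine (R.descendingMatching.morseD_single c).trans ?_
  change anickP I G _ = 0
  rw [single_eq_bar]
  obtain ⟨⟨⟨v, l⟩, hl⟩, hc⟩ := c
  change anickP I G (barD I G (bar G v l)) = 0
  by_cases h2 : l.length = 2
  · obtain ⟨w₀, w₁, rfl⟩ := List.length_eq_two.1 h2
    obtain ⟨-, t, g, ht, hg, hgt⟩ := exists_relation_of_isChain hc
    rw [R.barD_pair hl ht, map_neg, neg_eq_zero]
    refine lin_eq_of_supp (f := anickP I G ∘ₗ barPath G v) (g := 0) fun q hq => ?_
    rw [LinearMap.comp_apply, barPath_ofPath, LinearMap.zero_apply]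
    obtain ⟨h3, h4⟩ := R.mem_supp_of_mem_reduce hg hgt hq
    have h5 := R.two_le_of_mem_supp hg h3
    obtain ⟨a, b, hab, ha⟩ := exists_split q (n := 1) (by omega)
    have := concat_length hab
    by_cases hv : q.src = v
    · exact (R.anick_singleton hab h4 hv ha (by omega)).2
    · rw [bar, dif_neg fun h => hv h.1, map_zero]
  · rw [R.barD_of_isChain hl hc h2, map_zero]

theorem src_eq_of_mem_supp {g : PathAlgebra k V} (hg : g ∈ G) {t q : QPath V} (ht : IsTip g t)
    (hq : q ∈ supp g) : q.src = t.src := by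
  rcases R.gens.monomial_or g hg with ⟨p, rfl⟩ | hn
  · rw [supp_ofPath, Finset.mem_singleton] at hq
    rw [hq, isTip_ofPath.1 ht]
  · rw [(R.gens.branches g hg hn q hq).1, (R.gens.branches g hg hn t ht.1).1]

theorem nonTip_of_ne_tip {g : PathAlgebra k V} (hg : g ∈ G) {t q : QPath V} (ht : IsTip g t)
    (hq : q ∈ supp g) (hqt : q ≠ t) : NonTip G q := by
  rcases R.gens.monomial_or g hg with ⟨p, rfl⟩ | hn
  · rw [supp_ofPath, Finset.mem_singleton] at hq
    exact (hqt (hq.trans (isTip_ofPath.1 ht).symm)).elim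
  · exact R.nonTip_of_mem_supp hg hn hq ht hqt

/-- Let K(q) = [p₁q|p₂q] split q after its first arrow. Then d[w₀|w₁] = −[t − g] and h[q] = K(q) on
the support of t − g, so i[w₀|w₁] = K(t) − K(t − g) = K(g). For monomial g one has t − g = 0. -/
theorem anickI_pair (c : Chain G) {w₀ w₁ : QPath V} (hc : c.1.1.2 = [w₀, w₁]) :
    ∃ t : QPath V, concat w₀ w₁ = some t ∧ (∃! g, g ∈ G ∧ IsTip g t) ∧
      ∀ g ∈ G, IsTip g t → ∃ p₁ p₂ : QPath V → QPath V,
        (∀ q ∈ supp g, (p₁ q).length = 1 ∧ concat (p₁ q) (p₂ q) = some q ∧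
          IsBarTerm G c.1.1.1 [p₁ q, p₂ q]) ∧
        anickI I G (Finsupp.single c 1) =
          ∑ q ∈ supp g, coeff g q • bar G c.1.1.1 [p₁ q, p₂ q] := by
  have hch : IsChain G [w₀, w₁] := hc ▸ c.2
  have hl : IsBarTerm G c.1.1.1 [w₀, w₁] := hc ▸ c.1.2
  obtain ⟨h0, t, g₀, ht, hg₀, hgt₀⟩ := exists_relation_of_isChain hch
  refine ⟨t, ht, ⟨g₀, ⟨hg₀, hgt₀⟩, fun g hg => R.tip_unique hg.1 hg₀ hg.2 hgt₀⟩,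
    fun g hg hgt => ?_⟩
  -- The splitting is made total by an arbitrary value at trivial paths; paths in the support of g
  -- have length at least two.
  have hsplit : ∀ q : QPath V, ∃ a b, 1 ≤ q.length → concat a b = some q ∧ a.length = 1 := by
    intro q
    by_cases hq : 1 ≤ q.length
    · obtain ⟨a, b, h⟩ := exists_split q hq
      exact ⟨a, b, fun _ => h⟩
    · exact ⟨q, q, fun h => (hq h).elim⟩
  choose p₁ p₂ hp using hsplit
  have htl := R.two_le_of_mem_supp hg hgt.1
  have ht1 := hp t (by omega)
  obtain ⟨e1, e2⟩ := concat_inj ht1.1 ht (ht1.2.trans h0.symm)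
  have hpos : ∀ q ∈ supp g, 0 < (p₂ q).length := fun q hq => by
    have h1 := R.two_le_of_mem_supp hg hq
    have h2 := hp q (by omega)
    have h3 := concat_length h2.1
    omega
  have hsrc : ∀ q ∈ supp g, q.src = c.1.1.1 := fun q hq => by
    rw [R.src_eq_of_mem_supp hg hgt hq, concat_src ht]
    exact hl.1
  refine ⟨p₁, p₂, fun q hq => ?_, ?_⟩
  · have h1 := R.two_le_of_mem_supp hg hq
    have h2 := hp q (by omega)
    refine ⟨h2.2, h2.1, ?_⟩
    by_cases hqt : q = t
    · subst hqt
      rw [e1, e2]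
      exact hl
    · have hn := R.nonTip_of_ne_tip hg hgt hq hqt
      exact ⟨(concat_src h2.1).symm.trans (hsrc q hq), by omega, hn.left h2.1,
        (concat_meet h2.1).symm, hpos q hq, hn.right h2.1, trivial⟩
  · let K : PathAlgebra k V →ₗ[k] Bar G :=
      (Finsupp.linearCombination k fun q => bar G c.1.1.1 [p₁ q, p₂ q] :
        (QPath V →₀ k) →ₗ[k] Bar G)
    have hK : ∀ q, K (ofPath k q) = bar G c.1.1.1 [p₁ q, p₂ q] := fun q =>
      (Finsupp.linearCombination_single k _ _).trans (one_smul _ _)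
    have h1 : anickH I G (barPath G c.1.1.1 (reduce G (ofPath k t))) =
        K (reduce G (ofPath k t)) :=
      lin_eq_of_supp (f := anickH I G ∘ₗ barPath G c.1.1.1) (g := K) fun q hq => by
        obtain ⟨h3, h4⟩ := R.mem_supp_of_mem_reduce hg hgt hq
        have h5 := R.two_le_of_mem_supp hg h3
        have h6 := hp q (by omega)
        rw [LinearMap.comp_apply, barPath_ofPath, hK]
        exact (R.anick_singleton h6.1 h4 (hsrc q h3) h6.2 (hpos q h3)).1
    have h2 : K g = ∑ q ∈ supp g, coeff g q • bar G c.1.1.1 [p₁ q, p₂ q] := rfl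
    rw [R.anickI_single, hc, R.barD_pair hl ht, map_neg, h1, R.reduce_ofPath_of_isTip hg hgt,
      map_sub, hK, e1, e2, h2]
    abel

end BranchRelations

end AnickMatching

end Toupie

end

/-! ### The main theorem. -/

theorem mainTheorem6 {k : Type*} [Field k] {V : Type*} [Quiver V] [Fintype V]
    [∀ a b : V, Finite (a ⟶ b)] [LinearOrder (Toupie.QPath V)]
    (hlen : ∀ p q : Toupie.QPath V, p.length < q.length → p < q)
    (o ω : V) (hV : Toupie.IsToupie V o ω)
    (I : TwoSidedIdeal (Toupie.PathAlgebra k V)) (hI : Toupie.IsAdmissible I)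
    (G : Set (Toupie.PathAlgebra k V)) (hG : Toupie.IsToupieGenerators o ω I G) :
    -- the paths in `NonTip(I)` form a basis of `A`
    (∀ x : Toupie.PathAlgebra k V, ∃! y, Toupie.IsNormalForm I G x y) ∧
    -- the matching is a Morse matching, and its critical vertices are the chains
    Toupie.IsMorseMatching (Toupie.barD I G) (Toupie.AnickMatching G) ∧
    (∀ x : Toupie.BarTerm G,
      Toupie.IsCritical (Toupie.AnickMatching G) x ↔ Toupie.IsChain G x.1.2) ∧
    -- there are only finitely many zigzag paths from each vertex
    (∀ x : Toupie.BarTerm G,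
      {l | Toupie.IsZigzag (Toupie.barD I G) (Toupie.AnickMatching G) x l}.Finite) ∧
    -- the differential of the Morse complex is zero
    Toupie.anickD I G = 0 ∧
    -- the strong deformation retract datum
    Toupie.IsSDR Toupie.BarTerm.deg Toupie.Chain.deg (Toupie.barD I G) 0
      (Toupie.anickP I G) (Toupie.anickI I G) (-Toupie.anickH I G) ∧
    -- `i` identifies `T_*` with the homology of the bar construction
    (∀ z : Toupie.Bar G, Toupie.barD I G z = 0 →
      ∃! y : Toupie.Tor G, ∃ b : Toupie.Bar G, z - Toupie.anickI I G y = Toupie.barD I G b) ∧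
    -- the splitting algorithm computes `h` and `p` on attached bar terms
    (∀ x : Toupie.BarTerm G, Toupie.IsAttached G x.1.2 →
      (∃ γs Γ, Toupie.Splitting I G x.1.1 x.1.2 γs Γ) ∧
      ∀ γs Γ, Toupie.Splitting I G x.1.1 x.1.2 γs Γ →
        Toupie.anickH I G (Finsupp.single x 1) = γs.sum ∧
        Toupie.anickP I G (Finsupp.single x 1) = Γ) ∧
    -- `i` is the identity on all chains but the `1`-chains
    (∀ c : Toupie.Chain G, Toupie.Chain.deg c ≠ 2 →
      Toupie.anickI I G (Finsupp.single c 1) = Finsupp.single c.1 1) ∧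
    -- the `1`-chains
    (∀ (c : Toupie.Chain G) (w₀ w₁ : Toupie.QPath V), c.1.1.2 = [w₀, w₁] →
      ∃ t : Toupie.QPath V, Toupie.QPath.concat w₀ w₁ = some t ∧
        (∃! g, g ∈ G ∧ Toupie.IsTip g t) ∧
        ∀ g ∈ G, Toupie.IsTip g t →
          ∃ p₁ p₂ : Toupie.QPath V → Toupie.QPath V,
            (∀ q ∈ Toupie.supp g, (p₁ q).length = 1 ∧
              Toupie.QPath.concat (p₁ q) (p₂ q) = some q ∧
              Toupie.IsBarTerm G c.1.1.1 [p₁ q, p₂ q]) ∧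
            Toupie.anickI I G (Finsupp.single c 1) =
              ∑ q ∈ Toupie.supp g,
                Toupie.coeff g q • Toupie.bar G c.1.1.1 [p₁ q, p₂ q]) := by
  have R : Toupie.BranchRelations G I o ω := hV.branchRelations hI hG
  have D := R.descendingMatching
  have hSDR := D.isSDR R.anickD_eq_zero
  refine ⟨R.existsUnique_isNormalForm, D.isMorseMatching, R.isCritical_iff, D.zigzag_finite,
    R.anickD_eq_zero, hSDR, fun z hz => hSDR.existsUnique_homology hz, fun x hx => ?_,
    R.anickI_of_deg, fun c w₀ w₁ hc => R.anickI_pair c hc⟩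
  rw [Toupie.single_eq_bar]
  exact ⟨R.exists_splitting x.2 hx, fun γs Γ h => R.splitting_spec h x.2 hx⟩
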